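/- Let $d\ge 1$, let $\omega\in\mathbb R^d$ have rationally independent components, let $g:\mathbb R\to\mathbb R$ be real-analytic, and let $f:(\mathbb R/2\pi\mathbb Z)^d\to\mathbb R$ be analytic in the strip $\Sigma_\xi=\{\psi\in(\mathbb C/2\pi\mathbb Z)^d: |\operatorname{Im}\psi_k|\le\xi,\ k=1,\dots,d\}$ for some $\xi>0$, with Fourier coefficients $f_\nu$, $\nu\in\mathbb Z^d$. Consider $$\varepsilon\ddot x+\dot x+\varepsilon g(x)=\varepsilon f(\omega t).\qquad (*)$$ Let $c_0\in\mathbb R$ satisfy $g(c_0)=f_0$ (the average of $f$) and $g'(c_0)\ne0$. With $|\nu|=|\nu_1|+\dots+|\nu_d|$ put $$\beta_n(\omega)=\min\{|\omega\cdot\nu| : 0<|\nu|\le 2^n,\ f_\nu\neq0\},\qquad \varepsilon_n(\omega)=2^{-n}\log\frac1{\beta_n(\omega)}$$ ($\varepsilon_n(\omega)=0$ if there is no such $\nu$), and assume $\lim_{n\to\infty}\varepsilon_n(\omega)=0$. For $R,B>0$ let $\Omega_{R,B}=\{\varepsilon\in\mathbb C: |\operatorname{Re}\varepsilon|\ge B(\operatorname{Im}\varepsilon)^2,\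 0<|\varepsilon|<2R\}$. Then there are $\varepsilon_1>0$ and $\xi'\in(0,\xi)$, independent of $B$, such that for every $B>0$, with $\varepsilon_0=\varepsilon_1\min\{B,1\}^{\alpha}$ and $\alpha=8$, there is a response solution $x(t)=c_0+u(\omega t,\varepsilon)$ of $(*)$ for all $\varepsilon\in\Omega_{\varepsilon_0,B}$. Here $u(\psi,\varepsilon)$ is $2\pi$-periodic in each $\psi_k$ and (jointly) analytic in $\psi\in\Sigma_{\xi'}$ and $\varepsilon\in\Omega_{\varepsilon_0,B}$, and $u=O(\varepsilon)$: there is $C$ (which may depend on $B$) with $|u(\psi,\varepsilon)|\le C|\varepsilon|$ on $\Sigma_{\xi'}\times\Omega_{\varepsilon_0,B}$. For complex $\varepsilon$, $g$ is understood as the sum of its Taylor series at $c_0$, and $c_0+u$ stays in a disc about $c_0$ where that series converges absolutely; for real $\varepsilon$, $x$ is real and solves $(*)$ with the original $g$. -/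

import Mathlib

open Filter Topology

noncomputable section

namespace ResponseSolution

/-- The scalar product `ω · ν` of a frequency vector and an integer vector. -/
def freqDot {d : ℕ} (ω : Fin d → ℝ) (ν : Fin d → ℤ) : ℝ := ∑ i, ω i * (ν i : ℝ)

/-- The length `|ν| = |ν₁| + ⋯ + |ν_d|` of an integer vector. -/
def modeLength {d : ℕ} (ν : Fin d → ℤ) : ℕ := ∑ i, (ν i).natAbs

/-- The frequency vector has rationally independent components. -/
def RationallyIndependent {d : ℕ} (ω : Fin d → ℝ) : Prop :=
  ∀ ν : Fin d → ℤ, ν ≠ 0 → freqDot ω ν ≠ 0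

/-- `2π`-periodicity in each variable: `f` is a function on the torus `(ℝ / 2πℤ)^d`. -/
def IsTorusPeriodic {d : ℕ} (f : (Fin d → ℝ) → ℝ) : Prop :=
  ∀ (ψ : Fin d → ℝ) (k : Fin d), f (ψ + Pi.single k (2 * Real.pi)) = f ψ

/-- The average over the torus `(ℝ / 2πℤ)^d`. -/
def torusAverage {d : ℕ} {E : Type*} [NormedAddCommGroup E] [NormedSpace ℝ E]
    (h : (Fin d → ℝ) → E) : E :=
  ((2 * Real.pi) ^ d)⁻¹ • ∫ ψ in Set.Icc (0 : Fin d → ℝ) (fun _ => 2 * Real.pi), h ψ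

/-- The Fourier coefficient `f_ν`, so that `f(ψ) = ∑_ν f_ν e^{iν·ψ}`. -/
def fourierMode {d : ℕ} (f : (Fin d → ℝ) → ℝ) (ν : Fin d → ℤ) : ℂ :=
  torusAverage fun ψ : Fin d → ℝ =>
    Complex.exp (-Complex.I * ((freqDot ψ ν : ℝ) : ℂ)) * (f ψ : ℂ)

/-- The (finite) set of the small divisors `|ω · ν|`, where `0 < |ν| ≤ 2ⁿ` and `f_ν ≠ 0`. -/
def smallDivisors {d : ℕ} (f : (Fin d → ℝ) → ℝ) (ω : Fin d → ℝ) (n : ℕ) : Set ℝ :=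
  {s | ∃ ν : Fin d → ℤ, 0 < modeLength ν ∧ modeLength ν ≤ 2 ^ n ∧ fourierMode f ν ≠ 0 ∧
    s = |freqDot ω ν|}

open Classical in
/-- `β_n(ω) = min {|ω · ν| : 0 < |ν| ≤ 2ⁿ, f_ν ≠ 0}`. If there is no such `ν`, there is no small
divisor up to that order and the value is set to `1`, which contributes `log (1 / 1) = 0`. -/
def beta {d : ℕ} (f : (Fin d → ℝ) → ℝ) (ω : Fin d → ℝ) (n : ℕ) : ℝ :=
  if (smallDivisors f ω n).Nonempty then sInf (smallDivisors f ω n) else 1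

/-- `ε_n(ω) = 2⁻ⁿ log (1 / β_n(ω))`. -/
def epsilonSeq {d : ℕ} (f : (Fin d → ℝ) → ℝ) (ω : Fin d → ℝ) (n : ℕ) : ℝ :=
  1 / 2 ^ n * Real.log (1 / beta f ω n)

/-- The closed complex strip `Σ_ξ = {ψ : |Im ψ_k| ≤ ξ for all k}`; functions on the quotient by
`2πℤ^d` are periodic functions on it. -/
def strip (d : ℕ) (ξ : ℝ) : Set (Fin d → ℂ) := {ψ | ∀ k, |(ψ k).im| ≤ ξ}

/-- `f` is (the restriction to the real torus of) a function analytic in the strip `Σ_ξ`. -/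
def IsAnalyticInStrip {d : ℕ} (f : (Fin d → ℝ) → ℝ) (ξ : ℝ) : Prop :=
  ∃ F : (Fin d → ℂ) → ℂ, AnalyticOnNhd ℂ F (strip d ξ) ∧
    ∀ ψ : Fin d → ℝ, F (fun k => (ψ k : ℂ)) = (f ψ : ℂ)

/-- The parabolic domain `Ω_{R,B} = {ε : |Re ε| ≥ B (Im ε)², 0 < |ε| < 2R}`. -/
def parabolicDomain (R B : ℝ) : Set ℂ :=
  {ε | B * ε.im ^ 2 ≤ |ε.re| ∧ 0 < ‖ε‖ ∧ ‖ε‖ < 2 * R}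

/-- The Taylor coefficients `a_p = g⁽ᵖ⁾(c₀) / p!`. -/
def taylorCoeff (g : ℝ → ℝ) (c₀ : ℝ) (p : ℕ) : ℝ := iteratedDeriv p g c₀ / (p.factorial : ℝ)

/-- The extension `z ↦ ∑_p a_p (z - c₀)^p` of `g` to complex arguments close to `c₀`. It is
used only inside a disc in which the series converges absolutely. -/
def complexExtension (g : ℝ → ℝ) (c₀ : ℝ) (z : ℂ) : ℂ :=
  ∑' p : ℕ, (taylorCoeff g c₀ p : ℂ) * (z - (c₀ : ℂ)) ^ p

/-- `x` is a solution, defined for all real times, of `ε x'' + x' + ε g(x) = ε f(ωt)`;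
here `𝕜 = ℝ` for the real equation, and `𝕜 = ℂ` for complex `ε`. -/
def IsSolution {𝕜 : Type*} [RCLike 𝕜] {d : ℕ} (g : 𝕜 → 𝕜) (f : (Fin d → ℝ) → ℝ)
    (ω : Fin d → ℝ) (ε : 𝕜) (x : ℝ → 𝕜) : Prop :=
  ∃ v w : ℝ → 𝕜, (∀ t, HasDerivAt x (v t) t) ∧ (∀ t, HasDerivAt v (w t) t) ∧
    ∀ t, ε * w t + v t + ε * g (x t) = ε * ((f (fun k => ω k * t) : ℝ) : 𝕜)

/-- The function `u(ψ, ε)` describes a family of response solutions `x(t) = c₀ + u(ωt, ε)`, with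
`u = O(ε)`, analytic for `ψ` in the strip `Σ_ξ'` and `ε` in `Ω_{R,B}`. -/
structure IsAnalyticResponse {d : ℕ} (g : ℝ → ℝ) (f : (Fin d → ℝ) → ℝ) (ω : Fin d → ℝ)
    (c₀ ξ' R B : ℝ) (u : (Fin d → ℂ) → ℂ → ℂ) : Prop where
  /-- joint analyticity -/
  analytic : AnalyticOnNhd ℂ (fun z : (Fin d → ℂ) × ℂ => u z.1 z.2)
    (strip d ξ' ×ˢ parabolicDomain R B)
  /-- `u` is a function on the strip modulo `2πℤ^d` -/
  periodic : ∀ ε ∈ parabolicDomain R B, ∀ ψ ∈ strip d ξ', ∀ k : Fin d,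
    u (ψ + Pi.single k (2 * (Real.pi : ℂ))) ε = u ψ ε
  /-- `u = O(ε)` -/
  bigO : ∃ C : ℝ, ∀ ε ∈ parabolicDomain R B, ∀ ψ ∈ strip d ξ', ‖u ψ ε‖ ≤ C * ‖ε‖
  /-- `c₀ + u` stays in a disc where the Taylor series of `g` converges absolutely -/
  mem_disc : ∃ r > 0, (Summable fun p : ℕ => |taylorCoeff g c₀ p| * r ^ p) ∧
    ∀ ε ∈ parabolicDomain R B, ∀ ψ ∈ strip d ξ', ‖u ψ ε‖ ≤ r
  /-- the equation, for complex `ε` -/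
  solution : ∀ ε ∈ parabolicDomain R B,
    IsSolution (complexExtension g c₀) f ω ε
      (fun t => (c₀ : ℂ) + u (fun k => ((ω k * t : ℝ) : ℂ)) ε)
  /-- for real `ε` the solution is real and solves the original real equation -/
  real_solution : ∀ ε : ℝ, (ε : ℂ) ∈ parabolicDomain R B →
    ∃ x : ℝ → ℝ, (∀ t, (x t : ℂ) = (c₀ : ℂ) + u (fun k => ((ω k * t : ℝ) : ℂ)) (ε : ℂ)) ∧
      IsSolution g f ω ε x

end ResponseSolution

end

/-! Put x = c₀ + y and a = g'(c₀). In Fourier modes the equation reads D(ω·ν) y_ν = ε (F - T₂(y))_ν,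
where D(σ) = iσ + ε(a - σ²), F is f minus its average, and T₂ collects the Taylor terms of g of
order at least two. Since a ≠ 0, the zero mode, with D(0) = εa, is inverted like all the others and
no separate bifurcation equation arises. The fixed point problem is solved in the Wiener algebra of
Fourier series with weight e^{ρ|ν|}.

The nonlinearity populates modes about which no arithmetic is assumed, so only bounds uniform in σ
are available for them: on the parabolic domain |D(σ)| ≳ b|ε|², hence ε/D may be as large as
1/(b|ε|). Against the derivative of the quadratic term, of size |ε|, this leaves no smallness, and a
plain contraction fails. The remedy is in `exists_divisorBounds`: if |D(σ)| < κ|ε| then |σ| ≲ |ε|,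
and as D(σ) + D(τ) - D(σ+τ) = ε(a + 2στ) has size |ε| for such σ, τ, two almost resonant frequencies
never add up to a third. With Π the projection onto almost resonant modes, Π(Πx·Πy) = 0. Moreover,
for w = (ε/D)F, the product Π(w·Πx) sees only the modes of w with frequency O(|ε|), whose total size
is O(|ε|²/b). What is left couples the non-resonant part to the resonant one by a bounded amount,
and the resonant part to the non-resonant one by a small amount; the norm ‖Πy‖ + λ‖y - Πy‖ with
large λ then gives a contraction (`IterationData.contraction`).

Arithmetic enters only through the forcing. There |ε/D(σ)| ≲ |ε|(1 + 1/σ²)/b, and ε_n → 0 gives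
|ω·ν| ≥ c e^{-η|ν|} for every η > 0 on the modes with f_ν ≠ 0 (`exists_le_abs_freqDot`), a loss
absorbed by the exponential decay of f_ν (`exists_norm_fourierMode_le`). So w = O(|ε|/b).

All powers of b balance for |ε| ≲ b⁷, a range that contains the domain with exponent 8. Analyticity
in ε passes from the resolvent, an analytic map into ℓ^∞, to the iterates and to their uniform
limit; analyticity in ψ comes from the evaluation functional. For real ε everything stays in the
closed subring of series with c_{-ν} = conj c_ν. -/

noncomputable section

namespace ResponseSolution

open scoped NNReal ENNReal lp Pointwise

set_option linter.unusedSectionVars false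

section

variable {d : ℕ} {ρ : ℝ≥0}

/-! ### The weighted Wiener algebra of the torus -/

lemma modeLength_zero : modeLength (0 : Fin d → ℤ) = 0 := by simp [modeLength]

lemma modeLength_add_le (μ ν : Fin d → ℤ) : modeLength (μ + ν) ≤ modeLength μ + modeLength ν := by
  unfold modeLength
  rw [← Finset.sum_add_distrib]
  exact Finset.sum_le_sum fun i _ => Int.natAbs_add_le _ _

/-- The exponential weight `e^{ρ|ν|}`. -/
def modeWeight (ρ : ℝ≥0) (ν : Fin d → ℤ) : ℝ := Real.exp (ρ * modeLength ν)

lemma modeWeight_pos (ν : Fin d → ℤ) : 0 < modeWeight ρ ν := Real.exp_pos _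

lemma modeWeight_ne_zero (ν : Fin d → ℤ) : (modeWeight ρ ν : ℂ) ≠ 0 := by
  exact_mod_cast (modeWeight_pos ν).ne'

lemma one_le_modeWeight (ν : Fin d → ℤ) : 1 ≤ modeWeight ρ ν :=
  Real.one_le_exp (by positivity)

@[simp] lemma modeWeight_zero : modeWeight ρ (0 : Fin d → ℤ) = 1 := by
  simp [modeWeight, modeLength_zero]

lemma modeWeight_add_le (μ ν : Fin d → ℤ) :
    modeWeight ρ (μ + ν) ≤ modeWeight ρ μ * modeWeight ρ ν := by
  unfold modeWeight
  rw [← Real.exp_add, ← mul_add]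
  gcongr
  exact_mod_cast modeLength_add_le μ ν

/-- The Wiener algebra of Fourier series `∑ c_ν e^{iν·ψ}` with `∑ |c_ν| e^{ρ|ν|} < ∞`; the
underlying `ℓ¹` sequence consists of the weighted coefficients `c_ν e^{ρ|ν|}`. -/
def Wiener (d : ℕ) (_ρ : ℝ≥0) : Type := lp (fun _ : Fin d → ℤ => ℂ) 1

namespace Wiener

instance : NormedAddCommGroup (Wiener d ρ) :=
  inferInstanceAs (NormedAddCommGroup (lp (fun _ : Fin d → ℤ => ℂ) 1))
instance : NormedSpace ℂ (Wiener d ρ) :=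
  inferInstanceAs (NormedSpace ℂ (lp (fun _ : Fin d → ℤ => ℂ) 1))
instance : CompleteSpace (Wiener d ρ) :=
  inferInstanceAs (CompleteSpace (lp (fun _ : Fin d → ℤ => ℂ) 1))

/-- The underlying `ℓ¹` sequence of weighted coefficients. -/
def toLp : Wiener d ρ →ₗᵢ[ℂ] lp (fun _ : Fin d → ℤ => ℂ) 1 := LinearIsometry.id

/-- The Fourier coefficients. -/
def coeff (a : Wiener d ρ) (ν : Fin d → ℤ) : ℂ := toLp a ν / modeWeight ρ ν

lemma coeff_mul_modeWeight (a : Wiener d ρ) (ν : Fin d → ℤ) :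
    a.coeff ν * modeWeight ρ ν = toLp a ν := div_mul_cancel₀ _ (modeWeight_ne_zero ν)

lemma norm_coeff_mul (a : Wiener d ρ) (ν : Fin d → ℤ) :
    ‖a.coeff ν‖ * modeWeight ρ ν = ‖toLp a ν‖ := by
  rw [← coeff_mul_modeWeight, norm_mul, Complex.norm_real, Real.norm_of_nonneg (modeWeight_pos ν).le]

lemma hasSum_norm (a : Wiener d ρ) :
    HasSum (fun ν => ‖a.coeff ν‖ * modeWeight ρ ν) ‖a‖ := by
  simp_rw [norm_coeff_mul]
  have := lp.hasSum_norm (p := 1) (by simp) (toLp a)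
  simpa using this

lemma norm_coeff_le_norm_mul (a : Wiener d ρ) (ν : Fin d → ℤ) :
    ‖a.coeff ν‖ ≤ ‖a.coeff ν‖ * modeWeight ρ ν :=
  le_mul_of_one_le_right (norm_nonneg _) (one_le_modeWeight ν)

lemma summable_norm_coeff (a : Wiener d ρ) : Summable fun ν => ‖a.coeff ν‖ :=
  a.hasSum_norm.summable.of_nonneg_of_le (fun _ => norm_nonneg _) a.norm_coeff_le_norm_mul

lemma norm_coeff_le (a : Wiener d ρ) (ν : Fin d → ℤ) : ‖a.coeff ν‖ ≤ ‖a‖ :=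
  (a.norm_coeff_le_norm_mul ν).trans
    (le_hasSum a.hasSum_norm ν fun _ _ => mul_nonneg (norm_nonneg _) (modeWeight_pos _).le)

@[ext] lemma ext {a b : Wiener d ρ} (h : ∀ ν, a.coeff ν = b.coeff ν) : a = b := by
  apply toLp.injective
  ext ν
  rw [← coeff_mul_modeWeight, h, coeff_mul_modeWeight]

/-- The element with prescribed Fourier coefficients. -/
def ofCoeff (c : (Fin d → ℤ) → ℂ) (h : Summable fun ν => ‖c ν‖ * modeWeight ρ ν) : Wiener d ρ :=
  (⟨fun ν => c ν * modeWeight ρ ν, memℓp_gen (by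
    simpa [abs_of_pos (modeWeight_pos _)] using h)⟩ : lp (fun _ : Fin d → ℤ => ℂ) 1)

@[simp] lemma coeff_ofCoeff (c : (Fin d → ℤ) → ℂ) (h) (ν : Fin d → ℤ) :
    (ofCoeff (ρ := ρ) c h).coeff ν = c ν := mul_div_cancel_right₀ _ (modeWeight_ne_zero ν)

lemma norm_eq_tsum (a : Wiener d ρ) : ‖a‖ = ∑' ν, ‖a.coeff ν‖ * modeWeight ρ ν :=
  a.hasSum_norm.tsum_eq.symm

/-- The Fourier coefficients as a linear map. -/
def coeffLM (ν : Fin d → ℤ) : Wiener d ρ →ₗ[ℂ] ℂ where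
  toFun a := a.coeff ν
  map_add' a b := by simp [coeff, add_div]
  map_smul' c a := by simp [coeff, mul_div_assoc]

@[simp] lemma coeff_add (a b : Wiener d ρ) (ν : Fin d → ℤ) :
    (a + b).coeff ν = a.coeff ν + b.coeff ν := map_add (coeffLM ν) a b
@[simp] lemma coeff_sub (a b : Wiener d ρ) (ν : Fin d → ℤ) :
    (a - b).coeff ν = a.coeff ν - b.coeff ν := map_sub (coeffLM ν) a b
@[simp] lemma coeff_neg (a : Wiener d ρ) (ν : Fin d → ℤ) :
    (-a).coeff ν = -a.coeff ν := map_neg (coeffLM ν) a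
@[simp] lemma coeff_zero (ν : Fin d → ℤ) :
    (0 : Wiener d ρ).coeff ν = 0 := map_zero (coeffLM ν)
@[simp] lemma coeff_smul (c : ℂ) (a : Wiener d ρ) (ν : Fin d → ℤ) :
    (c • a).coeff ν = c * a.coeff ν := map_smul (coeffLM ν) c a

/-- The change of variables `(ν, μ) ↦ (μ, ν - μ)`. -/
def convEquiv (d : ℕ) : (Fin d → ℤ) × (Fin d → ℤ) ≃ (Fin d → ℤ) × (Fin d → ℤ) where
  toFun p := (p.2, p.1 - p.2)
  invFun p := (p.1 + p.2, p.1)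
  left_inv p := by simp
  right_inv p := by simp

lemma summable_conv_norm (a b : Wiener d ρ) :
    Summable fun p : (Fin d → ℤ) × (Fin d → ℤ) =>
      (‖a.coeff p.2‖ * modeWeight ρ p.2) * (‖b.coeff (p.1 - p.2)‖ * modeWeight ρ (p.1 - p.2)) :=
  (convEquiv d).summable_iff.mpr (a.hasSum_norm.summable.mul_of_nonneg b.hasSum_norm.summable
    (fun _ => mul_nonneg (norm_nonneg _) (modeWeight_pos _).le)
    (fun _ => mul_nonneg (norm_nonneg _) (modeWeight_pos _).le))

lemma norm_conv_le (a b : Wiener d ρ) (ν μ : Fin d → ℤ) :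
    ‖a.coeff μ * b.coeff (ν - μ)‖ * modeWeight ρ ν ≤
      (‖a.coeff μ‖ * modeWeight ρ μ) * (‖b.coeff (ν - μ)‖ * modeWeight ρ (ν - μ)) := by
  have := modeWeight_add_le (ρ := ρ) μ (ν - μ)
  rw [add_sub_cancel] at this
  rw [norm_mul]
  calc _ ≤ ‖a.coeff μ‖ * ‖b.coeff (ν - μ)‖ * (modeWeight ρ μ * modeWeight ρ (ν - μ)) := by gcongr
    _ = _ := by ring

lemma summable_conv (a b : Wiener d ρ) (ν : Fin d → ℤ) :
    Summable fun μ => ‖a.coeff μ * b.coeff (ν - μ)‖ := by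
  refine ((summable_conv_norm a b).prod_factor ν).of_nonneg_of_le (fun _ => norm_nonneg _)
    fun μ => le_trans ?_ (norm_conv_le a b ν μ)
  exact le_mul_of_one_le_right (norm_nonneg _) (one_le_modeWeight ν)

lemma norm_tsum_conv_le (a b : Wiener d ρ) (ν : Fin d → ℤ) :
    ‖∑' μ, a.coeff μ * b.coeff (ν - μ)‖ * modeWeight ρ ν ≤
      ∑' μ, (‖a.coeff μ‖ * modeWeight ρ μ) * (‖b.coeff (ν - μ)‖ * modeWeight ρ (ν - μ)) := by
  calc _ ≤ (∑' μ, ‖a.coeff μ * b.coeff (ν - μ)‖) * modeWeight ρ ν := by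
        have := modeWeight_pos (ρ := ρ) ν
        gcongr
        exact norm_tsum_le_tsum_norm (summable_conv a b ν)
    _ = ∑' μ, ‖a.coeff μ * b.coeff (ν - μ)‖ * modeWeight ρ ν := (tsum_mul_right).symm
    _ ≤ _ := Summable.tsum_le_tsum (norm_conv_le a b ν) ((summable_conv a b ν).mul_right _)
        ((summable_conv_norm a b).prod_factor ν)

lemma summable_norm_tsum_conv (a b : Wiener d ρ) :
    Summable fun ν => ‖∑' μ, a.coeff μ * b.coeff (ν - μ)‖ * modeWeight ρ ν :=
  (summable_conv_norm a b).prod.of_nonneg_of_le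
    (fun ν => mul_nonneg (norm_nonneg _) (modeWeight_pos ν).le) (norm_tsum_conv_le a b)

instance : Mul (Wiener d ρ) :=
  ⟨fun a b => ofCoeff (fun ν => ∑' μ, a.coeff μ * b.coeff (ν - μ)) (summable_norm_tsum_conv a b)⟩

lemma coeff_mul (a b : Wiener d ρ) (ν : Fin d → ℤ) :
    (a * b).coeff ν = ∑' μ, a.coeff μ * b.coeff (ν - μ) := coeff_ofCoeff _ _ _

instance : One (Wiener d ρ) :=
  ⟨ofCoeff (Pi.single 0 1) (summable_of_ne_finset_zero (s := {0}) fun ν hν => by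
    rw [Pi.single_eq_of_ne (by simpa using hν)]; simp)⟩

lemma coeff_one (ν : Fin d → ℤ) : (1 : Wiener d ρ).coeff ν = if ν = 0 then 1 else 0 := by
  change (ofCoeff _ _).coeff ν = _
  rw [coeff_ofCoeff, Pi.single_apply]

/-- Submultiplicativity of the weight, e^{ρ|ν|} ≤ e^{ρ|μ|} e^{ρ|ν-μ|}, reduces this to a nonnegative
double series, which `convEquiv` turns into a product of two sums. -/
protected lemma norm_mul_le (a b : Wiener d ρ) : ‖a * b‖ ≤ ‖a‖ * ‖b‖ := by
  rw [norm_eq_tsum (a * b), norm_eq_tsum a, norm_eq_tsum b]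
  simp_rw [coeff_mul]
  calc _ ≤ ∑' ν, ∑' μ, (‖a.coeff μ‖ * modeWeight ρ μ) *
          (‖b.coeff (ν - μ)‖ * modeWeight ρ (ν - μ)) :=
        Summable.tsum_le_tsum (norm_tsum_conv_le a b) (summable_norm_tsum_conv a b)
          (summable_conv_norm a b).prod
    _ = ∑' p : (Fin d → ℤ) × (Fin d → ℤ), (‖a.coeff p.2‖ * modeWeight ρ p.2) *
          (‖b.coeff (p.1 - p.2)‖ * modeWeight ρ (p.1 - p.2)) :=
        ((summable_conv_norm a b).tsum_prod).symm
    _ = ∑' p : (Fin d → ℤ) × (Fin d → ℤ), (‖a.coeff p.1‖ * modeWeight ρ p.1) *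
          (‖b.coeff p.2‖ * modeWeight ρ p.2) := (convEquiv d).tsum_eq
            (fun p => (‖a.coeff p.1‖ * modeWeight ρ p.1) * (‖b.coeff p.2‖ * modeWeight ρ p.2))
    _ = _ := (Summable.tsum_mul_tsum a.hasSum_norm.summable b.hasSum_norm.summable
          (a.hasSum_norm.summable.mul_of_nonneg b.hasSum_norm.summable
    (fun _ => mul_nonneg (norm_nonneg _) (modeWeight_pos _).le)
    (fun _ => mul_nonneg (norm_nonneg _) (modeWeight_pos _).le))).symm

protected lemma mul_comm (a b : Wiener d ρ) : a * b = b * a := by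
  ext ν
  rw [coeff_mul, coeff_mul, ← (Equiv.subLeft ν).tsum_eq]
  exact tsum_congr fun μ => by simp [mul_comm]

lemma mul_add' (a b c : Wiener d ρ) : a * (b + c) = a * b + a * c := by
  ext ν
  rw [coeff_add, coeff_mul, coeff_mul, coeff_mul,
    ← (summable_conv a b ν).of_norm.tsum_add (summable_conv a c ν).of_norm]
  exact tsum_congr fun μ => by rw [coeff_add, mul_add]

lemma smul_mul' (c : ℂ) (a b : Wiener d ρ) : (c • a) * b = c • (a * b) := by
  ext ν
  rw [coeff_smul, coeff_mul, coeff_mul, ← tsum_mul_left]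
  exact tsum_congr fun μ => by rw [coeff_smul, mul_assoc]

/-- Pairing a product with a bounded sequence. -/
lemma tsum_coeff_mul_mul (a b : Wiener d ρ) (φ : (Fin d → ℤ) → ℂ) {C : ℝ} (hφ : ∀ ν, ‖φ ν‖ ≤ C) :
    ∑' ν, (a * b).coeff ν * φ ν = ∑' μ, a.coeff μ * ∑' κ, b.coeff κ * φ (μ + κ) := by
  have hs : Summable fun p : (Fin d → ℤ) × (Fin d → ℤ) =>
      a.coeff p.1 * b.coeff p.2 * φ (p.1 + p.2) := by
    refine Summable.of_norm_bounded (g := fun p => ‖a.coeff p.1‖ * ‖b.coeff p.2‖ * C)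
      ((a.summable_norm_coeff.mul_of_nonneg b.summable_norm_coeff (fun _ => norm_nonneg _)
        (fun _ => norm_nonneg _)).mul_right C) fun p => ?_
    rw [norm_mul, norm_mul]
    gcongr
    exact hφ _
  have hs' := (convEquiv d).summable_iff.mpr hs
  calc _ = ∑' ν, ∑' μ, a.coeff μ * b.coeff (ν - μ) * φ (μ + (ν - μ)) := by
        simp_rw [coeff_mul, ← tsum_mul_right, add_sub_cancel]
    _ = ∑' p : (Fin d → ℤ) × (Fin d → ℤ), a.coeff p.2 * b.coeff (p.1 - p.2) *
          φ (p.2 + (p.1 - p.2)) := (hs'.tsum_prod).symm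
    _ = ∑' p : (Fin d → ℤ) × (Fin d → ℤ), a.coeff p.1 * b.coeff p.2 * φ (p.1 + p.2) :=
        (convEquiv d).tsum_eq (fun p => a.coeff p.1 * b.coeff p.2 * φ (p.1 + p.2))
    _ = _ := by
        rw [hs.tsum_prod]
        simp_rw [mul_assoc, tsum_mul_left]

protected lemma mul_assoc (a b c : Wiener d ρ) : a * b * c = a * (b * c) := by
  ext ν
  rw [coeff_mul, coeff_mul,
    tsum_coeff_mul_mul a b (fun κ => c.coeff (ν - κ)) (fun κ => c.norm_coeff_le _)]
  refine tsum_congr fun μ => ?_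
  rw [coeff_mul]
  simp_rw [sub_sub]

protected lemma one_mul (a : Wiener d ρ) : 1 * a = a := by
  ext ν
  rw [coeff_mul, tsum_eq_single 0 fun μ hμ => by simp [coeff_one, hμ]]
  simp [coeff_one]

instance : NormedCommRing (Wiener d ρ) where
  __ := (inferInstance : NormedAddCommGroup (Wiener d ρ))
  mul_assoc := Wiener.mul_assoc
  one_mul := Wiener.one_mul
  mul_one a := by rw [Wiener.mul_comm, Wiener.one_mul]
  mul_comm := Wiener.mul_comm
  left_distrib := mul_add'
  right_distrib a b c := by rw [Wiener.mul_comm, mul_add', Wiener.mul_comm c, Wiener.mul_comm c]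
  zero_mul a := by ext ν; simp [coeff_mul]
  mul_zero a := by ext ν; simp [coeff_mul]
  norm_mul_le := Wiener.norm_mul_le

instance : NormedAlgebra ℂ (Wiener d ρ) where
  __ := Algebra.ofModule smul_mul' fun c a b => by
    rw [Wiener.mul_comm, smul_mul', Wiener.mul_comm]
  norm_smul_le := norm_smul_le

instance : NormOneClass (Wiener d ρ) := ⟨by
  rw [norm_eq_tsum, tsum_eq_single 0 fun μ hμ => by simp [coeff_one, hμ]]
  simp [coeff_one]⟩

end Wiener

end

section

variable {d : ℕ} {ρ : ℝ≥0}

namespace Wiener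

/-- Every bound for a multiplier or a projection onto modes is diagonal and goes through this
comparison. -/
lemma norm_le_of_coeff_le {a b : Wiener d ρ} {C : ℝ}
    (h : ∀ ν, ‖a.coeff ν‖ ≤ C * ‖b.coeff ν‖) : ‖a‖ ≤ C * ‖b‖ := by
  rw [norm_eq_tsum a, norm_eq_tsum b, ← tsum_mul_left]
  refine Summable.tsum_le_tsum (fun ν => ?_) a.hasSum_norm.summable
    (b.hasSum_norm.summable.mul_left C)
  rw [← mul_assoc]
  exact mul_le_mul_of_nonneg_right (h ν) (modeWeight_pos ν).le

/-! ### Fourier multipliers -/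

/-- Bounded sequences indexed by the Fourier modes. -/
abbrev Multiplier (d : ℕ) : Type := lp (fun _ : Fin d → ℤ => ℂ) ∞

/-- A bounded sequence as a multiplier. -/
def Multiplier.mk (φ : (Fin d → ℤ) → ℂ) {C : ℝ} (h : ∀ ν, ‖φ ν‖ ≤ C) : Multiplier d :=
  ⟨φ, memℓp_infty ⟨C, by rintro _ ⟨ν, rfl⟩; exact h ν⟩⟩

@[simp] lemma Multiplier.mk_apply (φ : (Fin d → ℤ) → ℂ) {C : ℝ} (h : ∀ ν, ‖φ ν‖ ≤ C)
    (ν : Fin d → ℤ) : (Multiplier.mk φ h) ν = φ ν := rfl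

lemma Multiplier.norm_apply_le (φ : Multiplier d) (ν : Fin d → ℤ) : ‖φ ν‖ ≤ ‖φ‖ :=
  lp.norm_apply_le_norm (by simp) φ ν

lemma summable_multiplier (φ : Multiplier d) (a : Wiener d ρ) :
    Summable fun ν => ‖φ ν * a.coeff ν‖ * modeWeight ρ ν := by
  refine (a.hasSum_norm.summable.mul_left ‖φ‖).of_nonneg_of_le
    (fun ν => mul_nonneg (norm_nonneg _) (modeWeight_pos _).le) fun ν => ?_
  rw [norm_mul, mul_assoc]
  exact mul_le_mul_of_nonneg_right (φ.norm_apply_le ν)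
    (mul_nonneg (norm_nonneg _) (modeWeight_pos _).le)

/-- The action of the multipliers on the Wiener algebra, as a continuous bilinear map. -/
def multiplier : Multiplier d →L[ℂ] Wiener d ρ →L[ℂ] Wiener d ρ :=
  LinearMap.mkContinuous₂ (LinearMap.mk₂ ℂ
    (fun φ a => ofCoeff (fun ν => φ ν * a.coeff ν) (summable_multiplier φ a))
    (fun φ φ' a => by ext ν; simp [add_mul]) (fun c φ a => by ext ν; simp [mul_assoc])
    (fun φ a b => by ext ν; simp [mul_add]) (fun c φ a => by ext ν; simp [mul_left_comm])) 1
    (fun φ a => by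
      rw [one_mul]
      refine norm_le_of_coeff_le fun ν => ?_
      simp only [LinearMap.mk₂_apply, coeff_ofCoeff, norm_mul]
      exact mul_le_mul_of_nonneg_right (φ.norm_apply_le ν) (norm_nonneg _))

@[simp] lemma coeff_multiplier (φ : Multiplier d) (a : Wiener d ρ) (ν : Fin d → ℤ) :
    (multiplier φ a).coeff ν = φ ν * a.coeff ν := by
  simp [multiplier]

open Classical in
/-- The indicator sequence of a set of modes. -/
def modeIndicator (s : Set (Fin d → ℤ)) : Multiplier d :=
  Multiplier.mk (C := 1) (fun ν => if ν ∈ s then 1 else 0) fun ν => by split_ifs <;> simp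

/-- Restriction of a Fourier series to a set of modes. -/
def restrict (s : Set (Fin d → ℤ)) : Wiener d ρ →L[ℂ] Wiener d ρ := multiplier (modeIndicator s)

lemma coeff_restrict_of_mem {s : Set (Fin d → ℤ)} (a : Wiener d ρ) {ν : Fin d → ℤ} (h : ν ∈ s) :
    (restrict s a).coeff ν = a.coeff ν := by
  simp [restrict, modeIndicator, h]

lemma coeff_restrict_of_notMem {s : Set (Fin d → ℤ)} (a : Wiener d ρ) {ν : Fin d → ℤ}
    (h : ν ∉ s) : (restrict s a).coeff ν = 0 := by
  simp [restrict, modeIndicator, h]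

lemma norm_restrict_le (s : Set (Fin d → ℤ)) (a : Wiener d ρ) : ‖restrict s a‖ ≤ ‖a‖ := by
  rw [← one_mul ‖a‖]
  refine norm_le_of_coeff_le fun ν => ?_
  by_cases h : ν ∈ s
  · rw [coeff_restrict_of_mem a h, one_mul]
  · rw [coeff_restrict_of_notMem a h]; simp

/-! ### Evaluation on the complex strip -/

/-- The character `e^{iν·ψ}`. -/
def character (ψ : Fin d → ℂ) (ν : Fin d → ℤ) : ℂ := Complex.exp (Complex.I * ∑ k, ν k * ψ k)

lemma character_add (ψ : Fin d → ℂ) (μ ν : Fin d → ℤ) :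
    character ψ (μ + ν) = character ψ μ * character ψ ν := by
  simp [character, ← Complex.exp_add, add_mul, Finset.sum_add_distrib, mul_add]

lemma character_zero (ψ : Fin d → ℂ) : character ψ 0 = 1 := by simp [character]

lemma norm_character_le {ψ : Fin d → ℂ} (hψ : ψ ∈ strip d ρ) (ν : Fin d → ℤ) :
    ‖character ψ ν‖ ≤ modeWeight ρ ν := by
  rw [character, Complex.norm_exp, modeWeight]
  gcongr
  have : (Complex.I * ∑ k, (ν k : ℂ) * ψ k).re = ∑ k, -((ν k : ℝ) * (ψ k).im) := by
    simp [Complex.mul_im]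
  rw [this, modeLength]
  push_cast
  rw [Finset.mul_sum]
  refine Finset.sum_le_sum fun k _ => ?_
  calc -((ν k : ℝ) * (ψ k).im) ≤ |(ν k : ℝ)| * |(ψ k).im| := by
        rw [← abs_mul]; exact neg_le_abs _
    _ ≤ |(ν k : ℝ)| * ρ := by gcongr; exact hψ k
    _ = _ := by rw [mul_comm, Nat.cast_natAbs, Int.cast_abs]

/-- The sum of the Fourier series at a point. -/
def eval (ψ : Fin d → ℂ) (a : Wiener d ρ) : ℂ := ∑' ν, a.coeff ν * character ψ ν

lemma norm_coeff_mul_character_le {ψ : Fin d → ℂ} (hψ : ψ ∈ strip d ρ) (a : Wiener d ρ)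
    (ν : Fin d → ℤ) : ‖a.coeff ν * character ψ ν‖ ≤ ‖a.coeff ν‖ * modeWeight ρ ν := by
  rw [norm_mul]
  exact mul_le_mul_of_nonneg_left (norm_character_le hψ ν) (norm_nonneg _)

lemma summable_eval {ψ : Fin d → ℂ} (hψ : ψ ∈ strip d ρ) (a : Wiener d ρ) :
    Summable fun ν => a.coeff ν * character ψ ν :=
  Summable.of_norm_bounded a.hasSum_norm.summable (norm_coeff_mul_character_le hψ a)

lemma norm_eval_le {ψ : Fin d → ℂ} (hψ : ψ ∈ strip d ρ) (a : Wiener d ρ) : ‖eval ψ a‖ ≤ ‖a‖ :=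
  tsum_of_norm_bounded a.hasSum_norm (norm_coeff_mul_character_le hψ a)

/-- Evaluation at a point of the strip as a continuous linear functional. -/
def evalCLM {ψ : Fin d → ℂ} (hψ : ψ ∈ strip d ρ) : Wiener d ρ →L[ℂ] ℂ :=
  LinearMap.mkContinuous
    { toFun := eval ψ
      map_add' := fun a b => by
        simp only [eval, coeff_add, add_mul]
        exact (summable_eval hψ a).tsum_add (summable_eval hψ b)
      map_smul' := fun c a => by
        simp only [eval, coeff_smul, mul_assoc, tsum_mul_left, RingHom.id_apply, smul_eq_mul] } 1
    fun a => by rw [one_mul]; exact norm_eval_le hψ a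

lemma evalCLM_apply {ψ : Fin d → ℂ} (hψ : ψ ∈ strip d ρ) (a : Wiener d ρ) :
    evalCLM hψ a = eval ψ a := rfl

lemma eval_one (ψ : Fin d → ℂ) : eval ψ (1 : Wiener d ρ) = 1 := by
  rw [eval, tsum_eq_single 0 fun μ hμ => by simp [coeff_one, hμ]]
  simp [coeff_one, character_zero]

lemma summable_prod_character {ψ : Fin d → ℂ} (hψ : ψ ∈ strip d ρ) (a b : Wiener d ρ) :
    Summable fun p : (Fin d → ℤ) × (Fin d → ℤ) =>
      (a.coeff p.1 * character ψ p.1) * (b.coeff p.2 * character ψ p.2) :=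
  Summable.of_norm_bounded (a.hasSum_norm.summable.mul_of_nonneg b.hasSum_norm.summable
    (fun _ => mul_nonneg (norm_nonneg _) (modeWeight_pos _).le)
    (fun _ => mul_nonneg (norm_nonneg _) (modeWeight_pos _).le)) fun p => by
      rw [norm_mul]
      exact mul_le_mul (norm_coeff_mul_character_le hψ a _) (norm_coeff_mul_character_le hψ b _)
        (norm_nonneg _) (mul_nonneg (norm_nonneg _) (modeWeight_pos _).le)

lemma eval_mul {ψ : Fin d → ℂ} (hψ : ψ ∈ strip d ρ) (a b : Wiener d ρ) :
    eval ψ (a * b) = eval ψ a * eval ψ b := by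
  have hs := summable_prod_character hψ a b
  have hs' := (convEquiv d).summable_iff.mpr hs
  symm
  calc eval ψ a * eval ψ b = _ :=
        Summable.tsum_mul_tsum (summable_eval hψ a) (summable_eval hψ b) hs
    _ = ∑' p : (Fin d → ℤ) × (Fin d → ℤ), (a.coeff p.2 * character ψ p.2) *
          (b.coeff (p.1 - p.2) * character ψ (p.1 - p.2)) := ((convEquiv d).tsum_eq (fun p =>
            (a.coeff p.1 * character ψ p.1) * (b.coeff p.2 * character ψ p.2))).symm
    _ = ∑' ν, ∑' μ, (a.coeff μ * character ψ μ) * (b.coeff (ν - μ) * character ψ (ν - μ)) :=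
        hs'.tsum_prod
    _ = eval ψ (a * b) := by
        refine tsum_congr fun ν => ?_
        rw [coeff_mul, ← tsum_mul_right]
        refine tsum_congr fun μ => ?_
        rw [mul_mul_mul_comm, ← character_add, add_sub_cancel]

lemma eval_pow {ψ : Fin d → ℂ} (hψ : ψ ∈ strip d ρ) (a : Wiener d ρ) (n : ℕ) :
    eval ψ (a ^ n) = eval ψ a ^ n := by
  induction n with
  | zero => simp [eval_one]
  | succ n ih => rw [pow_succ, eval_mul hψ, ih, pow_succ]

lemma character_add_single (ψ : Fin d → ℂ) (k : Fin d) (ν : Fin d → ℤ) :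
    character (ψ + Pi.single k (2 * (Real.pi : ℂ))) ν = character ψ ν := by
  have : ∑ j, (ν j : ℂ) * (ψ + Pi.single k (2 * (Real.pi : ℂ)) : Fin d → ℂ) j =
      ∑ j, (ν j : ℂ) * ψ j + ν k * (2 * Real.pi) := by
    simp [mul_add, Finset.sum_add_distrib, Pi.single_apply]
  rw [character, this, mul_add, Complex.exp_add, character]
  convert mul_one _
  rw [Complex.exp_eq_one_iff]
  exact ⟨ν k, by ring⟩

lemma eval_add_single (ψ : Fin d → ℂ) (k : Fin d) (a : Wiener d ρ) :
    eval (ψ + Pi.single k (2 * (Real.pi : ℂ))) a = eval ψ a := by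
  simp only [eval, character_add_single]

/-! ### Analyticity of the evaluation -/

/-- The normalized one-dimensional characters `e^{-ρ|ν_k|} e^{iν_k z}`. -/
def weightedCharacter (d : ℕ) (ρ : ℝ≥0) (k : Fin d) (z : ℂ) : Multiplier d :=
  ∑' n : ℤ, (Complex.exp (-(ρ * |(n : ℝ)| : ℝ)) * Complex.exp (Complex.I * (n * z))) •
    modeIndicator {ν | ν k = n}

lemma norm_modeIndicator_le (s : Set (Fin d → ℤ)) : ‖modeIndicator s‖ ≤ 1 := by
  refine lp.norm_le_of_forall_le zero_le_one fun ν => ?_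
  simp only [modeIndicator, Multiplier.mk_apply]
  split_ifs <;> simp

/-- On |Im z| ≤ σ the factor e^{inz} grows at most like e^{σ|n|}, against the decay e^{-ρ|n|}. The
bound is geometric as soon as σ < ρ. -/
lemma norm_weightedCharacter_term_le {k : Fin d} {σ : ℝ} {z : ℂ} (hz : |z.im| ≤ σ) (n : ℤ) :
    ‖(Complex.exp (-(ρ * |(n : ℝ)| : ℝ)) * Complex.exp (Complex.I * (n * z))) •
      modeIndicator {ν : Fin d → ℤ | ν k = n}‖ ≤ Real.exp (-(ρ - σ)) ^ n.natAbs := by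
  rw [norm_smul]
  refine (mul_le_of_le_one_right (norm_nonneg _) (norm_modeIndicator_le _)).trans ?_
  rw [← Complex.exp_add, Complex.norm_exp, ← Real.exp_nat_mul]
  gcongr
  have h1 : (n.natAbs : ℝ) = |(n : ℝ)| := by rw [Nat.cast_natAbs, Int.cast_abs]
  have h2 : -((n : ℝ) * z.im) ≤ |(n : ℝ)| * σ := by
    refine (neg_le_abs _).trans ?_
    rw [abs_mul]
    gcongr
  rw [h1]
  have h3 : (-((ρ * |(n : ℝ)| : ℝ) : ℂ) + Complex.I * (n * z)).re =
      -(ρ * |(n : ℝ)|) + -(n * z.im) := by simp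
  rw [h3]
  linarith

lemma summable_pow_natAbs {r : ℝ} (h0 : 0 ≤ r) (h1 : r < 1) : Summable fun n : ℤ => r ^ n.natAbs := by
  refine Summable.of_nat_of_neg ?_ ?_ <;> simpa using summable_geometric_of_lt_one h0 h1

/-- Weierstrass' theorem: for σ between |Im z| and ρ the series converges in the ℓ^∞ norm, uniformly
on the open strip of width σ. -/
lemma analyticAt_weightedCharacter {k : Fin d} {z : ℂ} (hz : |z.im| < ρ) :
    AnalyticAt ℂ (weightedCharacter d ρ k) z := by
  obtain ⟨σ, hσ1, hσ2⟩ := exists_between hz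
  have hopen : IsOpen {w : ℂ | |w.im| < σ} :=
    isOpen_lt (continuous_abs.comp Complex.continuous_im) continuous_const
  have := Complex.differentiableOn_tsum_of_summable_norm
    (summable_pow_natAbs (Real.exp_pos (-(ρ - σ))).le (by
      rw [Real.exp_lt_one_iff]; linarith))
    (F := fun (n : ℤ) z => (Complex.exp (-(ρ * |(n : ℝ)| : ℝ)) * Complex.exp (Complex.I * (n * z))) •
      modeIndicator {ν : Fin d → ℤ | ν k = n})
    (fun n => by fun_prop) hopen (fun n w hw => norm_weightedCharacter_term_le (le_of_lt hw) n)
  exact this.analyticAt (hopen.mem_nhds hσ1)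

lemma weightedCharacter_apply {k : Fin d} {z : ℂ} (hz : |z.im| < ρ) (ν : Fin d → ℤ) :
    weightedCharacter d ρ k z ν =
      Complex.exp (-(ρ * |(ν k : ℝ)| : ℝ)) * Complex.exp (Complex.I * (ν k * z)) := by
  have hs := Summable.of_norm_bounded
    (summable_pow_natAbs (Real.exp_pos (-(ρ - |z.im|))).le (by
      rw [Real.exp_lt_one_iff]; linarith))
    (fun n => norm_weightedCharacter_term_le (d := d) (ρ := ρ) (k := k) (le_refl |z.im|) n)
  have := (lp.evalCLM ℂ (fun _ : Fin d → ℤ => ℂ) ∞ ν).map_tsum hs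
  change lp.evalCLM ℂ (fun _ : Fin d → ℤ => ℂ) ∞ ν (weightedCharacter d ρ k z) = _
  have hev : ∀ φ : Multiplier d, lp.evalCLM ℂ (fun _ : Fin d → ℤ => ℂ) ∞ ν φ = φ ν := fun _ => rfl
  rw [weightedCharacter, this, tsum_eq_single (ν k)]
  · rw [hev, lp.coeFn_smul]
    simp [modeIndicator]
  · intro n hn
    rw [hev, lp.coeFn_smul]
    simp [modeIndicator, hn.symm]

lemma prod_multiplier_apply {ι : Type*} (s : Finset ι) (φ : ι → Multiplier d) (ν : Fin d → ℤ) :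
    (∏ i ∈ s, φ i) ν = ∏ i ∈ s, φ i ν := by
  classical
  induction s using Finset.induction_on with
  | empty => simp
  | insert i s hi ih => rw [Finset.prod_insert hi, Finset.prod_insert hi, ← ih]; rfl

lemma prod_weightedCharacter_apply {ψ : Fin d → ℂ} (hψ : ∀ k, |(ψ k).im| < ρ) (ν : Fin d → ℤ) :
    (∏ k, weightedCharacter d ρ k (ψ k)) ν = character ψ ν / modeWeight ρ ν := by
  rw [prod_multiplier_apply]
  simp_rw [weightedCharacter_apply (hψ _)]
  rw [Finset.prod_mul_distrib, ← Complex.exp_sum, ← Complex.exp_sum, ← Finset.mul_sum, character,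
    modeWeight, Complex.ofReal_exp, div_eq_mul_inv, ← Complex.exp_neg, mul_comm]
  congr 2
  simp [modeLength, Finset.mul_sum]

/-- The pairing `(φ, a) ↦ ∑ φ_ν e^{ρ|ν|} a_ν`. -/
def pairing : Multiplier d →L[ℂ] Wiener d ρ →L[ℂ] ℂ :=
  (ContinuousLinearMap.compL ℂ (Wiener d ρ) (Wiener d ρ) ℂ
    ((lp.tsumCLM ℂ (Fin d → ℤ) ℂ).comp (toLp (d := d) (ρ := ρ)).toContinuousLinearMap)).comp
    multiplier

lemma pairing_apply (φ : Multiplier d) (a : Wiener d ρ) :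
    pairing φ a = ∑' ν, toLp (multiplier φ a) ν := rfl

/-- Evaluation factors through a fixed continuous bilinear map, so its analyticity in ψ becomes that
of a finite product of one-variable functions with values in ℓ^∞. -/
lemma eval_eq_pairing {ψ : Fin d → ℂ} (hψ : ∀ k, |(ψ k).im| < ρ) (a : Wiener d ρ) :
    eval ψ a = pairing (∏ k, weightedCharacter d ρ k (ψ k)) a := by
  rw [pairing_apply, eval]
  refine tsum_congr fun ν => ?_
  rw [← coeff_mul_modeWeight, coeff_multiplier, prod_weightedCharacter_apply hψ]
  field_simp [modeWeight_ne_zero (ρ := ρ) ν]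

lemma analyticAt_prod_weightedCharacter {ψ : Fin d → ℂ} (hψ : ∀ k, |(ψ k).im| < ρ) :
    AnalyticAt ℂ (fun z : Fin d → ℂ => ∏ k, weightedCharacter d ρ k (z k)) ψ := by
  refine Finset.analyticAt_fun_prod _ fun k _ => ?_
  have h1 : AnalyticAt ℂ (fun z : Fin d → ℂ => z k) ψ :=
    (ContinuousLinearMap.proj (R := ℂ) (φ := fun _ : Fin d => ℂ) k).analyticAt ψ
  exact AnalyticAt.comp (f := fun z : Fin d → ℂ => z k) (analyticAt_weightedCharacter (hψ k)) h1

/-- The evaluation is jointly analytic in the point and in an analytic parameter. -/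
lemma analyticAt_eval {a : ℂ → Wiener d ρ} {ψ : Fin d → ℂ} {ε : ℂ} (hψ : ∀ k, |(ψ k).im| < ρ)
    (ha : AnalyticAt ℂ a ε) :
    AnalyticAt ℂ (fun z : (Fin d → ℂ) × ℂ => eval z.1 (a z.2)) (ψ, ε) := by
  have hψ' : AnalyticAt ℂ (fun z : (Fin d → ℂ) × ℂ => ∏ k, weightedCharacter d ρ k (z.1 k))
      (ψ, ε) := 
    AnalyticAt.comp (f := fun z : (Fin d → ℂ) × ℂ => z.1) (x := (ψ, ε))
      (analyticAt_prod_weightedCharacter hψ) analyticAt_fst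
  have ha' : AnalyticAt ℂ (fun z : (Fin d → ℂ) × ℂ => a z.2) (ψ, ε) :=
    ha.fun_comp analyticAt_snd
  have h2 : AnalyticAt ℂ (fun z : (Fin d → ℂ) × ℂ =>
      pairing (∏ k, weightedCharacter d ρ k (z.1 k)) (a z.2)) (ψ, ε) :=
    AnalyticAt.comp (x := (ψ, ε))
      (f := fun z : (Fin d → ℂ) × ℂ => (∏ k, weightedCharacter d ρ k (z.1 k), a z.2))
      ((pairing (d := d) (ρ := ρ)).analyticAt_bilinear
        (∏ k, weightedCharacter d ρ k (ψ k), a ε)) (hψ'.prod ha')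
  refine h2.congr ?_
  have hopen : ∀ᶠ z : (Fin d → ℂ) × ℂ in 𝓝 (ψ, ε), ∀ k, |(z.1 k).im| < ρ := by
    refine eventually_all.mpr fun k => ?_
    have : Continuous fun z : (Fin d → ℂ) × ℂ => |(z.1 k).im| := by fun_prop
    exact this.continuousAt.eventually_lt continuousAt_const (hψ k)
  filter_upwards [hopen] with z hz
  exact (eval_eq_pairing hz _).symm

/-! ### Real Fourier series -/

/-- The Fourier series that are real on the real torus. -/
def realSubring (d : ℕ) (ρ : ℝ≥0) : Subring (Wiener d ρ) where
  carrier := {a | ∀ ν, a.coeff (-ν) = starRingEnd ℂ (a.coeff ν)}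
  zero_mem' ν := by simp
  one_mem' ν := by
    simp only [coeff_one, neg_eq_zero]
    split_ifs <;> simp
  add_mem' ha hb ν := by simp [ha ν, hb ν]
  neg_mem' ha ν := by simp [ha ν]
  mul_mem' {a b} ha hb ν := by
    -- The convolution sum is reindexed by μ ↦ -μ, which matches conjugation term by term.
    rw [coeff_mul, coeff_mul, Complex.conj_tsum, ← (Equiv.neg (Fin d → ℤ)).tsum_eq]
    refine tsum_congr fun μ => ?_
    rw [Equiv.neg_apply, map_mul, ← ha μ, ← hb (ν - μ)]
    congr 2
    abel

lemma mem_realSubring {a : Wiener d ρ} :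
    a ∈ realSubring d ρ ↔ ∀ ν, a.coeff (-ν) = starRingEnd ℂ (a.coeff ν) := Iff.rfl

lemma continuous_coeff (ν : Fin d → ℤ) : Continuous fun a : Wiener d ρ => a.coeff ν :=
  (LinearMap.mkContinuous (coeffLM ν) 1 fun a => by
    rw [one_mul]; exact a.norm_coeff_le ν).continuous

lemma isClosed_realSubring : IsClosed (realSubring d ρ : Set (Wiener d ρ)) := by
  have : (realSubring d ρ : Set (Wiener d ρ)) =
      ⋂ ν, {a | a.coeff (-ν) = starRingEnd ℂ (a.coeff ν)} := by
    ext a; simp [mem_realSubring]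
  rw [this]
  exact isClosed_iInter fun ν => isClosed_eq (continuous_coeff _)
    (Complex.continuous_conj.comp (continuous_coeff _))

lemma real_smul_mem {a : Wiener d ρ} (ha : a ∈ realSubring d ρ) (r : ℝ) :
    (r : ℂ) • a ∈ realSubring d ρ := fun ν => by
  rw [coeff_smul, coeff_smul, map_mul, ha ν, Complex.conj_ofReal]

lemma multiplier_mem {a : Wiener d ρ} (ha : a ∈ realSubring d ρ) {φ : Multiplier d}
    (hφ : ∀ ν, φ (-ν) = starRingEnd ℂ (φ ν)) : multiplier φ a ∈ realSubring d ρ := fun ν => by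
  rw [coeff_multiplier, coeff_multiplier, map_mul, hφ, ha]

lemma conj_eval {a : Wiener d ρ} (ha : a ∈ realSubring d ρ) (ψ : Fin d → ℝ) :
    starRingEnd ℂ (eval (fun k => (ψ k : ℂ)) a) = eval (fun k => (ψ k : ℂ)) a := by
  rw [eval, Complex.conj_tsum, ← (Equiv.neg (Fin d → ℤ)).tsum_eq]
  refine tsum_congr fun ν => ?_
  rw [Equiv.neg_apply, map_mul, ha ν, Complex.conj_conj]
  congr 1
  simp [character, ← Complex.exp_conj]

end Wiener

end

section

/-! ### The linear divisors -/

/-- The symbol `iσ + ε (a - σ²)` of the linearized operator `ε ∂² + ∂ + ε a` at frequency `σ`. -/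
def divisor (a : ℝ) (ε : ℂ) (σ : ℝ) : ℂ := Complex.I * σ + ε * ((a - σ ^ 2 : ℝ) : ℂ)

lemma divisor_re (a : ℝ) (ε : ℂ) (σ : ℝ) : (divisor a ε σ).re = ε.re * (a - σ ^ 2) := by
  simp only [divisor, Complex.add_re, Complex.mul_re, Complex.I_re, Complex.I_im,
    Complex.ofReal_re, Complex.ofReal_im]
  ring

lemma divisor_im (a : ℝ) (ε : ℂ) (σ : ℝ) : (divisor a ε σ).im = σ + ε.im * (a - σ ^ 2) := by
  simp only [divisor, Complex.add_im, Complex.mul_im, Complex.I_re, Complex.I_im,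
    Complex.ofReal_re, Complex.ofReal_im]
  ring

lemma abs_re_mul_le_norm_divisor (a : ℝ) (ε : ℂ) (σ : ℝ) :
    |ε.re| * |a - σ ^ 2| ≤ ‖divisor a ε σ‖ := by
  rw [← abs_mul, ← divisor_re]; exact Complex.abs_re_le_norm _

lemma abs_im_le_norm_divisor (a : ℝ) (ε : ℂ) (σ : ℝ) :
    |σ + ε.im * (a - σ ^ 2)| ≤ ‖divisor a ε σ‖ := by
  rw [← divisor_im]; exact Complex.abs_im_le_norm _

/-- Far from resonance with the zero frequency the divisor is bounded below. -/
lemma le_norm_divisor_of_large {a b : ℝ} {ε : ℂ} {σ : ℝ} (ha : a ≠ 0) (hb0 : 0 < b) (hb1 : b ≤ 1)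
    (hε : b * ε.im ^ 2 ≤ |ε.re|) (hσ : |a| / 2 ≤ σ ^ 2) :
    min (Real.sqrt (|a| / 2) / 2) (1 / 12) * b ≤ ‖divisor a ε σ‖ := by
  have ha' : 0 < |a| := abs_pos.mpr ha
  have hσ0 : Real.sqrt (|a| / 2) ≤ |σ| := Real.sqrt_le_iff.mpr ⟨abs_nonneg _, by rwa [sq_abs]⟩
  have h0 : 0 < Real.sqrt (|a| / 2) := Real.sqrt_pos.mpr (by positivity)
  have hupper : |a - σ ^ 2| ≤ 3 * σ ^ 2 := by
    refine (abs_sub _ _).trans ?_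
    rw [abs_of_nonneg (sq_nonneg σ)]; linarith
  rcases le_or_gt (|ε.im| * |a - σ ^ 2|) (|σ| / 2) with h | h
  -- The imaginary part σ + (Im ε)(a - σ²) keeps at least half of |σ|.
  · have h1 : |σ| - |ε.im| * |a - σ ^ 2| ≤ |σ + ε.im * (a - σ ^ 2)| := by
      rw [← abs_mul]
      have := abs_sub_abs_le_abs_sub σ (-(ε.im * (a - σ ^ 2)))
      rwa [abs_neg, sub_neg_eq_add] at this
    have h2 := abs_im_le_norm_divisor a ε σ
    calc _ ≤ Real.sqrt (|a| / 2) / 2 * 1 := by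
          gcongr
          exact min_le_left _ _
      _ ≤ _ := by linarith
  -- The imaginary part may now cancel. But then (Im ε)²|a - σ²|² ≥ σ²/4 ≥ |a - σ²|/12, and the
  -- parabolic condition makes the real part at least b/12.
  · have hpos : 0 < |a - σ ^ 2| := by
      by_contra hn
      have : |a - σ ^ 2| = 0 := le_antisymm (not_lt.mp hn) (abs_nonneg _)
      rw [this] at h
      linarith
    have h2 := abs_re_mul_le_norm_divisor a ε σ
    have h3 : σ ^ 2 / 4 ≤ ε.im ^ 2 * |a - σ ^ 2| ^ 2 := by
      have := pow_le_pow_left₀ (by positivity) h.le 2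
      rw [mul_pow, sq_abs, div_pow, sq_abs] at this
      linarith
    have h4 : 1 / 12 * |a - σ ^ 2| ≤ ε.im ^ 2 * |a - σ ^ 2| * |a - σ ^ 2| := by
      nlinarith
    have h5 : 1 / 12 ≤ ε.im ^ 2 * |a - σ ^ 2| := le_of_mul_le_mul_right h4 hpos
    calc _ ≤ 1 / 12 * b := by gcongr; exact min_le_right _ _
      _ ≤ (ε.im ^ 2 * |a - σ ^ 2|) * b := by gcongr
      _ = (b * ε.im ^ 2) * |a - σ ^ 2| := by ring
      _ ≤ |ε.re| * |a - σ ^ 2| := by gcongr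
      _ ≤ _ := h2

/-- Lower bounds for the divisors when `ε` lies in a parabolic domain; `|D(σ)| < κ |ε|` singles out
the almost resonant frequencies, which do not add up. -/
structure DivisorBounds (a b κ K : ℝ) (ε : ℂ) : Prop where
  lower : ∀ σ, b * ‖ε‖ ^ 2 ≤ K * ‖divisor a ε σ‖
  lower_freq : ∀ σ, b * σ ^ 2 ≤ K * (1 + σ ^ 2) * ‖divisor a ε σ‖
  small : ∀ σ, ‖divisor a ε σ‖ < κ * ‖ε‖ → |σ| ≤ K * ‖ε‖
  no_sum : ∀ σ τ, ‖divisor a ε σ‖ < κ * ‖ε‖ → ‖divisor a ε τ‖ < κ * ‖ε‖ →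
    κ * ‖ε‖ ≤ ‖divisor a ε (σ + τ)‖

lemma half_le_abs_sub_sq {a σ : ℝ} (hσ : σ ^ 2 < |a| / 2) :
    |a| / 2 ≤ |a - σ ^ 2| ∧ |a - σ ^ 2| ≤ 3 * |a| / 2 := by
  constructor
  · have := abs_sub_abs_le_abs_sub a (σ ^ 2)
    rw [abs_of_nonneg (sq_nonneg σ)] at this
    linarith
  · refine (abs_sub _ _).trans ?_
    rw [abs_of_nonneg (sq_nonneg σ)]; linarith

/-- Used in both regimes: it bounds |σ| by |ε| when D is almost resonant, and |σ| by |D| when it is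
not. -/
lemma abs_le_norm_divisor_add {a : ℝ} {ε : ℂ} {σ : ℝ} (hσ : σ ^ 2 < |a| / 2) :
    |σ| ≤ ‖divisor a ε σ‖ + 3 * |a| / 2 * ‖ε‖ := by
  have h1 := abs_im_le_norm_divisor a ε σ
  have h2 := abs_sub_abs_le_abs_sub σ (-(ε.im * (a - σ ^ 2)))
  rw [abs_neg, sub_neg_eq_add, abs_mul] at h2
  have h3 : |ε.im| * |a - σ ^ 2| ≤ ‖ε‖ * (3 * |a| / 2) :=
    mul_le_mul (Complex.abs_im_le_norm _) (half_le_abs_sub_sq hσ).2 (abs_nonneg _) (norm_nonneg _)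
  linarith

/-- The parabolic condition handles (Im ε)², and (Re ε)² ≤ |Re ε| handles the rest. Together with Re
D = Re ε (a - σ²) this is the source of the lower bound b|ε|² at low frequencies. -/
lemma mul_norm_sq_le_abs_re {b : ℝ} {ε : ℂ} (hb1 : b ≤ 1) (h1 : ‖ε‖ ≤ 1)
    (hε : b * ε.im ^ 2 ≤ |ε.re|) : b * ‖ε‖ ^ 2 ≤ 2 * |ε.re| := by
  have h2 : |ε.re| ≤ 1 := (Complex.abs_re_le_norm _).trans h1
  have h3 : ‖ε‖ ^ 2 = |ε.re| ^ 2 + ε.im ^ 2 := by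
    rw [Complex.sq_norm, Complex.normSq_apply, sq_abs]; ring
  rw [h3]
  nlinarith [abs_nonneg ε.re, sq_nonneg |ε.re|]

/-- High frequencies, σ² ≥ |a|/2, have |D| ≳ b. At low frequencies |a - σ²| is comparable to |a|, so
Re D ~ Re ε and Im D = σ + O(|ε|): the divisor can be small only if |σ| ≲ |ε| and ε is close to the
imaginary axis. -/
lemma exists_divisorBounds {a : ℝ} (ha : a ≠ 0) :
    ∃ κ > 0, κ < |a| ∧ ∃ K ≥ 1, ∃ δ > 0, ∀ (b : ℝ) (ε : ℂ), 0 < b → b ≤ 1 → b * ε.im ^ 2 ≤ |ε.re| →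
      0 < ‖ε‖ → ‖ε‖ ≤ δ * b → DivisorBounds a b κ K ε := by
  have ha' : 0 < |a| := abs_pos.mpr ha
  set c := min (Real.sqrt (|a| / 2) / 2) (1 / 12) with hc
  have hc0 : 0 < c := lt_min (half_pos (Real.sqrt_pos.mpr (by positivity))) (by norm_num)
  set K := 20 + 1 / c + 16 / |a| + 16 * |a| with hK
  have hKc : 1 ≤ K * c := by
    have : (1 / c) * c = 1 := by field_simp
    have h2 : 0 ≤ (20 + 16 / |a| + 16 * |a|) * c := by positivity
    rw [hK]; linarith
  have hKa : 4 ≤ K * |a| := by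
    have : (16 / |a|) * |a| = 16 := by field_simp
    have h2 : 0 ≤ (20 + 1 / c + 16 * |a|) * |a| := by positivity
    rw [hK]; linarith
  have hK20 : 20 ≤ K := by have : 0 ≤ 1 / c + 16 / |a| + 16 * |a| := by positivity
                           rw [hK]; linarith
  have hK16 : 16 * |a| ≤ K := by have : 0 ≤ 20 + 1 / c + 16 / |a| := by positivity
                                 rw [hK]; linarith
  -- The three entries of δ ensure |ε| ≤ 1; κ|ε| ≤ cb, so that no high frequency is almost resonant;
  -- and 16|a||ε|² ≤ 1, so that |2στ| ≤ |a|/2 for almost resonant σ and τ.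
  refine ⟨|a| / 12, by positivity, by linarith, K, by linarith,
    min 1 (min (12 * c / |a|) (1 / (4 * (1 + |a|)))), by positivity, ?_⟩
  intro b ε hb0 hb1 hε hε0 hεδ
  have hδ1 : ‖ε‖ ≤ 1 := hεδ.trans (mul_le_one₀ (min_le_left _ _) hb0.le hb1)
  have hδ2 : |a| / 12 * ‖ε‖ ≤ c * b := by
    have : ‖ε‖ ≤ 12 * c / |a| * b := hεδ.trans (by
      gcongr; exact (min_le_right _ _).trans (min_le_left _ _))
    calc |a| / 12 * ‖ε‖ ≤ |a| / 12 * (12 * c / |a| * b) := by gcongr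
      _ = c * b := by field_simp
  have hδ3 : 16 * |a| * ‖ε‖ ^ 2 ≤ 1 := by
    have h1 : ‖ε‖ ≤ 1 / (4 * (1 + |a|)) := hεδ.trans (by
      refine (mul_le_of_le_one_right (by positivity) hb1).trans ?_
      exact (min_le_right _ _).trans (min_le_right _ _))
    rw [le_div_iff₀ (by positivity)] at h1
    have h2 : (‖ε‖ * (4 * (1 + |a|))) ^ 2 ≤ 1 := pow_le_one₀ (by positivity) h1
    nlinarith [sq_nonneg (‖ε‖), mul_nonneg (sq_nonneg ‖ε‖) (sq_nonneg |a|),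
      mul_nonneg (sq_nonneg ‖ε‖) ha'.le]
  have hlarge : ∀ σ, |a| / 2 ≤ σ ^ 2 → c * b ≤ ‖divisor a ε σ‖ := fun σ hσ =>
    le_norm_divisor_of_large ha hb0 hb1 hε hσ
  have hdang : ∀ σ, ‖divisor a ε σ‖ < |a| / 12 * ‖ε‖ → σ ^ 2 < |a| / 2 := fun σ h => by
    by_contra hn
    linarith [hlarge σ (not_lt.mp hn)]
  have hre := mul_norm_sq_le_abs_re hb1 hδ1 hε
  have hlower : ∀ σ, b * ‖ε‖ ^ 2 ≤ K * ‖divisor a ε σ‖ := fun σ => by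
    rcases le_or_gt (|a| / 2) (σ ^ 2) with h | h
    · calc b * ‖ε‖ ^ 2 ≤ b * 1 := by gcongr; exact pow_le_one₀ (norm_nonneg _) hδ1
        _ ≤ (K * c) * b := by nlinarith
        _ = K * (c * b) := by ring
        _ ≤ _ := by gcongr; exact hlarge σ h
    · have h1 := abs_re_mul_le_norm_divisor a ε σ
      have h2 := (half_le_abs_sub_sq h).1
      calc b * ‖ε‖ ^ 2 ≤ 2 * |ε.re| := hre
        _ ≤ (K * |a|) / 2 * |ε.re| := by gcongr; linarith
        _ = K * (|ε.re| * (|a| / 2)) := by ring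
        _ ≤ K * (|ε.re| * |a - σ ^ 2|) := by gcongr
        _ ≤ _ := by gcongr
  have hsmall : ∀ σ, ‖divisor a ε σ‖ < |a| / 12 * ‖ε‖ → |σ| ≤ 2 * |a| * ‖ε‖ := fun σ h => by
    have := abs_le_norm_divisor_add (ε := ε) (hdang σ h)
    nlinarith
  refine ⟨hlower, fun σ => ?_, fun σ h => ?_, fun σ τ h1 h2 => ?_⟩
  · rcases le_or_gt (|a| / 2) (σ ^ 2) with h | h
    · calc b * σ ^ 2 ≤ b * (1 + σ ^ 2) := by gcongr; linarith
        _ ≤ (K * c) * (b * (1 + σ ^ 2)) := le_mul_of_one_le_left (by positivity) hKc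
        _ = K * (1 + σ ^ 2) * (c * b) := by ring
        _ ≤ _ := by gcongr; exact hlarge σ h
    · have h0 := norm_nonneg (divisor a ε σ)
      -- In the almost resonant case σ² = O(|ε|²), while |D| ≥ |Re ε||a|/2 is at least of order
      -- b|ε|². Otherwise |a||ε| ≤ 12|D|, hence |σ| ≤ 19|D|.
      rcases lt_or_ge ‖divisor a ε σ‖ (|a| / 12 * ‖ε‖) with h' | h'
      · have h1 := abs_re_mul_le_norm_divisor a ε σ
        have h2 := (half_le_abs_sub_sq h).1
        have h3 : σ ^ 2 ≤ (2 * |a| * ‖ε‖) ^ 2 := by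
          rw [← sq_abs σ]; exact pow_le_pow_left₀ (abs_nonneg _) (hsmall σ h') 2
        have h4 : |ε.re| * (|a| / 2) ≤ ‖divisor a ε σ‖ := le_trans (by gcongr) h1
        calc b * σ ^ 2 ≤ b * (2 * |a| * ‖ε‖) ^ 2 := by gcongr
          _ = 4 * |a| ^ 2 * (b * ‖ε‖ ^ 2) := by ring
          _ ≤ 4 * |a| ^ 2 * (2 * |ε.re|) := by gcongr
          _ = 16 * |a| * (|ε.re| * (|a| / 2)) := by ring
          _ ≤ K * ‖divisor a ε σ‖ := by gcongr
          _ ≤ K * (1 + σ ^ 2) * ‖divisor a ε σ‖ := by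
            gcongr
            nlinarith [sq_nonneg σ]
      · have h1 := abs_le_norm_divisor_add (ε := ε) h
        have h2 : |σ| ≤ 20 * ‖divisor a ε σ‖ := by linarith
        calc b * σ ^ 2 ≤ 1 * σ ^ 2 := by gcongr
          _ = |σ| * |σ| := by rw [one_mul, ← sq_abs, sq]
          _ ≤ 20 * ‖divisor a ε σ‖ * (1 + σ ^ 2) := by
            gcongr
            nlinarith [sq_nonneg (|σ| - 1), sq_abs σ]
          _ = 20 * (1 + σ ^ 2) * ‖divisor a ε σ‖ := by ring
          _ ≤ _ := by gcongr
  · have := hsmall σ h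
    nlinarith
  -- If all three divisors were small, then |Re ε| < |ε|/6, hence |Im ε| ≥ |ε|/2. The imaginary part
  -- of D(σ) + D(τ) - D(σ+τ), equal to (Im ε)(a + 2στ), would be smaller than 3κ|ε| = |a||ε|/4, yet
  -- |a + 2στ| ≥ |a|/2 makes it at least |a||ε|/4.
  · by_contra! h3
    have hx : |ε.re| < ‖ε‖ / 6 := by
      have h4 := abs_re_mul_le_norm_divisor a ε σ
      have h5 := (half_le_abs_sub_sq (hdang σ h1)).1
      have h6 : |ε.re| * (|a| / 2) ≤ |ε.re| * |a - σ ^ 2| := by gcongr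
      nlinarith
    have hy : ‖ε‖ / 2 ≤ |ε.im| := by
      have := Complex.norm_le_abs_re_add_abs_im ε
      linarith
    have e1 := abs_im_le_norm_divisor a ε σ
    have e2 := abs_im_le_norm_divisor a ε τ
    have e3 := abs_im_le_norm_divisor a ε (σ + τ)
    have e4 : |ε.im| * |a + 2 * σ * τ| < 3 * (|a| / 12 * ‖ε‖) := by
      rw [← abs_mul]
      have : ε.im * (a + 2 * σ * τ) = (σ + ε.im * (a - σ ^ 2)) + (τ + ε.im * (a - τ ^ 2)) -
          (σ + τ + ε.im * (a - (σ + τ) ^ 2)) := by ring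
      rw [this]
      have t1 := abs_sub (σ + ε.im * (a - σ ^ 2) + (τ + ε.im * (a - τ ^ 2)))
        (σ + τ + ε.im * (a - (σ + τ) ^ 2))
      have t2 := abs_add_le (σ + ε.im * (a - σ ^ 2)) (τ + ε.im * (a - τ ^ 2))
      linarith
    have e5 : |a| / 2 ≤ |a + 2 * σ * τ| := by
      have t1 := abs_sub_abs_le_abs_sub a (-(2 * σ * τ))
      rw [abs_neg, sub_neg_eq_add, abs_mul, abs_mul, abs_two] at t1
      have t2 : |σ| * |τ| ≤ (2 * |a| * ‖ε‖) * (2 * |a| * ‖ε‖) :=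
        mul_le_mul (hsmall σ h1) (hsmall τ h2) (abs_nonneg _) (by positivity)
      have t3 : (2 * |a| * ‖ε‖) * (2 * |a| * ‖ε‖) ≤ |a| / 4 := by
        calc _ = |a| / 4 * (16 * |a| * ‖ε‖ ^ 2) := by ring
          _ ≤ |a| / 4 * 1 := by gcongr
          _ = _ := mul_one _
      linarith
    have e6 : ‖ε‖ / 2 * (|a| / 2) ≤ |ε.im| * |a + 2 * σ * τ| := by gcongr
    linarith

end

section

/-! ### Power series and a fixed point iteration in a Banach algebra -/

section BanachAlgebra

variable {E : Type*} [NormedCommRing E] [NormOneClass E] [NormedAlgebra ℂ E] [CompleteSpace E]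

lemma norm_pow_sub_pow_le {x y : E} {U : ℝ} (hx : ‖x‖ ≤ U) (hy : ‖y‖ ≤ U) (n : ℕ) :
    ‖x ^ (n + 1) - y ^ (n + 1)‖ ≤ (n + 1) * U ^ n * ‖x - y‖ := by
  have hU : 0 ≤ U := (norm_nonneg x).trans hx
  induction n with
  | zero => simp
  | succ n ih =>
    have : x ^ (n + 1 + 1) - y ^ (n + 1 + 1) =
      x * (x ^ (n + 1) - y ^ (n + 1)) + (x - y) * y ^ (n + 1) := by ring
    rw [this]
    have h1 : ‖x * (x ^ (n + 1) - y ^ (n + 1))‖ ≤ U * ((n + 1) * U ^ n * ‖x - y‖) :=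
      (norm_mul_le _ _).trans (by gcongr)
    have h2 : ‖(x - y) * y ^ (n + 1)‖ ≤ ‖x - y‖ * U ^ (n + 1) :=
      (norm_mul_le _ _).trans (by gcongr; exact (norm_pow_le y _).trans (by gcongr))
    calc _ ≤ _ := (norm_add_le _ _).trans (add_le_add h1 h2)
      _ = _ := by push_cast; ring

/-- The tail `∑_{p ≥ k} c_p x^p` of a power series in a Banach algebra. -/
def powerTail (c : ℕ → ℂ) (k : ℕ) (x : E) : E := ∑' p : ℕ, c (p + k) • x ^ (p + k)

lemma summable_powerTail {c : ℕ → ℂ} {r : ℝ} (hc : Summable fun p => ‖c p‖ * r ^ p) (k : ℕ) {x : E}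
    (hx : ‖x‖ ≤ r) : Summable fun p : ℕ => c (p + k) • x ^ (p + k) := by
  refine Summable.of_norm_bounded ((summable_nat_add_iff k).mpr hc) fun p => ?_
  rw [norm_smul]
  gcongr
  exact (norm_pow_le x _).trans (by gcongr)

lemma powerTail_succ {c : ℕ → ℂ} {r : ℝ} (hc : Summable fun p => ‖c p‖ * r ^ p) (k : ℕ) {x : E}
    (hx : ‖x‖ ≤ r) : powerTail c k x = c k • x ^ k + powerTail c (k + 1) x := by
  rw [powerTail, (summable_powerTail hc k hx).tsum_eq_zero_add, zero_add, powerTail]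
  congr 1
  exact tsum_congr fun p => by rw [add_right_comm, add_assoc]

/-- Halving the radius pays for the factor p + 3 ≤ 4·2^p produced by differentiation. -/
lemma summable_deriv_bound {c : ℕ → ℂ} {r : ℝ} (hr : 0 < r)
    (hc : Summable fun p => ‖c p‖ * r ^ p) :
    Summable fun p : ℕ => ‖c (p + 3)‖ * ((p + 3) * (r / 2) ^ p) := by
  have h := (((summable_nat_add_iff 3).mpr hc).mul_left (4 / r ^ 3))
  refine h.of_nonneg_of_le (fun p => by positivity) fun p => ?_
  have hp : (p + 3 : ℝ) ≤ 4 * 2 ^ p := by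
    have : (p : ℝ) + 1 ≤ 2 ^ p := by exact_mod_cast Nat.lt_two_pow_self
    have h2 : (0 : ℝ) ≤ p := p.cast_nonneg
    linarith
  calc ‖c (p + 3)‖ * ((p + 3) * (r / 2) ^ p) ≤ ‖c (p + 3)‖ * ((4 * 2 ^ p) * (r / 2) ^ p) := by
        gcongr
    _ = 4 / r ^ 3 * (‖c (p + 3)‖ * r ^ (p + 3)) := by
        rw [div_pow]; field_simp; ring

/-- The Lipschitz constant is quadratic in the size of the arguments; this is why terms of order
three and higher survive multiplication by the large norm A without any cancellation. -/
lemma exists_powerTail_bound {c : ℕ → ℂ} {r : ℝ} (hr : 0 < r)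
    (hc : Summable fun p => ‖c p‖ * r ^ p) :
    ∃ M ≥ 0, ∀ (U : ℝ) (x y : E), U ≤ r / 2 → ‖x‖ ≤ U → ‖y‖ ≤ U →
      ‖powerTail c 3 x - powerTail c 3 y‖ ≤ M * U ^ 2 * ‖x - y‖ := by
  refine ⟨∑' p : ℕ, ‖c (p + 3)‖ * ((p + 3) * (r / 2) ^ p),
    tsum_nonneg fun p => by positivity, fun U x y hU hx hy => ?_⟩
  have hU0 : 0 ≤ U := (norm_nonneg x).trans hx
  have hUr : U ≤ r := by linarith
  rw [powerTail, powerTail, ← (summable_powerTail hc 3 (hx.trans hUr)).tsum_sub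
    (summable_powerTail hc 3 (hy.trans hUr))]
  refine tsum_of_norm_bounded (((summable_deriv_bound hr hc).hasSum.mul_right (U ^ 2)).mul_right
    ‖x - y‖) fun p => ?_
  rw [← smul_sub, norm_smul]
  have h := norm_pow_sub_pow_le hx hy (p + 2)
  calc ‖c (p + 3)‖ * ‖x ^ (p + 3) - y ^ (p + 3)‖
      ≤ ‖c (p + 3)‖ * (((p + 2 : ℕ) + 1) * U ^ (p + 2) * ‖x - y‖) := by gcongr
    _ = ‖c (p + 3)‖ * ((p + 3) * U ^ p) * U ^ 2 * ‖x - y‖ := by push_cast; ring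
    _ ≤ _ := by gcongr

lemma powerTail_zero (c : ℕ → ℂ) (k : ℕ) : powerTail c (k + 1) (0 : E) = 0 := by
  simp [powerTail]

/-- The data of the fixed point equation `v = - m (c₂ (w + v)² + T (w + v))`, in which the operator
`m` may be large (of size `A`) on the range of `Π`. -/
structure IterationData (Pi m : E →L[ℂ] E) (T : E → E) (w : E) (c₂ : ℂ)
    (K A θ V P Q U lam : ℝ) : Prop where
  norm_proj : ∀ x, ‖Pi x‖ ≤ ‖x‖
  proj_mul : ∀ x y, Pi (Pi x * Pi y) = 0
  proj_source : ∀ x, ‖Pi (w * Pi x)‖ ≤ θ * ‖Pi x‖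
  norm_proj_m : ∀ x, ‖Pi (m x)‖ ≤ A * ‖Pi x‖
  norm_compl_m : ∀ x, ‖m x - Pi (m x)‖ ≤ K * ‖x‖
  norm_source : ‖w‖ ≤ V
  norm_c₂ : ‖c₂‖ ≤ K
  T_zero : T 0 = 0
  T_lip : ∀ x y, ‖x‖ ≤ U → ‖y‖ ≤ U → ‖T x - T y‖ ≤ K * U ^ 2 * ‖x - y‖
  K_nonneg : 0 ≤ K
  A_nonneg : 0 ≤ A
  θ_nonneg : 0 ≤ θ
  P_nonneg : 0 ≤ P
  Q_nonneg : 0 ≤ Q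
  one_le_lam : 1 ≤ lam
  U_ge : V + P + Q ≤ U
  P_ge : A * (K * V ^ 2 + 2 * K * θ * P + 2 * K * U * Q + K * U ^ 3) ≤ P
  Q_ge : K * (K * U ^ 2 + K * U ^ 3) ≤ Q
  contr_proj : A * (2 * K * θ + 2 * K * Q + K * U ^ 2) +
    lam * (K * (2 * K * U + K * U ^ 2)) ≤ 1 / 2
  contr_compl : A * (2 * K * U + K * U ^ 2) + lam * (K * (2 * K * U + K * U ^ 2)) ≤ lam / 2

/-- The map whose fixed point is sought. -/
def iterMap (m : E →L[ℂ] E) (T : E → E) (w : E) (c₂ : ℂ) (v : E) : E :=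
  -m (c₂ • (w + v) ^ 2 + T (w + v))

/-- The iterates of the fixed point map, starting at zero. -/
def iterSeq (m : E →L[ℂ] E) (T : E → E) (w : E) (c₂ : ℂ) : ℕ → E
  | 0 => 0
  | n + 1 => iterMap m T w c₂ (iterSeq m T w c₂ n)

/-! ### Invariance and contraction with separate resonant and non-resonant bounds. -/

namespace IterationData

variable {Pi m : E →L[ℂ] E} {T : E → E} {w : E} {c₂ : ℂ} {K A θ V P Q U lam : ℝ}

lemma V_nonneg (h : IterationData Pi m T w c₂ K A θ V P Q U lam) : 0 ≤ V :=
  (norm_nonneg w).trans h.norm_source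

lemma U_nonneg (h : IterationData Pi m T w c₂ K A θ V P Q U lam) : 0 ≤ U :=
  le_trans (by linarith [h.V_nonneg, h.P_nonneg, h.Q_nonneg]) h.U_ge

lemma norm_add_le (h : IterationData Pi m T w c₂ K A θ V P Q U lam) {v : E}
    (hp : ‖Pi v‖ ≤ P) (hq : ‖v - Pi v‖ ≤ Q) : ‖w + v‖ ≤ U := by
  have h1 : w + v = w + (Pi v + (v - Pi v)) := by abel
  rw [h1]
  linarith [norm_add_le_of_le h.norm_source (norm_add_le_of_le hp hq), h.U_ge]

lemma norm_T_le (h : IterationData Pi m T w c₂ K A θ V P Q U lam) {x : E} (hx : ‖x‖ ≤ U) :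
    ‖T x‖ ≤ K * U ^ 3 := by
  have := h.T_lip x 0 hx (by simpa using h.U_nonneg)
  rw [h.T_zero, sub_zero, sub_zero] at this
  have hK := h.K_nonneg
  have hU := h.U_nonneg
  calc _ ≤ _ := this
    _ ≤ K * U ^ 2 * U := by gcongr
    _ = _ := by ring

/-- Both cancellations enter here. With δ = v - v', the product Πδ·Π(v + v') is killed by Π, and
2w·Πδ costs only θ. The other products contain a non-resonant factor: that of v and v', bounded by
Q, or that of δ, for which only the bound U on its partner is used. -/
lemma norm_proj_sq_sub_le (h : IterationData Pi m T w c₂ K A θ V P Q U lam) {v v' : E}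
    (hp : ‖Pi v‖ ≤ P) (hq : ‖v - Pi v‖ ≤ Q) (hp' : ‖Pi v'‖ ≤ P) (hq' : ‖v' - Pi v'‖ ≤ Q) :
    ‖Pi ((w + v) ^ 2 - (w + v') ^ 2)‖ ≤ (2 * θ + 2 * Q) * ‖Pi (v - v')‖ +
      2 * U * ‖(v - v') - Pi (v - v')‖ := by
  have hsplit : (w + v) ^ 2 - (w + v') ^ 2 = (w * Pi (v - v') + w * Pi (v - v')) +
      Pi (v - v') * Pi (v + v') + Pi (v - v') * ((v - Pi v) + (v' - Pi v')) +
      ((v - v') - Pi (v - v')) * ((w + v) + (w + v')) := by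
    rw [map_add, map_sub]; ring
  rw [hsplit, map_add, map_add, map_add, map_add, h.proj_mul, add_zero]
  have h1 := h.proj_source (v - v')
  have h2 : ‖Pi (Pi (v - v') * ((v - Pi v) + (v' - Pi v')))‖ ≤ ‖Pi (v - v')‖ * (Q + Q) :=
    (h.norm_proj _).trans ((norm_mul_le _ _).trans (by gcongr; exact norm_add_le_of_le hq hq'))
  have h3 : ‖Pi (((v - v') - Pi (v - v')) * ((w + v) + (w + v')))‖ ≤
      ‖(v - v') - Pi (v - v')‖ * (U + U) :=
    (h.norm_proj _).trans ((norm_mul_le _ _).trans (by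
      gcongr; exact norm_add_le_of_le (h.norm_add_le hp hq) (h.norm_add_le hp' hq')))
  have h4 := norm_add_le_of_le (norm_add_le_of_le (norm_add_le_of_le h1 h1) h2) h3
  linarith

lemma norm_le_add (x : E) : ‖x‖ ≤ ‖Pi x‖ + ‖x - Pi x‖ := by
  have : x = Pi x + (x - Pi x) := by abel
  calc ‖x‖ = ‖Pi x + (x - Pi x)‖ := by rw [← this]
    _ ≤ _ := _root_.norm_add_le _ _

lemma norm_sq_sub_le (h : IterationData Pi m T w c₂ K A θ V P Q U lam) {v v' : E}
    (hp : ‖Pi v‖ ≤ P) (hq : ‖v - Pi v‖ ≤ Q) (hp' : ‖Pi v'‖ ≤ P) (hq' : ‖v' - Pi v'‖ ≤ Q) :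
    ‖(w + v) ^ 2 - (w + v') ^ 2‖ ≤ 2 * U * ‖v - v'‖ := by
  have : (w + v) ^ 2 - (w + v') ^ 2 = ((w + v) + (w + v')) * (v - v') := by ring
  rw [this]
  refine (norm_mul_le _ _).trans ?_
  gcongr
  linarith [norm_add_le_of_le (h.norm_add_le hp hq) (h.norm_add_le hp' hq')]

lemma norm_T_sub_le (h : IterationData Pi m T w c₂ K A θ V P Q U lam) {v v' : E}
    (hp : ‖Pi v‖ ≤ P) (hq : ‖v - Pi v‖ ≤ Q) (hp' : ‖Pi v'‖ ≤ P) (hq' : ‖v' - Pi v'‖ ≤ Q) :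
    ‖T (w + v) - T (w + v')‖ ≤ K * U ^ 2 * ‖v - v'‖ := by
  simpa using h.T_lip _ _ (h.norm_add_le hp hq) (h.norm_add_le hp' hq')

lemma iterMap_sub (m : E →L[ℂ] E) (T : E → E) (w : E) (c₂ : ℂ) (v v' : E) :
    iterMap m T w c₂ v' - iterMap m T w c₂ v =
      m (c₂ • ((w + v) ^ 2 - (w + v') ^ 2) + (T (w + v) - T (w + v'))) := by
  have : c₂ • ((w + v) ^ 2 - (w + v') ^ 2) + (T (w + v) - T (w + v')) =
      (c₂ • (w + v) ^ 2 + T (w + v)) - (c₂ • (w + v') ^ 2 + T (w + v')) := by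
    rw [smul_sub]; abel
  rw [this, map_sub, iterMap, iterMap]
  abel

/-- The coupling of `dq` into the resonant part carries the factor AU, which need not be small; that
of `dp` into the complement carries only U. A large weight `lam` on the complement balances the two,
and the two contraction conditions are the resulting coefficients of `dp` and `dq`. -/
lemma contraction (h : IterationData Pi m T w c₂ K A θ V P Q U lam) {v v' : E}
    (hp : ‖Pi v‖ ≤ P) (hq : ‖v - Pi v‖ ≤ Q) (hp' : ‖Pi v'‖ ≤ P) (hq' : ‖v' - Pi v'‖ ≤ Q)
    {y : E} (hy : y = iterMap m T w c₂ v' - iterMap m T w c₂ v) :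
    ‖Pi y‖ + lam * ‖y - Pi y‖ ≤
      (‖Pi (v - v')‖ + lam * ‖(v - v') - Pi (v - v')‖) / 2 := by
  have hK := h.K_nonneg
  have hU := h.U_nonneg
  have hA := h.A_nonneg
  have hlam := h.one_le_lam
  have hs := norm_le_add (Pi := Pi) (v - v')
  have hT := h.norm_T_sub_le hp hq hp' hq'
  set dp := ‖Pi (v - v')‖
  set dq := ‖(v - v') - Pi (v - v')‖
  have hdp : 0 ≤ dp := norm_nonneg _
  have hdq : 0 ≤ dq := norm_nonneg _
  have hT' : ‖T (w + v) - T (w + v')‖ ≤ K * U ^ 2 * (dp + dq) :=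
    hT.trans (by gcongr)
  set z := c₂ • ((w + v) ^ 2 - (w + v') ^ 2) + (T (w + v) - T (w + v')) with hz
  have hy' : y = m z := by rw [hy, iterMap_sub]
  have h1 : ‖Pi z‖ ≤ K * ((2 * θ + 2 * Q) * dp + 2 * U * dq) + K * U ^ 2 * (dp + dq) := by
    rw [hz, map_add, map_smul]
    refine norm_add_le_of_le ?_ ((h.norm_proj _).trans hT')
    rw [norm_smul]
    exact mul_le_mul h.norm_c₂ (h.norm_proj_sq_sub_le hp hq hp' hq') (norm_nonneg _) hK
  have h2 : ‖z‖ ≤ K * (2 * U * (dp + dq)) + K * U ^ 2 * (dp + dq) := by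
    refine norm_add_le_of_le ?_ hT'
    rw [norm_smul]
    refine mul_le_mul h.norm_c₂ ((h.norm_sq_sub_le hp hq hp' hq').trans ?_) (norm_nonneg _) hK
    gcongr
  have h3 : ‖Pi y‖ ≤ A * (K * ((2 * θ + 2 * Q) * dp + 2 * U * dq) + K * U ^ 2 * (dp + dq)) := by
    rw [hy']; exact (h.norm_proj_m z).trans (by gcongr)
  have h4 : ‖y - Pi y‖ ≤ K * (K * (2 * U * (dp + dq)) + K * U ^ 2 * (dp + dq)) := by
    rw [hy']; exact (h.norm_compl_m z).trans (by gcongr)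
  have h5 := mul_le_mul_of_nonneg_right h.contr_proj hdp
  have h6 := mul_le_mul_of_nonneg_right h.contr_compl hdq
  have h7 : lam * ‖y - Pi y‖ ≤
      lam * (K * (K * (2 * U * (dp + dq)) + K * U ^ 2 * (dp + dq))) := by gcongr
  calc _ ≤ A * (K * ((2 * θ + 2 * Q) * dp + 2 * U * dq) + K * U ^ 2 * (dp + dq)) +
      lam * (K * (K * (2 * U * (dp + dq)) + K * U ^ 2 * (dp + dq))) := add_le_add h3 h7
    _ = (A * (2 * K * θ + 2 * K * Q + K * U ^ 2) + lam * (K * (2 * K * U + K * U ^ 2))) * dp +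
      (A * (2 * K * U + K * U ^ 2) + lam * (K * (2 * K * U + K * U ^ 2))) * dq := by ring
    _ ≤ _ := by linarith

/-- The square is expanded about w + Πv. As Πv·Πv drops out under Π, the leading contribution to the
resonant part comes from w², and it is this term that fixes the size of P. -/
lemma iterMap_mem (h : IterationData Pi m T w c₂ K A θ V P Q U lam) {v : E}
    (hp : ‖Pi v‖ ≤ P) (hq : ‖v - Pi v‖ ≤ Q) :
    ‖Pi (iterMap m T w c₂ v)‖ ≤ P ∧
      ‖iterMap m T w c₂ v - Pi (iterMap m T w c₂ v)‖ ≤ Q := by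
  have hK := h.K_nonneg
  have hU := h.U_nonneg
  have hA := h.A_nonneg
  have hV := h.V_nonneg
  have hP := h.P_nonneg
  have hQ := h.Q_nonneg
  have hx := h.norm_add_le hp hq
  set z := c₂ • (w + v) ^ 2 + T (w + v) with hz
  have hy : iterMap m T w c₂ v = -m z := rfl
  have hsq : ‖Pi ((w + v) ^ 2)‖ ≤ V ^ 2 + 2 * θ * P + 2 * U * Q := by
    have hsplit : (w + v) ^ 2 = w ^ 2 + (w * Pi v + w * Pi v) + Pi v * Pi v +
        (v - Pi v) * ((w + v) + (w + Pi v)) := by ring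
    rw [hsplit, map_add, map_add, map_add, map_add, h.proj_mul, add_zero]
    have h1 : ‖Pi (w * Pi v)‖ ≤ θ * P := (h.proj_source v).trans (by
      have := h.θ_nonneg
      gcongr)
    have h2 : ‖Pi (w ^ 2)‖ ≤ V ^ 2 := (h.norm_proj _).trans ((norm_pow_le w 2).trans
      (by gcongr; exact h.norm_source))
    have h3 : ‖Pi ((v - Pi v) * ((w + v) + (w + Pi v)))‖ ≤ Q * (U + U) :=
      (h.norm_proj _).trans ((norm_mul_le _ _).trans (by
        gcongr
        refine norm_add_le_of_le hx ((norm_add_le_of_le h.norm_source hp).trans ?_)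
        linarith [h.U_ge]))
    have h4 := norm_add_le_of_le (norm_add_le_of_le h2 (norm_add_le_of_le h1 h1)) h3
    linarith
  have h1 : ‖Pi z‖ ≤ K * (V ^ 2 + 2 * θ * P + 2 * U * Q) + K * U ^ 3 := by
    rw [hz, map_add, map_smul]
    refine norm_add_le_of_le ?_ ((h.norm_proj _).trans (h.norm_T_le hx))
    rw [norm_smul]
    exact mul_le_mul h.norm_c₂ hsq (norm_nonneg _) hK
  have h2 : ‖z‖ ≤ K * U ^ 2 + K * U ^ 3 := by
    refine norm_add_le_of_le ?_ (h.norm_T_le hx)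
    rw [norm_smul]
    exact mul_le_mul h.norm_c₂ ((norm_pow_le _ 2).trans (by gcongr)) (norm_nonneg _) hK
  rw [hy, map_neg, norm_neg, ← neg_add', norm_neg, ← sub_eq_add_neg]
  constructor
  · refine (h.norm_proj_m z).trans (le_trans ?_ h.P_ge)
    gcongr
    linarith
  · refine (h.norm_compl_m z).trans (le_trans ?_ h.Q_ge)
    gcongr

lemma iterSeq_mem (h : IterationData Pi m T w c₂ K A θ V P Q U lam) (n : ℕ) :
    ‖Pi (iterSeq m T w c₂ n)‖ ≤ P ∧ ‖iterSeq m T w c₂ n - Pi (iterSeq m T w c₂ n)‖ ≤ Q := by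
  induction n with
  | zero => simp [iterSeq, h.P_nonneg, h.Q_nonneg]
  | succ n ih => exact h.iterMap_mem ih.1 ih.2

/-- The contraction lives in the `lam`-weighted norm, which dominates ‖·‖ because `lam` ≥ 1. The
iterates start at zero, so P + `lam` Q bounds the first increment. -/
lemma norm_iterSeq_succ_sub_le (h : IterationData Pi m T w c₂ K A θ V P Q U lam) (n : ℕ) :
    ‖iterSeq m T w c₂ (n + 1) - iterSeq m T w c₂ n‖ ≤ (P + lam * Q) * (1 / 2) ^ n := by
  have key : ∀ n, ‖Pi (iterSeq m T w c₂ (n + 1) - iterSeq m T w c₂ n)‖ +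
      lam * ‖(iterSeq m T w c₂ (n + 1) - iterSeq m T w c₂ n) -
        Pi (iterSeq m T w c₂ (n + 1) - iterSeq m T w c₂ n)‖ ≤ (P + lam * Q) * (1 / 2) ^ n := by
    intro n
    have hlam := h.one_le_lam
    induction n with
    | zero =>
      have := h.iterSeq_mem 1
      simp only [iterSeq, sub_zero, pow_zero, mul_one] at this ⊢
      gcongr
      exacts [this.1, this.2]
    | succ n ih =>
      have hn := h.iterSeq_mem n
      have hn' := h.iterSeq_mem (n + 1)
      have := h.contraction hn.1 hn.2 hn'.1 hn'.2
        (y := iterSeq m T w c₂ (n + 1 + 1) - iterSeq m T w c₂ (n + 1)) rfl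
      have hneg : iterSeq m T w c₂ n - iterSeq m T w c₂ (n + 1) =
        -(iterSeq m T w c₂ (n + 1) - iterSeq m T w c₂ n) := by abel
      simp only [hneg, map_neg, norm_neg, ← neg_sub'] at this
      rw [pow_succ]
      linarith
  have hlam := h.one_le_lam
  refine le_trans (norm_le_add (Pi := Pi) _) (le_trans ?_ (key n))
  gcongr
  exact le_mul_of_one_le_left (norm_nonneg _) hlam

lemma norm_source_add_iterSeq_le (h : IterationData Pi m T w c₂ K A θ V P Q U lam) (n : ℕ) :
    ‖w + iterSeq m T w c₂ n‖ ≤ U := h.norm_add_le (h.iterSeq_mem n).1 (h.iterSeq_mem n).2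

/-- The iterates converge to a fixed point. -/
lemma exists_fixedPoint (h : IterationData Pi m T w c₂ K A θ V P Q U lam) :
    ∃ v : E, Tendsto (iterSeq m T w c₂) atTop (𝓝 v) ∧ ‖w + v‖ ≤ U ∧
      (∀ n, ‖iterSeq m T w c₂ n - v‖ ≤ (P + lam * Q) * 2 * (1 / 2) ^ n) ∧
      v = iterMap m T w c₂ v := by
  have hd : ∀ n, dist (iterSeq m T w c₂ n) (iterSeq m T w c₂ (n + 1)) ≤
      (P + lam * Q) * (1 / 2) ^ n := fun n => by
    rw [dist_comm, dist_eq_norm]; exact h.norm_iterSeq_succ_sub_le n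
  obtain ⟨v, hv⟩ := cauchySeq_tendsto_of_complete
    (cauchySeq_of_le_geometric (1 / 2) (P + lam * Q) (by norm_num) hd)
  have hU : ‖w + v‖ ≤ U := le_of_tendsto (tendsto_const_nhds.add hv).norm
    (Eventually.of_forall h.norm_source_add_iterSeq_le)
  refine ⟨v, hv, hU, fun n => ?_, ?_⟩
  · have := dist_le_of_le_geometric_of_tendsto (1 / 2) (P + lam * Q) (by norm_num) hd hv n
    rw [dist_eq_norm] at this
    refine this.trans (le_of_eq ?_)
    ring
  · have hT : Tendsto (fun n => T (w + iterSeq m T w c₂ n)) atTop (𝓝 (T (w + v))) := by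
      rw [tendsto_iff_norm_sub_tendsto_zero]
      have h0 : Tendsto (fun n => K * U ^ 2 * ‖iterSeq m T w c₂ n - v‖) atTop (𝓝 0) := by
        simpa using (tendsto_iff_norm_sub_tendsto_zero.mp hv).const_mul (K * U ^ 2)
      refine squeeze_zero (fun _ => norm_nonneg _) (fun n => ?_) h0
      simpa using h.T_lip _ _ (h.norm_source_add_iterSeq_le n) hU
    have h1 : Tendsto (fun n => iterSeq m T w c₂ (n + 1)) atTop (𝓝 (iterMap m T w c₂ v)) := by
      simp only [iterSeq, iterMap]
      exact ((m.continuous.tendsto _).comp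
        ((((tendsto_const_nhds.add hv).pow 2).const_smul c₂).add hT)).neg
    exact tendsto_nhds_unique ((tendsto_add_atTop_iff_nat 1).mpr hv) h1

end IterationData

end BanachAlgebra

end

section

variable {d : ℕ}

/-! ### Fourier series on the torus -/

/-- The periodicity in each variable gives the periodicity with respect to the whole lattice. -/
lemma periodic_lattice {E : Type*} {h : (Fin d → ℝ) → E}
    (hper : ∀ ψ k, h (ψ + Pi.single k (2 * Real.pi)) = h ψ) (n : Fin d → ℤ) (ψ : Fin d → ℝ) :
    h (ψ + fun k => 2 * Real.pi * n k) = h ψ := by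
  have h1 : (fun k => 2 * Real.pi * (n k : ℝ)) =
      ∑ k, n k • (Pi.single k (2 * Real.pi) : Fin d → ℝ) := by
    ext j
    simp [Finset.sum_apply, Pi.single_apply, mul_comm]
  have h2 : ∀ s : Finset (Fin d),
      Function.Periodic h (∑ k ∈ s, n k • (Pi.single k (2 * Real.pi) : Fin d → ℝ)) := by
    intro s
    induction s using Finset.induction_on with
    | empty => intro ψ; simp
    | insert k s hk ih =>
      rw [Finset.sum_insert hk]
      exact Function.Periodic.add_period
        (Function.Periodic.zsmul (fun ψ => hper ψ k) (n k)) ih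
  rw [h1]
  exact h2 _ ψ

/-- A continuous periodic function descends to the torus. -/
lemma exists_torusLift {h : (Fin d → ℝ) → ℂ} (hc : Continuous h)
    (hper : ∀ ψ k, h (ψ + Pi.single k (2 * Real.pi)) = h ψ) :
    ∃ H : C(UnitAddTorus (Fin d), ℂ), ∀ y : Fin d → ℝ,
      H (fun i => (y i : UnitAddCircle)) = h ((2 * Real.pi) • y) := by
  set q : (Fin d → ℝ) → UnitAddTorus (Fin d) := fun y i => (y i : UnitAddCircle) with hq
  have hquot : IsOpenQuotientMap q := IsOpenQuotientMap.piMap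
    (f := fun _ : Fin d => ((↑) : ℝ → UnitAddCircle)) fun _ => QuotientAddGroup.isOpenQuotientMap_mk
  set H : UnitAddTorus (Fin d) → ℂ := fun x => h ((2 * Real.pi) • (hquot.surjective x).choose)
  have hH : ∀ y, H (q y) = h ((2 * Real.pi) • y) := by
    intro y
    have hspec := (hquot.surjective (q y)).choose_spec
    set y' := (hquot.surjective (q y)).choose with hy'
    have : ∀ i, ∃ n : ℤ, y' i = y i + n := by
      intro i
      have hi := congrFun hspec i
      simp only [hq] at hi
      have h0 : ((y' i - y i : ℝ) : UnitAddCircle) = 0 := by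
        rw [AddCircle.coe_sub, hi, sub_self]
      obtain ⟨n, hn⟩ := AddCircle.coe_eq_zero_iff (p := (1 : ℝ)).mp h0
      exact ⟨n, by rw [zsmul_eq_mul, mul_one] at hn; linarith⟩
    choose n hn using this
    have h2 : (2 * Real.pi) • y' = (2 * Real.pi) • y + fun k => 2 * Real.pi * n k := by
      ext k
      simp [hn k, mul_add]
    change h ((2 * Real.pi) • y') = _
    rw [h2, periodic_lattice hper]
  refine ⟨⟨H, ?_⟩, hH⟩
  rw [hquot.isQuotientMap.continuous_iff]
  have : H ∘ q = fun y => h ((2 * Real.pi) • y) := funext hH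
  rw [this]
  fun_prop

/-- The unit cube `∏ (0, 1]`, translated by `a`. -/
abbrev unitCube (a : Fin d → ℝ) : Set (Fin d → ℝ) := {x | ∀ i, x i ∈ Set.Ioc (a i) (a i + 1)}

lemma torusAverage_eq_integral_unitCube (h : (Fin d → ℝ) → ℂ) :
    torusAverage h = ∫ y in unitCube 0, h ((2 * Real.pi) • y) := by
  have hpi : (0 : ℝ) < 2 * Real.pi := by positivity
  have h1 : (unitCube 0 : Set (Fin d → ℝ)) =ᵐ[MeasureTheory.volume] Set.Icc (0 : Fin d → ℝ) 1 := by
    have := MeasureTheory.Measure.univ_pi_Ioc_ae_eq_Icc (ι := Fin d)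
      (μ := fun _ => (MeasureTheory.volume : MeasureTheory.Measure ℝ)) (f := 0) (g := 1)
    have hset : (unitCube 0 : Set (Fin d → ℝ)) =
        Set.univ.pi fun i => Set.Ioc ((0 : Fin d → ℝ) i) ((1 : Fin d → ℝ) i) := by
      ext x
      simp [unitCube]
    rw [hset]
    exact this
  have h2 : (2 * Real.pi) • Set.Icc (0 : Fin d → ℝ) 1 = Set.Icc 0 (fun _ => 2 * Real.pi) := by
    ext x
    rw [Set.mem_smul_set_iff_inv_smul_mem₀ hpi.ne']
    simp only [Set.mem_Icc, Pi.le_def, Pi.zero_apply, Pi.smul_apply, Pi.one_apply, smul_eq_mul]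
    refine and_congr (forall_congr' fun i => ?_) (forall_congr' fun i => ?_)
    · rw [mul_nonneg_iff_of_pos_left (inv_pos.mpr hpi)]
    · rw [inv_mul_le_iff₀ hpi, mul_one]
  rw [MeasureTheory.setIntegral_congr_set h1,
    MeasureTheory.Measure.setIntegral_comp_smul_of_pos _ _ _ hpi, h2, torusAverage]
  simp

lemma mFourier_coe (n : Fin d → ℤ) (y : Fin d → ℝ) :
    UnitAddTorus.mFourier n (fun i => (y i : UnitAddCircle)) =
      Wiener.character (fun k => (((2 * Real.pi) • y) k : ℂ)) n := by
  simp only [UnitAddTorus.mFourier, ContinuousMap.coe_mk, fourier_coe_apply, Wiener.character]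
  rw [← Complex.exp_sum, Finset.mul_sum]
  congr 1
  refine Finset.sum_congr rfl fun i _ => ?_
  simp
  ring

lemma exp_neg_freqDot (ψ : Fin d → ℝ) (ν : Fin d → ℤ) :
    Complex.exp (-Complex.I * ((freqDot ψ ν : ℝ) : ℂ)) =
      Wiener.character (fun k => (ψ k : ℂ)) (-ν) := by
  simp [Wiener.character, freqDot, mul_comm]

lemma torusAverage_character_mul {h : (Fin d → ℝ) → ℂ} {H : C(UnitAddTorus (Fin d), ℂ)}
    (hH : ∀ y : Fin d → ℝ, H (fun i => (y i : UnitAddCircle)) = h ((2 * Real.pi) • y))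
    (ν : Fin d → ℤ) :
    torusAverage (fun ψ => Wiener.character (fun k => (ψ k : ℂ)) (-ν) * h ψ) =
      UnitAddTorus.mFourierCoeff H ν := by
  rw [torusAverage_eq_integral_unitCube, UnitAddTorus.mFourierCoeff_eq_integral _ _ 0]
  simp only [mFourier_coe, hH, smul_eq_mul]

/-- The average of a periodic function is invariant under translations. -/
lemma torusAverage_translate {h : (Fin d → ℝ) → ℂ} (hc : Continuous h)
    (hper : ∀ ψ k, h (ψ + Pi.single k (2 * Real.pi)) = h ψ) (c : Fin d → ℝ) :
    torusAverage (fun ψ => h (ψ + c)) = torusAverage h := by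
  obtain ⟨H, hH⟩ := exists_torusLift hc hper
  have hpi : (2 * Real.pi) ≠ 0 := by positivity
  have key : ∀ a : Fin d → ℝ, ∫ y in unitCube a, h ((2 * Real.pi) • y) =
      UnitAddTorus.mFourierCoeff H 0 := fun a => by
    rw [UnitAddTorus.mFourierCoeff_eq_integral _ _ a]
    simp only [hH, neg_zero, UnitAddTorus.mFourier_zero, ContinuousMap.one_apply, one_smul]
  rw [torusAverage_eq_integral_unitCube, torusAverage_eq_integral_unitCube, key,
    ← key ((2 * Real.pi)⁻¹ • c)]
  have hmp := MeasureTheory.measurePreserving_add_right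
    (MeasureTheory.volume : MeasureTheory.Measure (Fin d → ℝ)) ((2 * Real.pi)⁻¹ • c)
  have hset : (fun y => y + (2 * Real.pi)⁻¹ • c) ⁻¹' unitCube ((2 * Real.pi)⁻¹ • c) =
      unitCube 0 := by
    ext y
    simp only [unitCube, Set.mem_preimage, Set.mem_ofPred_eq, Set.mem_Ioc, Pi.add_apply,
      Pi.zero_apply]
    refine forall_congr' fun i => ?_
    constructor <;> rintro ⟨h1, h2⟩ <;> constructor <;> linarith
  rw [← hmp.setIntegral_preimage_emb (MeasurableEquiv.addRight _).measurableEmbedding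
    (fun y => h ((2 * Real.pi) • y)) (unitCube ((2 * Real.pi)⁻¹ • c)), hset]
  refine MeasureTheory.integral_congr_ae (Eventually.of_forall fun y => ?_)
  simp only [smul_add, smul_inv_smul₀ hpi]

/-- Pointwise convergence of an absolutely convergent Fourier series. -/
lemma hasSum_fourierMode {f : (Fin d → ℝ) → ℝ} (hc : Continuous f) (hper : IsTorusPeriodic f)
    (hs : Summable (fourierMode f)) (ψ : Fin d → ℝ) :
    HasSum (fun ν => fourierMode f ν * Wiener.character (fun k => (ψ k : ℂ)) ν) (f ψ : ℂ) := by
  obtain ⟨H, hH⟩ := exists_torusLift (h := fun ψ => (f ψ : ℂ)) (by fun_prop)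
    fun ψ k => by rw [hper ψ k]
  have hcoeff : fourierMode f = UnitAddTorus.mFourierCoeff H := by
    ext ν
    rw [← torusAverage_character_mul (h := fun ψ => (f ψ : ℂ)) hH, fourierMode]
    simp_rw [exp_neg_freqDot]
  have h2 : (2 * Real.pi) • ((2 * Real.pi)⁻¹ • ψ) = ψ := smul_inv_smul₀ (by positivity) ψ
  have := UnitAddTorus.hasSum_mFourier_series_apply_of_summable (f := H) (hcoeff ▸ hs)
    (fun i => ((((2 * Real.pi)⁻¹ • ψ) i : ℝ) : UnitAddCircle))
  rw [hH, ← hcoeff] at this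
  simp only [mFourier_coe, smul_eq_mul] at this
  rwa [h2] at this

/-! ### Exponential decay of the Fourier coefficients -/

/-- Differentiation under the integral sign: |σ_k| ≤ 1 keeps the shifted points in the strip, and
compactness of parameter disc times domain bounds the derivative. -/
lemma differentiableAt_integral_translate {Φ : (Fin d → ℂ) → ℂ} {ξ : ℝ}
    (hΦ : AnalyticOnNhd ℂ Φ (strip d ξ)) {σ : Fin d → ℝ} (hσ : ∀ k, |σ k| ≤ 1) {s : Set (Fin d → ℝ)}
    (hs : IsCompact s) {l : ℂ} (hl : |l.im| < ξ) :
    DifferentiableAt ℂ (fun l : ℂ => ∫ ψ : Fin d → ℝ in s, Φ (fun k => ψ k + l * σ k)) l := by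
  obtain ⟨ξ', hξ1, hξ2⟩ := exists_between hl
  have hmem : ∀ l' : ℂ, |l'.im| ≤ ξ' → ∀ ψ : Fin d → ℝ,
      (fun k => (ψ k : ℂ) + l' * σ k) ∈ strip d ξ := by
    intro l' hl' ψ k
    have : ((ψ k : ℂ) + l' * σ k).im = l'.im * σ k := by simp
    rw [this, abs_mul]
    calc |l'.im| * |σ k| ≤ |l'.im| * 1 := by gcongr; exact hσ k
      _ ≤ ξ := by linarith
  set σ' : Fin d → ℂ := fun k => (σ k : ℂ) with hσ'
  have hcont : ∀ l' : ℂ, |l'.im| ≤ ξ' → Continuous fun ψ : Fin d → ℝ =>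
      Φ (fun k => ψ k + l' * σ k) := fun l' hl' =>
    hΦ.continuousOn.comp_continuous (by fun_prop) (hmem l' hl')
  have hfd : ContinuousOn (fun z => fderiv ℂ Φ z σ') (strip d ξ) :=
    hΦ.fderiv.continuousOn.clm_apply continuousOn_const
  set N : Set ℂ := Metric.closedBall l (ξ' - |l.im|) with hN
  have hNim : ∀ l' ∈ N, |l'.im| ≤ ξ' := by
    intro l' hl'
    have h1 : |(l' - l).im| ≤ ξ' - |l.im| :=
      (Complex.abs_im_le_norm _).trans (by rwa [hN, Metric.mem_closedBall, dist_eq_norm] at hl')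
    rw [Complex.sub_im] at h1
    linarith [abs_sub_abs_le_abs_sub l'.im l.im]
  have hcompact : IsCompact (N ×ˢ s) := (isCompact_closedBall _ _).prod hs
  have hcd : ContinuousOn (fun p : ℂ × (Fin d → ℝ) =>
      fderiv ℂ Φ (fun k => p.2 k + p.1 * σ k) σ') (N ×ˢ s) :=
    hfd.comp (by fun_prop) fun p hp => hmem _ (hNim _ hp.1) _
  obtain ⟨C, hC⟩ := hcompact.exists_bound_of_continuousOn hcd
  have hfin : MeasureTheory.IsFiniteMeasure (MeasureTheory.volume.restrict s) :=
    ⟨by simpa using hs.measure_lt_top⟩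
  have hmeas := hs.measurableSet
  refine (hasDerivAt_integral_of_dominated_loc_of_deriv_le (𝕜 := ℂ)
    (F := fun l' (ψ : Fin d → ℝ) => Φ (fun k => ψ k + l' * σ k))
    (F' := fun l' (ψ : Fin d → ℝ) => fderiv ℂ Φ (fun k => ψ k + l' * σ k) σ') (bound := fun _ => C)
    (s := N) (Metric.closedBall_mem_nhds _ (by linarith)) ?_ ?_ ?_ ?_ ?_ ?_).2.differentiableAt
  · filter_upwards [Metric.closedBall_mem_nhds l (show 0 < ξ' - |l.im| by linarith)] with l' hl'
    exact (hcont l' (hNim l' hl')).aestronglyMeasurable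
  · exact (hcont l hξ1.le).continuousOn.integrableOn_compact hs
  · refine ContinuousOn.aestronglyMeasurable ?_ hmeas
    exact (hfd.comp_continuous (f := fun ψ : Fin d → ℝ => fun k => (ψ k : ℂ) + l * σ k)
      (by fun_prop) (hmem l hξ1.le)).continuousOn
  · refine (MeasureTheory.ae_restrict_iff' hmeas).mpr (Eventually.of_forall fun ψ hψ l' hl' => ?_)
    exact hC (l', ψ) ⟨hl', hψ⟩
  · exact MeasureTheory.integrable_const _
  · refine Eventually.of_forall fun ψ l' hl' => ?_
    have h1 : HasDerivAt (fun l : ℂ => fun k => (ψ k : ℂ) + l * σ k) σ' l' := by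
      rw [hasDerivAt_pi]
      intro k
      simpa using ((hasDerivAt_id l').mul_const (σ k : ℂ)).const_add (ψ k : ℂ)
    exact ((hΦ _ (hmem l' (hNim l' hl') ψ)).differentiableAt.hasFDerivAt).comp_hasDerivAt l' h1

lemma isPreconnected_open_strip (ξ : ℝ) : IsPreconnected {l : ℂ | |l.im| < ξ} := by
  have : {l : ℂ | |l.im| < ξ} = Complex.imLm ⁻¹' (Set.Ioo (-ξ) ξ) := by
    ext l; simp [abs_lt]
  rw [this]
  exact ((convex_Ioo (-ξ) ξ).linear_preimage Complex.imLm).isPreconnected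

/-- Shift of the contour of integration. -/
lemma torusAverage_shift {h : (Fin d → ℝ) → ℂ} {Φ : (Fin d → ℂ) → ℂ} {ξ : ℝ}
    (hΦ : AnalyticOnNhd ℂ Φ (strip d ξ)) (hΦh : ∀ ψ : Fin d → ℝ, Φ (fun k => (ψ k : ℂ)) = h ψ)
    (hper : ∀ ψ k, h (ψ + Pi.single k (2 * Real.pi)) = h ψ) {σ : Fin d → ℝ} (hσ : ∀ k, |σ k| ≤ 1)
    {l : ℂ} (hl : |l.im| < ξ) :
    torusAverage (fun ψ : Fin d → ℝ => Φ (fun k => ψ k + l * σ k)) = torusAverage h := by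
  have hξ : 0 < ξ := (abs_nonneg _).trans_lt hl
  have hc : Continuous h := by
    have : h = fun ψ : Fin d → ℝ => Φ (fun k => (ψ k : ℂ)) := funext fun ψ => (hΦh ψ).symm
    rw [this]
    exact hΦ.continuousOn.comp_continuous (by fun_prop) fun ψ k => by simp [hξ.le]
  set G : ℂ → ℂ := fun l => torusAverage (fun ψ : Fin d → ℝ => Φ (fun k => ψ k + l * σ k)) with hG
  have hopen : IsOpen {l : ℂ | |l.im| < ξ} :=
    isOpen_lt (continuous_abs.comp Complex.continuous_im) continuous_const
  have hana : AnalyticOnNhd ℂ G {l : ℂ | |l.im| < ξ} := by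
    refine DifferentiableOn.analyticOnNhd (fun l hl => ?_) hopen
    exact ((differentiableAt_integral_translate hΦ hσ isCompact_Icc hl).const_smul
      (((2 * Real.pi) ^ d)⁻¹ : ℝ)).differentiableWithinAt
  -- A real shift is a translation of the torus, so G is constant on the real axis and the identity
  -- theorem extends this to complex shifts. Only the real function h has to be periodic, not Φ.
  have hreal : ∀ x : ℝ, G x = torusAverage h := by
    intro x
    rw [← torusAverage_translate hc hper (fun k => x * σ k), hG]
    simp_rw [← hΦh]
    simp
  have hfreq : ∃ᶠ z in 𝓝[≠] (0 : ℂ), G z = (fun _ => torusAverage h) z := by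
    have h1 : Tendsto (fun x : ℝ => (x : ℂ)) (𝓝[≠] 0) (𝓝[≠] 0) := by
      refine tendsto_nhdsWithin_iff.mpr ⟨?_, ?_⟩
      · exact (Complex.continuous_ofReal.tendsto' 0 0 (by simp)).mono_left nhdsWithin_le_nhds
      · filter_upwards [self_mem_nhdsWithin] with x hx
        simpa using hx
    exact h1.frequently (Eventually.of_forall hreal).frequently
  exact hana.eqOn_of_preconnected_of_frequently_eq analyticOnNhd_const
    (isPreconnected_open_strip ξ) (z₀ := 0) (by simpa using hξ) hfreq hl

lemma analyticOnNhd_character (ν : Fin d → ℤ) (s : Set (Fin d → ℂ)) :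
    AnalyticOnNhd ℂ (fun z => Wiener.character z ν) s := by
  intro z _
  have h1 : ∀ k, AnalyticAt ℂ (fun z : Fin d → ℂ => z k) z := fun k =>
    (ContinuousLinearMap.proj (R := ℂ) (φ := fun _ : Fin d => ℂ) k).analyticAt z
  have h2 : AnalyticAt ℂ (fun z : Fin d → ℂ => Complex.I * ∑ k, (ν k : ℂ) * z k) z :=
    analyticAt_const.mul (Finset.analyticAt_fun_sum _ fun k _ => analyticAt_const.mul (h1 k))
  exact h2.cexp

lemma norm_torusAverage_le {h : (Fin d → ℝ) → ℂ} {C : ℝ}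
    (hC : ∀ ψ ∈ Set.Icc (0 : Fin d → ℝ) (fun _ => 2 * Real.pi), ‖h ψ‖ ≤ C) :
    ‖torusAverage h‖ ≤ C := by
  have hpi : (0 : ℝ) < (2 * Real.pi) ^ d := by positivity
  have hvol : (MeasureTheory.volume (Set.Icc (0 : Fin d → ℝ) (fun _ => 2 * Real.pi))).toReal =
      (2 * Real.pi) ^ d := by
    rw [Real.volume_Icc_pi_toReal (fun _ => by positivity)]
    simp
  have h1 := MeasureTheory.norm_setIntegral_le_of_norm_le_const
    (μ := MeasureTheory.volume) (s := Set.Icc (0 : Fin d → ℝ) (fun _ => 2 * Real.pi))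
    isCompact_Icc.measure_lt_top hC
  rw [MeasureTheory.measureReal_def, hvol] at h1
  rw [torusAverage, norm_smul, norm_inv, Real.norm_of_nonneg hpi.le, inv_mul_le_iff₀ hpi]
  linarith

/-- The Fourier coefficients of a function analytic in a strip decay exponentially. -/
lemma exists_norm_fourierMode_le {f : (Fin d → ℝ) → ℝ} (hper : IsTorusPeriodic f) {ξ : ℝ}
    (hf : IsAnalyticInStrip f ξ) {η : ℝ} (hη0 : 0 ≤ η) (hη : η < ξ) :
    ∃ M ≥ 0, ∀ ν, ‖fourierMode f ν‖ ≤ M * Real.exp (-(η * modeLength ν)) := by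
  obtain ⟨F, hF, hFf⟩ := hf
  set box : Set (Fin d → ℂ) := Set.univ.pi fun _ => Set.Icc 0 (2 * Real.pi) ×ℂ Set.Icc (-η) η
  have hbox : IsCompact box := isCompact_univ_pi fun _ => isCompact_Icc.reProdIm isCompact_Icc
  obtain ⟨C, hC⟩ := hbox.exists_bound_of_continuousOn (hF.continuousOn.mono fun z hz k => by
    have := (hz k trivial).2
    exact abs_le.mpr ⟨by linarith [this.1], by linarith [this.2]⟩)
  refine ⟨max C 0, le_max_right _ _, fun ν => ?_⟩
  -- Shifting ψ_k by -iη sign(ν_k) turns |e^{-iν·ψ}| into e^{-η|ν|}.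
  set σ : Fin d → ℝ := fun k => -(SignType.sign (ν k : ℝ) : ℝ) with hσ
  have hσ1 : ∀ k, |σ k| ≤ 1 := fun k => by
    rw [hσ]
    rcases lt_trichotomy (ν k : ℝ) 0 with h | h | h <;> simp [h]
  set Φ : (Fin d → ℂ) → ℂ := fun z => Wiener.character z (-ν) * F z with hΦ
  have hl : |(Complex.I * η : ℂ).im| < ξ := by simpa [abs_of_nonneg hη0] using hη
  have hchar : ∀ (ψ : Fin d → ℝ) k,
      Wiener.character (fun j => (((ψ + Pi.single k (2 * Real.pi) : Fin d → ℝ) j : ℝ) : ℂ)) (-ν) =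
      Wiener.character (fun j => (ψ j : ℂ)) (-ν) := fun ψ k => by
    rw [← Wiener.character_add_single (fun j => (ψ j : ℂ)) k]
    congr 1
    ext j
    by_cases hj : j = k
    · subst hj; simp
    · simp [hj]
  have hmode : fourierMode f ν =
      torusAverage (fun ψ : Fin d → ℝ => Φ (fun k => ψ k + Complex.I * η * σ k)) := by
    rw [torusAverage_shift (h := fun ψ => Wiener.character (fun k => (ψ k : ℂ)) (-ν) * (f ψ : ℂ))
      (Φ := Φ) ((analyticOnNhd_character _ _).mul hF) (fun ψ => by rw [hΦ, ← hFf])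
      (fun ψ k => by rw [hchar, hper ψ k]) hσ1 hl, fourierMode]
    simp_rw [exp_neg_freqDot]
  rw [hmode]
  refine norm_torusAverage_le fun ψ hψ => ?_
  rw [hΦ, norm_mul, mul_comm]
  refine mul_le_mul ?_ ?_ (norm_nonneg _) (le_max_right _ _)
  · refine (hC _ fun k _ => ⟨?_, ?_⟩).trans (le_max_left _ _)
    · simpa using ⟨hψ.1 k, hψ.2 k⟩
    · have : ((ψ k : ℂ) + Complex.I * η * σ k).im = η * σ k := by simp
      rw [Set.mem_preimage, this, Set.mem_Icc, ← abs_le, abs_mul, abs_of_nonneg hη0]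
      exact mul_le_of_le_one_right hη0 (hσ1 k)
  · rw [Wiener.character, Complex.norm_exp]
    refine Real.exp_le_exp.mpr (le_of_eq ?_)
    have : (Complex.I * ∑ k, (((-ν) k : ℤ) : ℂ) * ((ψ k : ℂ) + Complex.I * η * σ k)).re =
        ∑ k, η * (ν k * σ k) := by
      simp [Complex.mul_im]
      refine Finset.sum_congr rfl fun k _ => by ring
    rw [this, ← Finset.mul_sum, ← mul_neg, modeLength]
    congr 1
    push_cast
    rw [← Finset.sum_neg_distrib]
    refine Finset.sum_congr rfl fun k _ => ?_
    rw [hσ, mul_neg, Nat.cast_natAbs, Int.cast_abs, mul_comm, sign_mul_self]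

/-! ### Symmetry, mean value and summability over the lattice of modes. -/

lemma fourierMode_neg (f : (Fin d → ℝ) → ℝ) (ν : Fin d → ℤ) :
    fourierMode f (-ν) = starRingEnd ℂ (fourierMode f ν) := by
  rw [fourierMode, fourierMode, torusAverage, torusAverage]
  simp only [exp_neg_freqDot, Complex.real_smul, map_mul, Complex.conj_ofReal]
  rw [← integral_conj]
  congr 2
  ext ψ
  simp [Wiener.character, ← Complex.exp_conj]

lemma fourierMode_zero (f : (Fin d → ℝ) → ℝ) : fourierMode f 0 = (torusAverage f : ℝ) := by
  rw [fourierMode, torusAverage, torusAverage]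
  simp only [exp_neg_freqDot, neg_zero, Wiener.character_zero, one_mul, Complex.real_smul,
    smul_eq_mul, Complex.ofReal_mul]
  rw [integral_complex_ofReal]

lemma continuous_of_isAnalyticInStrip {f : (Fin d → ℝ) → ℝ} {ξ : ℝ} (hξ : 0 ≤ ξ)
    (hf : IsAnalyticInStrip f ξ) : Continuous f := by
  obtain ⟨F, hF, hFf⟩ := hf
  have h1 : Continuous fun ψ : Fin d → ℝ => F (fun k => (ψ k : ℂ)) :=
    hF.continuousOn.comp_continuous (by fun_prop) fun ψ k => by simpa using hξ
  have h2 : f = fun ψ => (F (fun k => (ψ k : ℂ))).re := funext fun ψ => by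
    rw [hFf, Complex.ofReal_re]
  rw [h2]
  exact Complex.continuous_re.comp h1

/-- A finite set of modes sits in a box, over which the sum of products factors. -/
lemma summable_prod_comp {g : ℤ → ℝ} (h0 : ∀ n, 0 ≤ g n) (hg : Summable g) :
    Summable fun ν : Fin d → ℤ => ∏ k, g (ν k) := by
  have hnn : ∀ ν : Fin d → ℤ, 0 ≤ ∏ k, g (ν k) := fun ν => Finset.prod_nonneg fun k _ => h0 _
  refine summable_of_sum_le (c := ∏ _k : Fin d, ∑' n, g n) hnn fun u => ?_
  have hsub : u ⊆ Fintype.piFinset fun k => u.image fun ν => ν k := fun ν hν => by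
    rw [Fintype.mem_piFinset]
    exact fun k => Finset.mem_image_of_mem _ hν
  calc ∑ ν ∈ u, ∏ k, g (ν k)
      ≤ ∑ ν ∈ Fintype.piFinset fun k => u.image fun ν => ν k, ∏ k, g (ν k) :=
        Finset.sum_le_sum_of_subset_of_nonneg hsub fun ν _ _ => hnn ν
    _ = ∏ k : Fin d, ∑ n ∈ u.image fun ν => ν k, g n := (Finset.prod_univ_sum _ _).symm
    _ ≤ ∏ _k : Fin d, ∑' n, g n := Finset.prod_le_prod
        (fun _ _ => Finset.sum_nonneg fun n _ => h0 n)
        fun k _ => hg.sum_le_tsum _ fun n _ => h0 n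

/-- Exponentially decaying coefficients are summable. -/
lemma summable_exp_neg_modeLength {η : ℝ} (hη : 0 < η) :
    Summable fun ν : Fin d → ℤ => Real.exp (-(η * modeLength ν)) := by
  have h1 : ∀ ν : Fin d → ℤ, Real.exp (-(η * modeLength ν)) =
      ∏ k, Real.exp (-η) ^ (ν k).natAbs := fun ν => by
    rw [Finset.prod_pow_eq_pow_sum, ← Real.exp_nat_mul, modeLength]
    congr 1; ring
  have h2 : Summable fun n : ℤ => Real.exp (-η) ^ n.natAbs :=
    Wiener.summable_pow_natAbs (Real.exp_pos _).le (by rw [Real.exp_lt_one_iff]; linarith)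
  exact (summable_prod_comp (fun n => by positivity) h2).congr fun ν => (h1 ν).symm

end

section

variable {d : ℕ}

/-! ### Small divisors -/

lemma finite_modeLength_le (N : ℕ) : {ν : Fin d → ℤ | modeLength ν ≤ N}.Finite := by
  refine (Set.finite_Icc (fun _ : Fin d => -(N : ℤ)) (fun _ => (N : ℤ))).subset fun ν hν => ?_
  have : ∀ k, |ν k| ≤ N := fun k => by
    have h1 : (ν k).natAbs ≤ modeLength ν :=
      Finset.single_le_sum (f := fun k => (ν k).natAbs) (fun _ _ => Nat.zero_le _)
        (Finset.mem_univ k)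
    have h2 : (ν k).natAbs ≤ N := h1.trans hν
    rw [Int.abs_eq_natAbs]
    exact_mod_cast h2
  exact ⟨fun k => (abs_le.mp (this k)).1, fun k => (abs_le.mp (this k)).2⟩

lemma modeLength_pos {ν : Fin d → ℤ} (hν : ν ≠ 0) : 0 < modeLength ν := by
  obtain ⟨k, hk⟩ := Function.ne_iff.mp hν
  exact (Int.natAbs_pos.mpr hk).trans_le (Finset.single_le_sum (f := fun k => (ν k).natAbs)
    (fun _ _ => Nat.zero_le _) (Finset.mem_univ k))

lemma smallDivisors_finite (f : (Fin d → ℝ) → ℝ) (ω : Fin d → ℝ) (n : ℕ) :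
    (smallDivisors f ω n).Finite := by
  refine ((finite_modeLength_le (d := d) (2 ^ n)).image fun ν => |freqDot ω ν|).subset ?_
  rintro s ⟨ν, -, h, -, rfl⟩
  exact ⟨ν, h, rfl⟩

lemma beta_le (f : (Fin d → ℝ) → ℝ) (ω : Fin d → ℝ) {n : ℕ} {ν : Fin d → ℤ} (hν : ν ≠ 0)
    (hn : modeLength ν ≤ 2 ^ n) (hf : fourierMode f ν ≠ 0) : beta f ω n ≤ |freqDot ω ν| := by
  have hmem : |freqDot ω ν| ∈ smallDivisors f ω n := ⟨ν, modeLength_pos hν, hn, hf, rfl⟩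
  rw [beta, if_pos ⟨_, hmem⟩]
  exact csInf_le (smallDivisors_finite f ω n).bddBelow hmem

lemma beta_pos (f : (Fin d → ℝ) → ℝ) {ω : Fin d → ℝ} (hω : RationallyIndependent ω) (n : ℕ) :
    0 < beta f ω n := by
  rw [beta]
  split_ifs with h
  · obtain ⟨ν, h1, -, -, h2⟩ := h.csInf_mem (smallDivisors_finite f ω n)
    rw [h2, abs_pos]
    refine hω ν fun h0 => ?_
    rw [h0, modeLength_zero] at h1
    exact lt_irrefl _ h1
  · exact one_pos

/-- If `ε_n(ω) → 0`, then the small divisors decay slower than any exponential. -/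
lemma exists_le_abs_freqDot {f : (Fin d → ℝ) → ℝ} {ω : Fin d → ℝ} (hω : RationallyIndependent ω)
    (hlim : Tendsto (epsilonSeq f ω) atTop (𝓝 0)) {η : ℝ} (hη : 0 < η) :
    ∃ c > 0, ∀ ν, ν ≠ 0 → fourierMode f ν ≠ 0 →
      c * Real.exp (-(η * modeLength ν)) ≤ |freqDot ω ν| := by
  obtain ⟨N, hN⟩ := (hlim.eventually (gt_mem_nhds (half_pos hη))).exists_forall_of_atTop
  have hbeta : ∀ n ≥ N, Real.exp (-(2 ^ n * (η / 2))) ≤ beta f ω n := fun n hn => by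
    have h1 := hN n hn
    rw [epsilonSeq, one_div, inv_mul_lt_iff₀ (by positivity), one_div, Real.log_inv] at h1
    rw [← Real.le_log_iff_exp_le (beta_pos f hω n)]
    linarith
  -- The constant is the bound at level N, which serves all |ν| ≤ 2^N. A longer ν is treated at
  -- level n = ⌈log₂|ν|⌉, where 2^n ≤ 2|ν|; this factor 2 is why the threshold for ε_n is η/2.
  refine ⟨Real.exp (-(2 ^ N * (η / 2))), Real.exp_pos _, fun ν hν hf => ?_⟩
  have hl := modeLength_pos hν
  obtain ⟨n, hn, hn1, hn2⟩ : ∃ n ≥ N, modeLength ν ≤ 2 ^ n ∧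
      ((2 : ℝ) ^ n * (η / 2) ≤ 2 ^ N * (η / 2) + η * modeLength ν) := by
    by_cases h : modeLength ν ≤ 2 ^ N
    · exact ⟨N, le_rfl, h, le_add_of_nonneg_right (by positivity)⟩
    · refine ⟨Nat.clog 2 (modeLength ν), ?_, Nat.le_pow_clog one_lt_two _, ?_⟩
      · by_contra! hlt
        exact h ((Nat.le_pow_clog one_lt_two _).trans (Nat.pow_le_pow_right two_pos hlt.le))
      · have h1 : 1 < modeLength ν := lt_of_le_of_lt Nat.one_le_two_pow (not_le.mp h)
        have h2 := Nat.pow_pred_clog_lt_self one_lt_two h1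
        have h3 : 0 < Nat.clog 2 (modeLength ν) := Nat.clog_pos one_lt_two h1
        have h4 : (2 : ℝ) ^ Nat.clog 2 (modeLength ν) ≤ 2 * modeLength ν := by
          obtain ⟨m, hm⟩ := Nat.exists_eq_succ_of_ne_zero h3.ne'
          rw [hm, Nat.pred_succ] at h2
          rw [hm, pow_succ, mul_comm]
          have : (2 : ℝ) ^ m ≤ modeLength ν := by exact_mod_cast h2.le
          linarith
        have h5 : (0 : ℝ) ≤ 2 ^ N * (η / 2) := by positivity
        nlinarith
  refine le_trans ?_ ((hbeta n hn).trans (beta_le f ω hν hn1 hf))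
  rw [← Real.exp_add]
  exact Real.exp_le_exp.mpr (by linarith)

/-! ### The resolvent multiplier -/

open Wiener

open Classical in
/-- The multiplier `ε / D(ω·ν)`, whenever it is bounded. -/
def resolvent (a : ℝ) (ω : Fin d → ℝ) (ε : ℂ) : Multiplier d :=
  if h : ∃ C, ∀ ν, ‖ε / divisor a ε (freqDot ω ν)‖ ≤ C then Multiplier.mk _ h.choose_spec else 0

lemma resolvent_apply {a : ℝ} {ω : Fin d → ℝ} {ε : ℂ} {C : ℝ}
    (h : ∀ ν, ‖ε / divisor a ε (freqDot ω ν)‖ ≤ C) (ν : Fin d → ℤ) :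
    resolvent a ω ε ν = ε / divisor a ε (freqDot ω ν) := by
  rw [resolvent, dif_pos ⟨C, h⟩, Multiplier.mk_apply]

lemma Multiplier.inverse_apply {φ : Multiplier d} (hφ : IsUnit φ) (ν : Fin d → ℤ) :
    (Ring.inverse φ) ν = (φ ν)⁻¹ := by
  have h1 := Ring.inverse_mul_cancel φ hφ
  have h2 : (Ring.inverse φ) ν * φ ν = 1 := by
    have := congrArg (fun x : Multiplier d => x ν) h1
    simpa [lp.infty_coeFn_mul] using this
  exact eq_inv_of_mul_eq_one_left h2

/-- D_ε = D_{ε₀}(1 + (ε - ε₀)k) with k = (a - σ²)/D_{ε₀}. Although σ² is unbounded over the modes,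
|Re D_{ε₀}| = |Re ε₀||a - σ²| bounds k uniformly, so the claim reduces to analyticity of inversion
at 1 in the Banach algebra ℓ^∞. -/
lemma analyticAt_resolvent {a c : ℝ} {ω : Fin d → ℝ} {ε₀ : ℂ} (hre : ε₀.re ≠ 0) (hc : 0 < c)
    (hD : ∀ ν, c ≤ ‖divisor a ε₀ (freqDot ω ν)‖) : AnalyticAt ℂ (resolvent a ω) ε₀ := by
  have hD0 : ∀ ν, divisor a ε₀ (freqDot ω ν) ≠ 0 := fun ν =>
    norm_pos_iff.mp (hc.trans_le (hD ν))
  have hr : ∀ ν, ‖(divisor a ε₀ (freqDot ω ν))⁻¹‖ ≤ c⁻¹ := fun ν => by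
    rw [norm_inv]
    exact inv_anti₀ hc (hD ν)
  have hk : ∀ ν, ‖((a - freqDot ω ν ^ 2 : ℝ) : ℂ) / divisor a ε₀ (freqDot ω ν)‖ ≤ |ε₀.re|⁻¹ := by
    intro ν
    rw [norm_div, div_le_iff₀ (norm_pos_iff.mpr (hD0 ν)), Complex.norm_real, Real.norm_eq_abs,
      inv_mul_eq_div, le_div_iff₀' (abs_pos.mpr hre)]
    exact abs_re_mul_le_norm_divisor a ε₀ _
  set r₀ : Multiplier d := Multiplier.mk _ hr with hr₀
  set k : Multiplier d := Multiplier.mk _ hk with hk₀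
  have h1 : AnalyticAt ℂ (fun ε : ℂ => 1 + (ε - ε₀) • k) ε₀ :=
    analyticAt_const.add ((analyticAt_id.sub analyticAt_const).smul analyticAt_const)
  have hval : (1 : Multiplier d) + (ε₀ - ε₀) • k = ((1 : (Multiplier d)ˣ) : Multiplier d) := by
    simp
  have h2 : AnalyticAt ℂ (fun ε : ℂ => Ring.inverse (1 + (ε - ε₀) • k)) ε₀ :=
    AnalyticAt.comp (g := Ring.inverse) (f := fun ε : ℂ => (1 : Multiplier d) + (ε - ε₀) • k)
      (by rw [hval]; exact analyticAt_inverse (𝕜 := ℂ) (1 : (Multiplier d)ˣ)) h1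
  have h3 : AnalyticAt ℂ (fun ε : ℂ => ε • (r₀ * Ring.inverse (1 + (ε - ε₀) • k))) ε₀ :=
    analyticAt_id.smul (analyticAt_const.mul h2)
  refine h3.congr ?_
  have hunit : ∀ᶠ ε in 𝓝 ε₀, IsUnit (1 + (ε - ε₀) • k) := by
    have := h1.continuousAt.tendsto
    rw [hval] at this
    exact this.eventually (Units.isOpen.mem_nhds (1 : (Multiplier d)ˣ).isUnit)
  filter_upwards [hunit] with ε hε
  have hcoord : ∀ ν, (ε • (r₀ * Ring.inverse (1 + (ε - ε₀) • k)) : Multiplier d) ν =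
      ε / divisor a ε (freqDot ω ν) := by
    intro ν
    have hinv := Multiplier.inverse_apply hε ν
    have hone : (1 + (ε - ε₀) • k : Multiplier d) ν =
        1 + (ε - ε₀) * (((a - freqDot ω ν ^ 2 : ℝ) : ℂ) / divisor a ε₀ (freqDot ω ν)) := rfl
    rw [lp.coeFn_smul, Pi.smul_apply, lp.infty_coeFn_mul, Pi.mul_apply, hinv, hone, hr₀,
      Multiplier.mk_apply, smul_eq_mul, ← mul_inv, div_eq_mul_inv]
    congr 2
    have hcancel := mul_inv_cancel₀ (hD0 ν)
    have hexp : divisor a ε (freqDot ω ν) = divisor a ε₀ (freqDot ω ν) +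
        (ε - ε₀) * ((a - freqDot ω ν ^ 2 : ℝ) : ℂ) := by
      rw [divisor, divisor]; ring
    rw [hexp]
    linear_combination (ε - ε₀) * ((a - freqDot ω ν ^ 2 : ℝ) : ℂ) * hcancel
  -- Uniform boundedness certifies that `resolvent` is not its default value 0.
  have hb : ∀ ν, ‖ε / divisor a ε (freqDot ω ν)‖ ≤
      ‖(ε • (r₀ * Ring.inverse (1 + (ε - ε₀) • k)) : Multiplier d)‖ := fun ν => by
    rw [← hcoord]
    exact Multiplier.norm_apply_le _ ν
  ext ν
  rw [hcoord, resolvent_apply hb]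

lemma divisor_neg (a ε : ℝ) (σ : ℝ) :
    divisor a ε (-σ) = starRingEnd ℂ (divisor a ε σ) := by
  simp [divisor]

lemma freqDot_neg (ω : Fin d → ℝ) (ν : Fin d → ℤ) : freqDot ω (-ν) = -freqDot ω ν := by
  simp [freqDot]

lemma freqDot_add (ω : Fin d → ℝ) (μ ν : Fin d → ℤ) :
    freqDot ω (μ + ν) = freqDot ω μ + freqDot ω ν := by
  simp [freqDot, mul_add, Finset.sum_add_distrib]

end

section

variable {d : ℕ} {ρ : ℝ≥0}

open Wiener

/-! ### The iteration in the Wiener algebra -/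

/-- The almost resonant modes. -/
def resonantModes (a κ : ℝ) (ω : Fin d → ℝ) (ε : ℂ) : Set (Fin d → ℤ) :=
  {ν | ‖divisor a ε (freqDot ω ν)‖ < κ * ‖ε‖}

/-! ### The resolvent and products of almost resonant modes. -/

namespace DivisorBounds

variable {a b κ K : ℝ} {ε : ℂ} {ω : Fin d → ℝ}

lemma norm_divisor_pos (h : DivisorBounds a b κ K ε) (hb : 0 < b) (hε : 0 < ‖ε‖) (σ : ℝ) :
    0 < ‖divisor a ε σ‖ := by
  have h1 := h.lower σ
  have h2 : 0 < b * ‖ε‖ ^ 2 := by positivity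
  by_contra hn
  have : ‖divisor a ε σ‖ = 0 := le_antisymm (not_lt.mp hn) (norm_nonneg _)
  rw [this, mul_zero] at h1
  linarith

lemma norm_div_divisor_le (h : DivisorBounds a b κ K ε) (hb : 0 < b) (hε : 0 < ‖ε‖) (σ : ℝ) :
    ‖ε / divisor a ε σ‖ ≤ K / (b * ‖ε‖) := by
  rw [norm_div, div_le_div_iff₀ (h.norm_divisor_pos hb hε σ) (by positivity)]
  linarith [h.lower σ, mul_comm ‖ε‖ (b * ‖ε‖), mul_assoc b ‖ε‖ ‖ε‖, sq ‖ε‖]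

/-- No negative power of ε appears: at a fixed nonzero frequency the resolvent is O(|ε|), and the
price 1 + 1/σ² is later paid by the decay of the forcing. -/
lemma norm_div_divisor_le_freq (h : DivisorBounds a b κ K ε) (hb : 0 < b) (hε : 0 < ‖ε‖)
    (hK : 0 < K) {σ : ℝ} (hσ : σ ≠ 0) :
    ‖ε / divisor a ε σ‖ ≤ K / b * ‖ε‖ * (1 + 1 / σ ^ 2) := by
  have h0 := h.norm_divisor_pos hb hε σ
  have hs : 0 < σ ^ 2 := by positivity
  have h1 : 1 ≤ K / b * (1 + 1 / σ ^ 2) * ‖divisor a ε σ‖ := by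
    have : K / b * (1 + 1 / σ ^ 2) * ‖divisor a ε σ‖ =
        K * (1 + σ ^ 2) * ‖divisor a ε σ‖ / (b * σ ^ 2) := by field_simp; ring
    rw [this, le_div_iff₀ (by positivity), one_mul]
    exact h.lower_freq σ
  rw [norm_div, div_le_iff₀ h0]
  nlinarith

lemma resolvent_apply (h : DivisorBounds a b κ K ε) (hb : 0 < b) (hε : 0 < ‖ε‖)
    (ν : Fin d → ℤ) : resolvent a ω ε ν = ε / divisor a ε (freqDot ω ν) :=
  ResponseSolution.resolvent_apply (fun ν => h.norm_div_divisor_le hb hε (freqDot ω ν)) ν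

/-- A mode ν = μ + (ν - μ) with all three almost resonant is excluded by `no_sum`, so each term of
the convolution vanishes. -/
lemma proj_mul (h : DivisorBounds a b κ K ε) (x y : Wiener d ρ) :
    restrict (resonantModes a κ ω ε)
      (restrict (resonantModes a κ ω ε) x * restrict (resonantModes a κ ω ε) y) = 0 := by
  set s := resonantModes a κ ω ε
  ext ν
  by_cases hν : ν ∈ s
  · rw [coeff_restrict_of_mem _ hν, coeff_mul, coeff_zero]
    refine (tsum_congr fun μ => ?_).trans tsum_zero
    by_cases hμ : μ ∈ s
    · by_cases hνμ : ν - μ ∈ s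
      · have h1 := h.no_sum _ _ hμ hνμ
        rw [← freqDot_add, add_sub_cancel] at h1
        exact absurd hν (not_lt.mpr h1)
      · rw [coeff_restrict_of_notMem _ hνμ, mul_zero]
    · rw [coeff_restrict_of_notMem _ hμ, zero_mul]
  · rw [coeff_restrict_of_notMem _ hν, coeff_zero]

/-- If ν and ν - μ are both almost resonant, each frequency is at most K|ε|, hence |ω·μ| ≤ 2K|ε|; no
other mode of w contributes. -/
lemma proj_mul_eq (h : DivisorBounds a b κ K ε) (w x : Wiener d ρ) :
    restrict (resonantModes a κ ω ε) (w * restrict (resonantModes a κ ω ε) x) =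
      restrict (resonantModes a κ ω ε)
        (restrict {μ | |freqDot ω μ| ≤ 2 * K * ‖ε‖} w * restrict (resonantModes a κ ω ε) x) := by
  set s := resonantModes a κ ω ε
  ext ν
  by_cases hν : ν ∈ s
  · rw [coeff_restrict_of_mem _ hν, coeff_restrict_of_mem _ hν, coeff_mul, coeff_mul]
    refine tsum_congr fun μ => ?_
    by_cases hνμ : ν - μ ∈ s
    · rw [coeff_restrict_of_mem w]
      have h1 := h.small _ hν
      have h2 := h.small _ hνμ
      have h3 : freqDot ω μ = freqDot ω ν - freqDot ω (ν - μ) := by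
        have := freqDot_add ω μ (ν - μ)
        rw [add_sub_cancel] at this
        linarith
      change |freqDot ω μ| ≤ _
      rw [h3]
      exact (abs_sub _ _).trans (by linarith)
    · rw [coeff_restrict_of_notMem x hνμ, mul_zero, mul_zero]
  · rw [coeff_restrict_of_notMem _ hν, coeff_restrict_of_notMem _ hν]

lemma norm_proj_resolvent_le (h : DivisorBounds a b κ K ε) (hb : 0 < b) (hε : 0 < ‖ε‖)
    (x : Wiener d ρ) :
    ‖restrict (resonantModes a κ ω ε) (multiplier (resolvent a ω ε) x)‖ ≤
      K / (b * ‖ε‖) * ‖restrict (resonantModes a κ ω ε) x‖ := by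
  refine norm_le_of_coeff_le fun ν => ?_
  by_cases hν : ν ∈ resonantModes a κ ω ε
  · rw [coeff_restrict_of_mem _ hν, coeff_restrict_of_mem _ hν, coeff_multiplier, norm_mul,
      h.resolvent_apply hb hε]
    exact mul_le_mul_of_nonneg_right (h.norm_div_divisor_le hb hε _) (norm_nonneg _)
  · rw [coeff_restrict_of_notMem _ hν, coeff_restrict_of_notMem _ hν, norm_zero, mul_zero]

lemma norm_compl_resolvent_le (h : DivisorBounds a b κ K ε) (hb : 0 < b) (hε : 0 < ‖ε‖)
    (hκ : 0 < κ) (x : Wiener d ρ) :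
    ‖multiplier (resolvent a ω ε) x -
      restrict (resonantModes a κ ω ε) (multiplier (resolvent a ω ε) x)‖ ≤ 1 / κ * ‖x‖ := by
  refine norm_le_of_coeff_le fun ν => ?_
  rw [coeff_sub]
  by_cases hν : ν ∈ resonantModes a κ ω ε
  · rw [coeff_restrict_of_mem _ hν, sub_self, norm_zero]
    positivity
  · rw [coeff_restrict_of_notMem _ hν, sub_zero, coeff_multiplier, norm_mul,
      h.resolvent_apply hb hε]
    refine mul_le_mul_of_nonneg_right ?_ (norm_nonneg _)
    have hν' : κ * ‖ε‖ ≤ ‖divisor a ε (freqDot ω ν)‖ := not_lt.mp hν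
    rw [norm_div, div_le_div_iff₀ (h.norm_divisor_pos hb hε _) hκ]
    linarith

end DivisorBounds

/-- A forcing term whose Fourier coefficients dominate the small divisors; `S` bounds the sum of
the coefficients divided by the divisors. -/
structure Forcing (F : Wiener d ρ) (ω : Fin d → ℝ) (S : ℝ) : Prop where
  freq_ne_zero : ∀ ν, F.coeff ν ≠ 0 → freqDot ω ν ≠ 0
  bound : ∃ G : (Fin d → ℤ) → ℝ, HasSum G S ∧ ∀ ν,
    ‖F.coeff ν‖ * modeWeight ρ ν * (1 + 1 / freqDot ω ν ^ 2) ≤ G ν ∧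
    ‖F.coeff ν‖ * modeWeight ρ ν * (1 + 1 / freqDot ω ν ^ 2) * |freqDot ω ν|⁻¹ ≤ G ν

/-! ### Size of the linear response to the forcing. -/

namespace Forcing

variable {a b κ K S : ℝ} {ε : ℂ} {ω : Fin d → ℝ} {F : Wiener d ρ}

lemma norm_coeff_resolvent_le (hF : Forcing F ω S) (h : DivisorBounds a b κ K ε) (hb : 0 < b)
    (hε : 0 < ‖ε‖) (hK : 0 < K) (ν : Fin d → ℤ) :
    ‖(multiplier (resolvent a ω ε) F).coeff ν‖ * modeWeight ρ ν ≤
      K / b * ‖ε‖ * (‖F.coeff ν‖ * modeWeight ρ ν * (1 + 1 / freqDot ω ν ^ 2)) := by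
  rw [coeff_multiplier, norm_mul, h.resolvent_apply hb hε]
  by_cases h0 : F.coeff ν = 0
  · simp [h0]
  · have h1 := h.norm_div_divisor_le_freq hb hε hK (hF.freq_ne_zero ν h0)
    have h2 := modeWeight_pos (ρ := ρ) ν
    calc _ ≤ (K / b * ‖ε‖ * (1 + 1 / freqDot ω ν ^ 2)) * ‖F.coeff ν‖ * modeWeight ρ ν := by gcongr
      _ = _ := by ring

lemma norm_resolvent_le (hF : Forcing F ω S) (h : DivisorBounds a b κ K ε) (hb : 0 < b)
    (hε : 0 < ‖ε‖) (hK : 0 < K) :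
    ‖multiplier (resolvent a ω ε) F‖ ≤ K / b * ‖ε‖ * S := by
  obtain ⟨G, hG, hFG⟩ := hF.bound
  refine hasSum_le (fun ν => ?_) (Wiener.hasSum_norm _) (hG.mul_left (K / b * ‖ε‖))
  refine (hF.norm_coeff_resolvent_le h hb hε hK ν).trans ?_
  gcongr
  exact (hFG ν).1

/-- On the selected modes 1 = |ω·μ|·|ω·μ|⁻¹, where the first factor gains 2K|ε| and the second is
absorbed in G. The resulting O(|ε|²/b) compensates the resolvent norm of order 1/(b|ε|). -/
lemma norm_restrict_resolvent_le (hF : Forcing F ω S) (h : DivisorBounds a b κ K ε) (hb : 0 < b)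
    (hε : 0 < ‖ε‖) (hK : 0 < K) :
    ‖restrict {μ | |freqDot ω μ| ≤ 2 * K * ‖ε‖} (multiplier (resolvent a ω ε) F)‖ ≤
      K / b * ‖ε‖ * (2 * K * ‖ε‖) * S := by
  obtain ⟨G, hG, hFG⟩ := hF.bound
  refine hasSum_le (fun ν => ?_) (Wiener.hasSum_norm _)
    (hG.mul_left (K / b * ‖ε‖ * (2 * K * ‖ε‖)))
  have hw := modeWeight_pos (ρ := ρ) ν
  have hG0 : 0 ≤ G ν := le_trans (by positivity) (hFG ν).1
  by_cases hν : ν ∈ {μ | |freqDot ω μ| ≤ 2 * K * ‖ε‖}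
  · rw [coeff_restrict_of_mem _ hν]
    by_cases h0 : F.coeff ν = 0
    · rw [coeff_multiplier, h0, mul_zero, norm_zero, zero_mul]
      positivity
    refine (hF.norm_coeff_resolvent_le h hb hε hK ν).trans ?_
    have hs : 0 < |freqDot ω ν| := abs_pos.mpr (hF.freq_ne_zero ν h0)
    have hν' : |freqDot ω ν| ≤ 2 * K * ‖ε‖ := hν
    have h1 : ‖F.coeff ν‖ * modeWeight ρ ν * (1 + 1 / freqDot ω ν ^ 2) =
        |freqDot ω ν| * (‖F.coeff ν‖ * modeWeight ρ ν * (1 + 1 / freqDot ω ν ^ 2) *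
          |freqDot ω ν|⁻¹) := by field_simp
    rw [h1, mul_assoc (K / b * ‖ε‖)]
    gcongr
    exact (hFG ν).2
  · rw [coeff_restrict_of_notMem _ hν, norm_zero, zero_mul]
    positivity

end Forcing

/-! ### The choice of the constants -/

/-- The arithmetic conditions of the iteration, with `x = |ε| / b⁷` small. -/
lemma iteration_arithmetic {K b x A θ V P Q U lam : ℝ} (hK : 1 ≤ K) (hb0 : 0 < b) (hb1 : b ≤ 1)
    (hx0 : 0 < x) (hx : 2000 * (K ^ 12 * x) ≤ 1) (hA : A = K / (x * b ^ 8))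
    (hθ : θ = K * x ^ 2 * b ^ 13) (hV : V = K * x * b ^ 6) (hP : P = 2 * K ^ 4 * x * b ^ 4)
    (hQ : Q = 32 * K ^ 10 * x ^ 2 * b ^ 8) (hU : U = 4 * K ^ 4 * x * b ^ 4)
    (hlam : lam = 48 * K ^ 6 / b ^ 4) :
    V + P + Q ≤ U ∧ A * (K * V ^ 2 + 2 * K * θ * P + 2 * K * U * Q + K * U ^ 3) ≤ P ∧
    K * (K * U ^ 2 + K * U ^ 3) ≤ Q ∧
    A * (2 * K * θ + 2 * K * Q + K * U ^ 2) + lam * (K * (2 * K * U + K * U ^ 2)) ≤ 1 / 2 ∧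
    A * (2 * K * U + K * U ^ 2) + lam * (K * (2 * K * U + K * U ^ 2)) ≤ lam / 2 ∧
    1 ≤ lam ∧ U ≤ 1 / K ∧ P + lam * Q ≤ K ^ 4 := by
  have hK0 : 0 < K := by linarith
  have hpow : ∀ i, i ≤ 12 → K ^ i * x ≤ 1 / 2000 := fun i hi => by
    have : K ^ i * x ≤ K ^ 12 * x := by gcongr
    linarith
  have hb : ∀ i, b ^ i ≤ 1 := fun i => pow_le_one₀ hb0.le hb1
  have hxb : ∀ i j, i ≤ 12 → K ^ i * x * b ^ j ≤ 1 / 2000 := fun i j hi =>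
    (mul_le_of_le_one_right (by positivity) (hb j)).trans (hpow i hi)
  have hU0 : 0 ≤ U := by rw [hU]; positivity
  have hU1 : U ≤ 1 := by rw [hU]; have := hxb 4 4 (by norm_num); linarith
  have hA0 : 0 < A := by rw [hA]; positivity
  have hlam0 : 0 < lam := by rw [hlam]; positivity
  have hUsq : K * (2 * K * U + K * U ^ 2) ≤ 3 * K ^ 2 * U := by
    have : U ^ 2 ≤ U := by nlinarith
    nlinarith [mul_le_mul_of_nonneg_left this (by positivity : 0 ≤ K ^ 2)]
  -- With `lam` of order b⁻⁴ and U of order x b⁴ = |ε|/b³, the product is of order x = |ε|/b⁷: one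
  -- of the terms that require |ε| ≲ b⁷.
  have hlamU : lam * (K * (2 * K * U + K * U ^ 2)) ≤ 576 * (K ^ 12 * x) := by
    calc _ ≤ lam * (3 * K ^ 2 * U) := by gcongr
      _ = 576 * (K ^ 12 * x) := by rw [hlam, hU]; field_simp; ring
  refine ⟨?_, ?_, ?_, ?_, ?_, ?_, ?_, ?_⟩
  · have e1 : V ≤ K ^ 4 * x * b ^ 4 := by
      rw [hV]
      have h1 : K ≤ K ^ 4 := le_self_pow₀ hK (by norm_num)
      have h2 : b ^ 6 ≤ b ^ 4 := pow_le_pow_of_le_one hb0.le hb1 (by norm_num)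
      gcongr
    have e2 : Q ≤ K ^ 4 * x * b ^ 4 := by
      have h1 := hxb 6 4 (by norm_num)
      calc Q = 32 * (K ^ 6 * x * b ^ 4) * (K ^ 4 * x * b ^ 4) := by rw [hQ]; ring
        _ ≤ 1 * (K ^ 4 * x * b ^ 4) := by gcongr; linarith
        _ = _ := one_mul _
    rw [hP, hU]; linarith
  -- A K V² is exactly P/2, which dictates P; the other terms are small multiples of P.
  · have e1 : A * (K * V ^ 2) = K ^ 4 * x * b ^ 4 := by rw [hA, hV]; field_simp
    have e2 : A * (2 * K * θ * P) = 4 * (K ^ 3 * x * b ^ 5) * (K ^ 4 * x * b ^ 4) := by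
      rw [hA, hθ, hP]; field_simp; ring
    have e3 : A * (2 * K * U * Q) = 256 * (K ^ 12 * x) * (K ^ 4 * x * b ^ 4) := by
      rw [hA, hU, hQ]; field_simp; ring
    have e4 : A * (K * U ^ 3) = 64 * (K ^ 10 * x) * (K ^ 4 * x * b ^ 4) := by
      rw [hA, hU]; field_simp; ring
    have h2 := hxb 3 5 (by norm_num)
    have h3 := hpow 12 le_rfl
    have h4 := hpow 10 (by norm_num)
    have hpos : 0 ≤ K ^ 4 * x * b ^ 4 := by positivity
    calc _ = A * (K * V ^ 2) + A * (2 * K * θ * P) + A * (2 * K * U * Q) + A * (K * U ^ 3) := by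
          ring
      _ = (1 + 4 * (K ^ 3 * x * b ^ 5) + 256 * (K ^ 12 * x) + 64 * (K ^ 10 * x)) *
          (K ^ 4 * x * b ^ 4) := by rw [e1, e2, e3, e4]; ring
      _ ≤ 2 * (K ^ 4 * x * b ^ 4) := by gcongr; linarith
      _ = P := by rw [hP]; ring
  · have h1 : U ^ 3 ≤ U ^ 2 := pow_le_pow_of_le_one hU0 hU1 (by norm_num)
    calc _ ≤ K * (K * U ^ 2 + K * U ^ 2) := by gcongr
      _ = Q := by rw [hQ, hU]; ring
  · have e1 : A * (2 * K * θ) = 2 * (K ^ 3 * x * b ^ 5) := by rw [hA, hθ]; field_simp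
    have e2 : A * (2 * K * Q) = 64 * (K ^ 12 * x) := by rw [hA, hQ]; field_simp; ring
    have e3 : A * (K * U ^ 2) = 16 * (K ^ 10 * x) := by rw [hA, hU]; field_simp; ring
    have h1 := hxb 3 5 (by norm_num)
    have h2 := hpow 12 le_rfl
    have h3 := hpow 10 (by norm_num)
    rw [mul_add, mul_add, e1, e2, e3]
    linarith
  -- AU is of order b⁻⁴ whatever x is, so it cannot be made small; `lam` is chosen so that 3AKU =
  -- `lam`/4.
  · have e1 : A * (2 * K * U + K * U ^ 2) ≤ lam / 4 := by
      have h1 : 2 * K * U + K * U ^ 2 ≤ 3 * K * U := by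
        have : U ^ 2 ≤ U := by nlinarith
        nlinarith
      calc _ ≤ A * (3 * K * U) := by gcongr
        _ = lam / 4 := by rw [hA, hU, hlam]; field_simp; ring
    have e2 : 1 ≤ lam / 4 := by
      rw [hlam, div_div, le_div_iff₀ (by positivity)]
      have := one_le_pow₀ hK (n := 6)
      have := hb 4
      linarith
    have h2 := hpow 12 le_rfl
    linarith
  · rw [hlam, le_div_iff₀ (by positivity)]
    have := one_le_pow₀ hK (n := 6)
    have := hb 4
    linarith
  · rw [hU, le_div_iff₀ hK0]
    have := hxb 5 4 (by norm_num)
    linarith [show 4 * K ^ 4 * x * b ^ 4 * K = 4 * (K ^ 5 * x * b ^ 4) by ring]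
  · have e1 : lam * Q = 1536 * (K ^ 12 * x * b ^ 4) * (K ^ 4 * x) := by
      rw [hlam, hQ]; field_simp; ring
    have h1 := hxb 12 4 le_rfl
    have h2 := hpow 4 (by norm_num)
    have h3 := hxb 4 4 (by norm_num)
    have h4 : 1 ≤ K ^ 4 := one_le_pow₀ hK
    have h5 : 1536 * (K ^ 12 * x * b ^ 4) * (K ^ 4 * x) ≤ 1536 * (1 / 2000) * (1 / 2000) := by
      gcongr
    rw [e1, hP]
    linarith

/-- The iteration converges for `ε` small with respect to `b⁷`. -/
lemma exists_iterationData {a : ℝ} (ha : a ≠ 0) {ω : Fin d → ℝ} {F : Wiener d ρ} {S : ℝ}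
    (hF : Forcing F ω S) {c : ℕ → ℂ} {r : ℝ} (hr : 0 < r)
    (hc : Summable fun p => ‖c p‖ * r ^ p) :
    ∃ K ≥ 1, 2 / r ≤ K ∧ ∀ (b : ℝ) (ε : ℂ), 0 < b → b ≤ 1 → b * ε.im ^ 2 ≤ |ε.re| → 0 < ‖ε‖ →
      2000 * K ^ 12 * ‖ε‖ ≤ b ^ 7 →
      (∀ ν, resolvent a ω ε ν = ε / divisor a ε (freqDot ω ν)) ∧
      (∀ ν, b * ‖ε‖ ^ 2 / K ≤ ‖divisor a ε (freqDot ω ν)‖) ∧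
      ∃ Pi A θ V P Q U lam, IterationData Pi (multiplier (resolvent a ω ε)) (powerTail c 3)
        (multiplier (resolvent a ω ε) F) (c 2) K A θ V P Q U lam ∧
        U = 4 * K ^ 4 / b ^ 3 * ‖ε‖ ∧ U ≤ 1 / K ∧ P + lam * Q ≤ K ^ 4 := by
  obtain ⟨κ, hκ, -, K₁, hK₁, δ, hδ, hdiv⟩ := exists_divisorBounds ha
  obtain ⟨M, hM, hT⟩ := exists_powerTail_bound (E := Wiener d ρ) hr hc
  have hS : 0 ≤ S := by
    obtain ⟨G, hG, hFG⟩ := hF.bound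
    refine hG.nonneg fun ν => le_trans ?_ (hFG ν).1
    have hw := modeWeight_pos (ρ := ρ) ν
    positivity
  -- One constant dominates all others. The summand 2/r yields U ≤ 1/K ≤ r/2, and 1/δ yields |ε| ≤
  -- δb; the last summand covers both θ and V.
  obtain ⟨K, hKdef⟩ : ∃ K, K = 1 + K₁ + 1 / κ + ‖c 2‖ + M + 2 / r + 1 / δ + 2 * K₁ ^ 2 * S :=
    ⟨_, rfl⟩
  have hK₁0 : 0 < K₁ := by linarith
  have p1 : 0 ≤ 1 / κ := by positivity
  have p2 : 0 ≤ 2 / r := by positivity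
  have p3 : 0 ≤ 1 / δ := by positivity
  have p4 : 0 ≤ 2 * K₁ ^ 2 * S := by positivity
  have p5 := norm_nonneg (c 2)
  have hK1 : 1 ≤ K := by linarith
  have hK0 : 0 < K := by linarith
  refine ⟨K, hK1, by linarith, fun b ε hb0 hb1 hε hε0 hεb => ?_⟩
  have hKδ : ‖ε‖ ≤ δ * b := by
    have h1 : 1 ≤ K * δ := by
      have : (1 / δ) * δ = 1 := by field_simp
      have h2 : 1 / δ ≤ K := by linarith
      calc 1 = (1 / δ) * δ := this.symm
        _ ≤ K * δ := by gcongr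
    have h2 : K ≤ 2000 * K ^ 12 := by
      have := le_self_pow₀ hK1 (n := 12) (by norm_num)
      linarith
    have h3 : b ^ 7 ≤ b := pow_le_of_le_one hb0.le hb1 (by norm_num)
    have h4 : K * ‖ε‖ ≤ b := by
      calc K * ‖ε‖ ≤ 2000 * K ^ 12 * ‖ε‖ := by gcongr
        _ ≤ b := hεb.trans h3
    calc ‖ε‖ ≤ (K * δ) * ‖ε‖ := le_mul_of_one_le_left hε0.le h1
      _ = δ * (K * ‖ε‖) := by ring
      _ ≤ δ * b := by gcongr
  have hD := hdiv b ε hb0 hb1 hε hε0 hKδ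
  refine ⟨hD.resolvent_apply hb0 hε0, fun ν => ?_, ?_⟩
  · rw [div_le_iff₀' hK0]
    refine (hD.lower (freqDot ω ν)).trans ?_
    gcongr
    linarith
  obtain ⟨x, hx⟩ : ∃ x, x = ‖ε‖ / b ^ 7 := ⟨_, rfl⟩
  have hb7 : 0 < b ^ 7 := by positivity
  have hεx : ‖ε‖ = x * b ^ 7 := by rw [hx]; field_simp
  have hx0 : 0 < x := by rw [hx]; positivity
  have hx1 : 2000 * (K ^ 12 * x) ≤ 1 := by
    rw [hx, ← mul_assoc, ← mul_div_assoc, div_le_one hb7]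
    exact hεb
  obtain ⟨q1, q2, q3, q4, q5, q6, q7, q8⟩ := iteration_arithmetic hK1 hb0 hb1 hx0 hx1 rfl rfl rfl
    rfl rfl rfl rfl
  have hUr : 4 * K ^ 4 * x * b ^ 4 ≤ r / 2 := by
    refine q7.trans ?_
    rw [div_le_iff₀ hK0]
    have : (2 / r) * r = 2 := by field_simp
    have h2 : (2 / r) * r ≤ K * r := by gcongr; linarith
    linarith
  refine ⟨restrict (resonantModes a κ ω ε), _, _, _, _, _, _, _,
    ⟨norm_restrict_le _, hD.proj_mul, fun y => ?_, fun y => ?_, fun y => ?_, ?_, ?_,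
      powerTail_zero c 2, fun y z hy hz => ?_, hK0.le, ?_, ?_, ?_, ?_, q6, q1, q2, q3, q4, q5⟩,
    ?_, q7, q8⟩
  · rw [hD.proj_mul_eq]
    refine (norm_restrict_le _ _).trans ((norm_mul_le _ _).trans ?_)
    gcongr
    refine (hF.norm_restrict_resolvent_le hD hb0 hε0 hK₁0).trans ?_
    calc K₁ / b * ‖ε‖ * (2 * K₁ * ‖ε‖) * S = (2 * K₁ ^ 2 * S) * x ^ 2 * b ^ 13 := by
          rw [hεx]; field_simp
      _ ≤ K * x ^ 2 * b ^ 13 := by gcongr; linarith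
  · refine (hD.norm_proj_resolvent_le hb0 hε0 y).trans
      (mul_le_mul_of_nonneg_right ?_ (norm_nonneg _))
    calc K₁ / (b * ‖ε‖) = K₁ / (x * b ^ 8) := by rw [hεx]; congr 1; ring
      _ ≤ K / (x * b ^ 8) := by gcongr; linarith
  · refine (hD.norm_compl_resolvent_le hb0 hε0 hκ y).trans ?_
    gcongr
    linarith
  · refine (hF.norm_resolvent_le hD hb0 hε0 hK₁0).trans ?_
    have h1 : K₁ * S ≤ 2 * K₁ ^ 2 * S := by
      have : K₁ ≤ 2 * K₁ ^ 2 := by nlinarith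
      gcongr
    calc K₁ / b * ‖ε‖ * S = (K₁ * S) * x * b ^ 6 := by rw [hεx]; field_simp
      _ ≤ K * x * b ^ 6 := by gcongr; linarith
  · linarith
  · refine (hT _ y z hUr hy hz).trans ?_
    gcongr
    linarith
  · positivity
  · positivity
  · positivity
  · positivity
  · rw [hεx]; field_simp

end

section

variable {d : ℕ} {ρ : ℝ≥0}

open Wiener

/-! ### Analytic dependence on the parameter -/

section BanachAlgebra

variable {E : Type*} [NormedCommRing E] [NormOneClass E] [NormedAlgebra ℂ E] [CompleteSpace E]

lemma differentiableOn_powerTail {c : ℕ → ℂ} {r : ℝ} (hc : Summable fun p => ‖c p‖ * r ^ p) (k : ℕ)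
    {y : ℂ → E} {s : Set ℂ} (hs : IsOpen s) (hy : DifferentiableOn ℂ y s)
    (hyr : ∀ ε ∈ s, ‖y ε‖ ≤ r) : DifferentiableOn ℂ (fun ε => powerTail c k (y ε)) s := by
  refine Complex.differentiableOn_tsum_of_summable_norm ((summable_nat_add_iff k).mpr hc)
    (fun p => (hy.fun_pow _).fun_const_smul _) hs fun p ε hε => ?_
  rw [norm_smul]
  gcongr
  exact (norm_pow_le _ _).trans (pow_le_pow_left₀ (norm_nonneg _) (hyr ε hε) _)

lemma differentiableOn_iterSeq {c : ℕ → ℂ} {r : ℝ} (hc : Summable fun p => ‖c p‖ * r ^ p)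
    {m : ℂ → E →L[ℂ] E} {w : ℂ → E} {s : Set ℂ} (hs : IsOpen s) (hm : DifferentiableOn ℂ m s)
    (hw : DifferentiableOn ℂ w s)
    (hr : ∀ n, ∀ ε ∈ s, ‖w ε + iterSeq (m ε) (powerTail c 3) (w ε) (c 2) n‖ ≤ r) (n : ℕ) :
    DifferentiableOn ℂ (fun ε => iterSeq (m ε) (powerTail c 3) (w ε) (c 2) n) s := by
  induction n with
  | zero => exact differentiableOn_const 0
  | succ n ih =>
    have h1 := hw.add ih
    exact (hm.clm_apply (((h1.pow 2).const_smul (c 2)).add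
      (differentiableOn_powerTail hc 3 hs h1 (hr n)))).neg

end BanachAlgebra

lemma powerTail_mem_realSubring {c : ℕ → ℝ} {r : ℝ} (hc : Summable fun p => ‖(c p : ℂ)‖ * r ^ p)
    (k : ℕ) {x : Wiener d ρ} (hx : ‖x‖ ≤ r) (hreal : x ∈ realSubring d ρ) :
    powerTail (fun p => (c p : ℂ)) k x ∈ realSubring d ρ :=
  isClosed_realSubring.mem_of_tendsto
    (summable_powerTail hc k hx).hasSum
    (Eventually.of_forall fun _ => sum_mem fun _ _ => real_smul_mem (pow_mem hreal _) _)

lemma resolvent_real {a : ℝ} {ω : Fin d → ℝ} {ε : ℝ}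
    (h : ∀ ν, resolvent a ω ε ν = ε / divisor a ε (freqDot ω ν)) (ν : Fin d → ℤ) :
    resolvent a ω ε (-ν) = starRingEnd ℂ (resolvent a ω ε ν) := by
  rw [h, h, map_div₀, freqDot_neg, divisor_neg, Complex.conj_ofReal]

lemma iterSeq_mem_realSubring {c : ℕ → ℝ} {r : ℝ} (hc : Summable fun p => ‖(c p : ℂ)‖ * r ^ p)
    {φ : Multiplier d} (hφ : ∀ ν, φ (-ν) = starRingEnd ℂ (φ ν)) {w : Wiener d ρ}
    (hw : w ∈ realSubring d ρ)
    (hr : ∀ n, ‖w + iterSeq (multiplier φ) (powerTail (fun p => (c p : ℂ)) 3) w (c 2) n‖ ≤ r)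
    (n : ℕ) :
    iterSeq (multiplier φ) (powerTail (fun p => (c p : ℂ)) 3) w (c 2) n ∈ realSubring d ρ := by
  induction n with
  | zero => exact zero_mem _
  | succ n ih =>
    have h1 := add_mem hw ih
    exact neg_mem (multiplier_mem (add_mem (real_smul_mem (pow_mem h1 2) _)
      (powerTail_mem_realSubring hc 3 (hr n) h1)) hφ)

/-- An open neighbourhood of the parabolic domain. -/
def openParabolicDomain (b τ : ℝ) : Set ℂ := {ε | b * ε.im ^ 2 < |ε.re| ∧ 0 < ‖ε‖ ∧ ‖ε‖ < τ}

lemma isOpen_openParabolicDomain (b τ : ℝ) : IsOpen (openParabolicDomain b τ) := by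
  have h1 : IsOpen {ε : ℂ | b * ε.im ^ 2 < |ε.re|} := isOpen_lt (by fun_prop) (by fun_prop)
  have h2 : IsOpen {ε : ℂ | 0 < ‖ε‖} := isOpen_lt (by fun_prop) (by fun_prop)
  have h3 : IsOpen {ε : ℂ | ‖ε‖ < τ} := isOpen_lt (by fun_prop) (by fun_prop)
  exact h1.inter (h2.inter h3)

/-- The fixed points form an analytic family in the Wiener algebra, whose Fourier coefficients
solve the range equation. -/
lemma exists_analytic_family {a : ℝ} (ha : a ≠ 0) {ω : Fin d → ℝ} {F : Wiener d ρ} {S : ℝ}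
    (hF : Forcing F ω S) (hFreal : F ∈ realSubring d ρ) {c : ℕ → ℝ} {r : ℝ} (hr : 0 < r)
    (hc : Summable fun p => ‖(c p : ℂ)‖ * r ^ p) :
    ∃ K ≥ 1, ∀ b, 0 < b → b ≤ 1 → ∃ y : ℂ → Wiener d ρ,
      DifferentiableOn ℂ y (openParabolicDomain b (b ^ 7 / (2000 * K ^ 12))) ∧
      ∀ ε ∈ openParabolicDomain b (b ^ 7 / (2000 * K ^ 12)),
        ‖y ε‖ ≤ 4 * K ^ 4 / b ^ 3 * ‖ε‖ ∧ ‖y ε‖ ≤ r ∧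
        (∀ ν, divisor a ε (freqDot ω ν) * (y ε).coeff ν =
          ε * (F.coeff ν - (powerTail (fun p => (c p : ℂ)) 2 (y ε)).coeff ν)) ∧
        (ε.im = 0 → y ε ∈ realSubring d ρ) := by
  obtain ⟨K, hK1, hKr, hiter⟩ := exists_iterationData ha hF hr hc
  have hK0 : 0 < K := by linarith
  refine ⟨K, hK1, fun b hb0 hb1 => ?_⟩
  set O := openParabolicDomain b (b ^ 7 / (2000 * K ^ 12)) with hO
  have hKr' : 1 / K ≤ r := by
    rw [div_le_iff₀ hK0]
    rw [div_le_iff₀ hr] at hKr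
    linarith
  have hdata : ∀ ε ∈ O, _ := fun ε hε => hiter b ε hb0 hb1 hε.1.le hε.2.1
    (by have := hε.2.2.le; rwa [le_div_iff₀' (by positivity)] at this)
  set w : ℂ → Wiener d ρ := fun ε => multiplier (resolvent a ω ε) F with hw
  set c' : ℕ → ℂ := fun p => (c p : ℂ) with hc'
  set v : ℕ → ℂ → Wiener d ρ := fun n ε =>
    iterSeq (multiplier (resolvent a ω ε)) (powerTail c' 3) (w ε) (c' 2) n with hv
  have hvr : ∀ n, ∀ ε ∈ O, ‖w ε + v n ε‖ ≤ r := fun n ε hε => by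
    obtain ⟨-, -, Pi, A, θ, V, P, Q, U, lam, hd, -, hU, -⟩ := hdata ε hε
    exact (hd.norm_source_add_iterSeq_le n).trans (hU.trans hKr')
  have hexists : ∀ ε ∈ O, ∃ z : Wiener d ρ, Tendsto (fun n => v n ε) atTop (𝓝 z) ∧
      ‖w ε + z‖ ≤ 4 * K ^ 4 / b ^ 3 * ‖ε‖ ∧ ‖w ε + z‖ ≤ r ∧
      (∀ n, ‖v n ε - z‖ ≤ K ^ 4 * 2 * (1 / 2) ^ n) ∧
      z = iterMap (multiplier (resolvent a ω ε)) (powerTail c' 3) (w ε) (c' 2) z := by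
    intro ε hε
    obtain ⟨-, -, Pi, A, θ, V, P, Q, U, lam, hd, hU1, hU2, hPQ⟩ := hdata ε hε
    obtain ⟨z, hz1, hz2, hz3, hz4⟩ := hd.exists_fixedPoint
    exact ⟨z, hz1, hU1 ▸ hz2, hz2.trans (hU2.trans hKr'), fun n => (hz3 n).trans (by gcongr), hz4⟩
  choose! z hz1 hz2 hz3 hz4 hz5 using hexists
  have hOopen : IsOpen O := isOpen_openParabolicDomain _ _
  have hres : DifferentiableOn ℂ (resolvent a ω) O := fun ε hε => by
    have hre : ε.re ≠ 0 := by
      rw [← abs_pos]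
      exact lt_of_le_of_lt (by positivity) hε.1
    have hpos : 0 < b * ‖ε‖ ^ 2 / K := by
      have := hε.2.1
      positivity
    exact (analyticAt_resolvent hre hpos (hdata ε hε).2.1).differentiableAt.differentiableWithinAt
  have hm : DifferentiableOn ℂ (fun ε => multiplier (ρ := ρ) (resolvent a ω ε)) O :=
    (multiplier (d := d) (ρ := ρ)).differentiable.comp_differentiableOn hres
  have hwd : DifferentiableOn ℂ w O := hm.clm_apply (differentiableOn_const F)
  have hvd : ∀ n, DifferentiableOn ℂ (v n) O := differentiableOn_iterSeq hc hOopen hm hwd hvr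
  -- The bound P + `lam` Q ≤ K⁴ makes the geometric rate independent of ε, so the limit inherits
  -- analyticity.
  have hunif : TendstoUniformlyOn v z atTop O := by
    rw [Metric.tendstoUniformlyOn_iff]
    intro e he
    have hlim : Tendsto (fun n : ℕ => K ^ 4 * 2 * (1 / 2 : ℝ) ^ n) atTop (𝓝 0) := by
      simpa using (tendsto_pow_atTop_nhds_zero_of_lt_one (r := (1 / 2 : ℝ)) (by norm_num)
        (by norm_num)).const_mul (K ^ 4 * 2)
    filter_upwards [hlim.eventually (gt_mem_nhds he)] with n hn ε hε
    rw [dist_comm, dist_eq_norm]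
    exact (hz4 ε hε n).trans_lt hn
  have hzd : DifferentiableOn ℂ z O :=
    hunif.tendstoLocallyUniformlyOn.differentiableOn (Eventually.of_forall hvd) hOopen
  refine ⟨fun ε => w ε + z ε, hwd.add hzd, fun ε hε => ⟨hz2 ε hε, hz3 ε hε, fun ν => ?_, ?_⟩⟩
  · obtain ⟨hra, hDb, -⟩ := hdata ε hε
    have hD : divisor a ε (freqDot ω ν) ≠ 0 := by
      rw [← norm_pos_iff]
      refine lt_of_lt_of_le ?_ (hDb ν)
      have := hε.2.1
      positivity
    -- Quadratic term and cubic tail recombine into the full tail of order two, giving y = (ε/D)(F -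
    -- T₂(y)).
    have h1 : w ε + z ε = multiplier (resolvent a ω ε) (F - powerTail c' 2 (w ε + z ε)) := by
      conv_lhs => rw [hz5 ε hε]
      rw [powerTail_succ hc 2 (hz3 ε hε), iterMap, map_sub, sub_eq_add_neg]
    have h2 : (w ε + z ε).coeff ν = ε / divisor a ε (freqDot ω ν) *
        (F.coeff ν - (powerTail c' 2 (w ε + z ε)).coeff ν) := by
      conv_lhs => rw [h1]
      rw [coeff_multiplier, coeff_sub, hra]
    change _ * (w ε + z ε).coeff ν = _
    rw [h2]
    field_simp
  · intro him
    have hεr : ε = ((ε.re : ℝ) : ℂ) := by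
      apply Complex.ext <;> simp [him]
    obtain ⟨hra, -, -⟩ := hdata ε hε
    have hφ : ∀ ν, resolvent a ω ε (-ν) = starRingEnd ℂ (resolvent a ω ε ν) := by
      rw [hεr] at hra ⊢
      exact resolvent_real hra
    have hwr : w ε ∈ realSubring d ρ := multiplier_mem hFreal hφ
    exact add_mem hwr (isClosed_realSubring.mem_of_tendsto (hz1 ε hε)
      (Eventually.of_forall (iterSeq_mem_realSubring hc hφ hwr fun n => hvr n ε hε)))

/-! ### The differential equation -/

lemma character_ofReal_mul (ω : Fin d → ℝ) (t : ℝ) (ν : Fin d → ℤ) :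
    character (fun k => ((ω k * t : ℝ) : ℂ)) ν = Complex.exp (Complex.I * freqDot ω ν * t) := by
  simp only [character, freqDot]
  congr 1
  push_cast
  rw [mul_assoc, Finset.sum_mul]
  congr 1
  exact Finset.sum_congr rfl fun k _ => by ring

lemma norm_exp_I_mul (s t : ℝ) : ‖Complex.exp (Complex.I * s * t)‖ = 1 := by
  rw [mul_assoc, mul_comm, ← Complex.ofReal_mul, Complex.norm_exp_ofReal_mul_I]

lemma hasDerivAt_tsum_exp {ι : Type*} {c : ι → ℂ} {s : ι → ℝ} (h0 : Summable fun i => ‖c i‖)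
    (h1 : Summable fun i => ‖Complex.I * s i * c i‖) (t : ℝ) :
    HasDerivAt (fun t : ℝ => ∑' i, c i * Complex.exp (Complex.I * s i * t))
      (∑' i, Complex.I * s i * c i * Complex.exp (Complex.I * s i * t)) t := by
  refine hasDerivAt_tsum (𝕜 := ℝ) (F := ℂ) (y₀ := 0)
    (g := fun i (t : ℝ) => c i * Complex.exp (Complex.I * s i * t))
    (g' := fun i (t : ℝ) => Complex.I * s i * c i * Complex.exp (Complex.I * s i * t)) h1 (fun i y => ?_) (fun i y => ?_) ?_ t
  · have h2 : HasDerivAt (fun t : ℝ => Complex.I * s i * (t : ℂ)) (Complex.I * s i) y := by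
      simpa using (Complex.ofRealCLM.hasDerivAt (x := y)).const_mul (Complex.I * s i)
    have h3 := h2.cexp.const_mul (c i)
    rwa [show c i * (Complex.exp (Complex.I * s i * y) * (Complex.I * s i)) =
      Complex.I * s i * c i * Complex.exp (Complex.I * s i * y) by ring] at h3
  · rw [norm_mul, norm_exp_I_mul, mul_one]
  · refine Summable.of_norm ?_
    simpa using h0

lemma abs_freqDot_le (ω : Fin d → ℝ) (ν : Fin d → ℤ) :
    |freqDot ω ν| ≤ (∑ k, |ω k|) * modeLength ν := by
  rw [freqDot, Finset.sum_mul]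
  refine (Finset.abs_sum_le_sum_abs _ _).trans (Finset.sum_le_sum fun k _ => ?_)
  rw [abs_mul]
  gcongr
  rw [← Int.cast_abs, Int.abs_eq_natAbs, Int.cast_natCast]
  exact_mod_cast Finset.single_le_sum (f := fun k => (ν k).natAbs) (fun _ _ => Nat.zero_le _)
    (Finset.mem_univ k)

/-- |ω·ν| grows at most linearly in |ν| and the exponential weight dominates every power, which
permits termwise differentiation in t. -/
lemma summable_freqDot_pow (hρ : 0 < ρ) (ω : Fin d → ℝ) (y : Wiener d ρ) (n : ℕ) :
    Summable fun ν => |freqDot ω ν| ^ n * ‖y.coeff ν‖ := by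
  set Ω := ∑ k, |ω k|
  have hΩ : 0 ≤ Ω := Finset.sum_nonneg fun k _ => abs_nonneg _
  have hρ' : (0 : ℝ) < ρ := hρ
  refine (y.hasSum_norm.summable.mul_left (Ω ^ n * (n.factorial / (ρ : ℝ) ^ n))).of_nonneg_of_le
    (fun ν => by positivity) fun ν => ?_
  have h1 : (ρ * modeLength ν : ℝ) ^ n / n.factorial ≤ modeWeight ρ ν :=
    Real.pow_div_factorial_le_exp _ (by positivity) n
  have h2 : (modeLength ν : ℝ) ^ n ≤ n.factorial / (ρ : ℝ) ^ n * modeWeight ρ ν := by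
    rw [div_le_iff₀ (by positivity), mul_pow] at h1
    rw [div_mul_eq_mul_div, le_div_iff₀ (by positivity)]
    linarith
  calc |freqDot ω ν| ^ n * ‖y.coeff ν‖ ≤ (Ω * modeLength ν) ^ n * ‖y.coeff ν‖ := by
        gcongr
        exact abs_freqDot_le ω ν
    _ ≤ Ω ^ n * (n.factorial / (ρ : ℝ) ^ n * modeWeight ρ ν) * ‖y.coeff ν‖ := by
        rw [mul_pow]; gcongr
    _ = _ := by ring

lemma ofReal_mem_strip (ψ : Fin d → ℝ) : (fun k => (ψ k : ℂ)) ∈ strip d ρ := fun k => by simp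

/-- The linear part of the equation acts diagonally on the Fourier coefficients. -/
lemma exists_derivatives (hρ : 0 < ρ) (ω : Fin d → ℝ) (y : Wiener d ρ) :
    ∃ v w : ℝ → ℂ, (∀ t, HasDerivAt (fun t : ℝ => eval (fun k => ((ω k * t : ℝ) : ℂ)) y) (v t) t) ∧
      (∀ t, HasDerivAt v (w t) t) ∧ ∀ (a : ℝ) (ε : ℂ) (t : ℝ),
        ε * w t + v t + ε * a * eval (fun k => ((ω k * t : ℝ) : ℂ)) y =
          ∑' ν, divisor a ε (freqDot ω ν) * y.coeff ν *
            character (fun k => ((ω k * t : ℝ) : ℂ)) ν := by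
  have h0 := summable_freqDot_pow hρ ω y 0
  have h1 := summable_freqDot_pow hρ ω y 1
  have h2 := summable_freqDot_pow hρ ω y 2
  have s0 : Summable fun ν => ‖y.coeff ν‖ := y.summable_norm_coeff
  have s1 : Summable fun ν => ‖Complex.I * freqDot ω ν * y.coeff ν‖ := by
    simpa using h1
  have s2 : Summable fun ν => ‖Complex.I * freqDot ω ν * (Complex.I * freqDot ω ν * y.coeff ν)‖ := by
    refine h2.congr fun ν => ?_
    simp only [norm_mul, Complex.norm_I, one_mul, Complex.norm_real, Real.norm_eq_abs]
    ring
  refine ⟨fun t => ∑' ν, Complex.I * freqDot ω ν * y.coeff ν *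
      Complex.exp (Complex.I * freqDot ω ν * t),
    fun t => ∑' ν, Complex.I * freqDot ω ν * (Complex.I * freqDot ω ν * y.coeff ν) *
      Complex.exp (Complex.I * freqDot ω ν * t), fun t => ?_, hasDerivAt_tsum_exp s1 s2, ?_⟩
  · simp only [eval, character_ofReal_mul]
    exact hasDerivAt_tsum_exp s0 s1 t
  · intro a ε t
    simp only [eval, character_ofReal_mul]
    have hsum : ∀ {c : (Fin d → ℤ) → ℂ}, (Summable fun ν => ‖c ν‖) →
        Summable fun ν => c ν * Complex.exp (Complex.I * freqDot ω ν * t) := fun hc =>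
      Summable.of_norm (by simpa only [norm_mul, norm_exp_I_mul, mul_one] using hc)
    rw [← tsum_mul_left, ← tsum_mul_left,
      ← ((hsum s2).mul_left ε).tsum_add (hsum s1),
      ← (((hsum s2).mul_left ε).add (hsum s1)).tsum_add ((hsum s0).mul_left (ε * a))]
    refine tsum_congr fun ν => ?_
    rw [divisor]
    push_cast
    linear_combination (ε * freqDot ω ν ^ 2 * y.coeff ν *
      Complex.exp (Complex.I * freqDot ω ν * t)) * Complex.I_sq

end

section

variable {d : ℕ} {ρ : ℝ≥0}

open Wiener

/-! ### The forcing term and the nonlinearity -/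

/-- The oscillating part of an analytic function on the torus as a forcing term. -/
lemma exists_forcing {f : (Fin d → ℝ) → ℝ} {ω : Fin d → ℝ} (hω : RationallyIndependent ω)
    (hper : IsTorusPeriodic f) {ξ : ℝ} (hf : IsAnalyticInStrip f ξ)
    (hlim : Tendsto (epsilonSeq f ω) atTop (𝓝 0)) (hρ : 0 < ρ) (hρξ : 4 * (ρ : ℝ) = ξ) :
    ∃ (F : Wiener d ρ) (S : ℝ), Forcing F ω S ∧ F ∈ realSubring d ρ ∧
      ∀ ψ : Fin d → ℝ, eval (fun k => (ψ k : ℂ)) F = (f ψ : ℂ) - (torusAverage f : ℝ) := by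
  have hρ' : (0 : ℝ) < ρ := hρ
  -- Of the decay rate 3ρ < ξ, the weight consumes ρ and three inverse powers of |ω·ν| ≥ c
  -- e^{-ρ|ν|/3} consume another ρ; the remaining e^{-ρ|ν|} is summable.
  obtain ⟨M, hM, hdecay⟩ := exists_norm_fourierMode_le hper hf (η := 3 * ρ) (by positivity)
    (by linarith)
  obtain ⟨c, hc, hdiv⟩ := exists_le_abs_freqDot hω hlim (η := ρ / 3) (by positivity)
  set q : (Fin d → ℤ) → ℂ := fun ν => if ν = 0 then 0 else fourierMode f ν with hq
  have hqw : ∀ ν, ‖q ν‖ * modeWeight ρ ν ≤ M * Real.exp (-(2 * ρ * modeLength ν)) := fun ν => by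
    have h1 : ‖q ν‖ ≤ ‖fourierMode f ν‖ := by
      rw [hq]
      dsimp only
      split_ifs <;> simp
    calc _ ≤ M * Real.exp (-(3 * ρ * modeLength ν)) * Real.exp (ρ * modeLength ν) := by
          have := modeWeight_pos (ρ := ρ) ν
          exact mul_le_mul_of_nonneg_right (h1.trans (hdecay ν)) this.le
      _ = _ := by rw [mul_assoc, ← Real.exp_add]; congr 2; ring
  have hsum2 : Summable fun ν => ‖q ν‖ * modeWeight ρ ν :=
    ((summable_exp_neg_modeLength (show (0 : ℝ) < 2 * ρ by positivity)).mul_left M).of_nonneg_of_le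
      (fun ν => mul_nonneg (norm_nonneg _) (modeWeight_pos _).le) hqw
  set C := 1 + 1 / c with hC
  have hC1 : 1 ≤ C := le_add_of_nonneg_right (by positivity)
  have hG : Summable fun ν : Fin d → ℤ => 2 * M * C ^ 3 * Real.exp (-(ρ * modeLength ν)) :=
    (summable_exp_neg_modeLength hρ').mul_left _
  refine ⟨ofCoeff q hsum2, _, ⟨fun ν hν => ?_, _, hG.hasSum, fun ν => ?_⟩, fun ν => ?_, fun ψ => ?_⟩
  · rw [coeff_ofCoeff] at hν
    exact hω ν fun h0 => hν (by simp [hq, h0])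
  · rw [coeff_ofCoeff]
    by_cases h0 : q ν = 0
    · rw [h0]
      simp only [norm_zero, zero_mul, and_self]
      positivity
    have hν : ν ≠ 0 := fun h => h0 (by simp [hq, h])
    have hfν : fourierMode f ν ≠ 0 := fun h => h0 (by simp [hq, h])
    have hs := hdiv ν hν hfν
    have hspos : 0 < |freqDot ω ν| := abs_pos.mpr (hω ν hν)
    -- t dominates both 1 and 1/|ω·ν|, so both quantities to be bounded are at most 2t³.
    obtain ⟨t, ht⟩ : ∃ t, t = C * Real.exp (ρ / 3 * modeLength ν) := ⟨_, rfl⟩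
    have hexp1 : 1 ≤ Real.exp (ρ / 3 * modeLength ν) := Real.one_le_exp (by positivity)
    have ht1 : 1 ≤ t := by rw [ht]; exact one_le_mul_of_one_le_of_one_le hC1 hexp1
    have hst : |freqDot ω ν|⁻¹ ≤ t := by
      rw [inv_le_comm₀ hspos (by linarith)]
      refine le_trans ?_ hs
      rw [ht, mul_inv, Real.exp_neg]
      gcongr
      refine inv_le_of_inv_le₀ hc ?_
      rw [hC, one_div]
      linarith
    have hst2 : 1 / freqDot ω ν ^ 2 ≤ t ^ 2 := by
      rw [← sq_abs, one_div, ← inv_pow]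
      gcongr
    have h23 : t ^ 2 ≤ t ^ 3 := pow_le_pow_right₀ ht1 (by norm_num)
    have h12 : 1 ≤ t ^ 2 := one_le_pow₀ ht1
    have e1 : 1 + 1 / freqDot ω ν ^ 2 ≤ 2 * t ^ 3 := by linarith
    have e2 : (1 + 1 / freqDot ω ν ^ 2) * |freqDot ω ν|⁻¹ ≤ 2 * t ^ 3 := by
      calc _ ≤ (2 * t ^ 2) * t := by gcongr; linarith
        _ = _ := by ring
    have e3 : M * Real.exp (-(2 * ρ * modeLength ν)) * (2 * t ^ 3) =
        2 * M * C ^ 3 * Real.exp (-(ρ * modeLength ν)) := by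
      have : Real.exp (-(2 * ρ * modeLength ν)) * Real.exp (ρ / 3 * modeLength ν) ^ 3 =
          Real.exp (-(ρ * modeLength ν)) := by
        rw [← Real.exp_nat_mul, ← Real.exp_add]
        congr 1
        push_cast
        ring
      rw [ht, mul_pow, ← this]
      ring
    constructor
    · rw [← e3]
      exact mul_le_mul (hqw ν) e1 (by positivity) (by positivity)
    · rw [← e3, mul_assoc]
      exact mul_le_mul (hqw ν) e2 (by positivity) (by positivity)
  · rw [coeff_ofCoeff, coeff_ofCoeff, hq]
    simp only [neg_eq_zero]
    split_ifs
    · simp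
    · exact fourierMode_neg f ν
  · have hsummable : Summable (fourierMode f) := by
      refine Summable.of_norm_bounded
        ((summable_exp_neg_modeLength (show (0 : ℝ) < 3 * ρ by positivity)).mul_left M) hdecay
    have h1 := hasSum_fourierMode (continuous_of_isAnalyticInStrip (by linarith) hf) hper
      hsummable ψ
    have h2 := hasSum_ite_eq (0 : Fin d → ℤ) (fourierMode f 0)
    rw [← h1.tsum_eq, ← fourierMode_zero, ← h2.tsum_eq, ← h1.summable.tsum_sub h2.summable, eval]
    refine tsum_congr fun ν => ?_
    rw [coeff_ofCoeff, hq]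
    by_cases h0 : ν = 0
    · simp [h0, character_zero]
    · simp [h0]

/-- The Taylor series of an analytic function. -/
lemma exists_hasSum_taylorCoeff {g : ℝ → ℝ} {c₀ : ℝ} (hg : AnalyticAt ℝ g c₀) :
    ∃ r > 0, (Summable fun p => |taylorCoeff g c₀ p| * r ^ p) ∧
      ∀ y : ℝ, |y| ≤ r → HasSum (fun p => taylorCoeff g c₀ p * y ^ p) (g (c₀ + y)) := by
  obtain ⟨R, hR⟩ := hg.hasFPowerSeriesAt
  obtain ⟨r, hr0, hrR⟩ := ENNReal.lt_iff_exists_nnreal_btwn.mp hR.r_pos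
  have hr0' : (0 : ℝ) < r := by exact_mod_cast hr0
  refine ⟨r, hr0', ?_, fun y hy => ?_⟩
  · have := FormalMultilinearSeries.summable_norm_mul_pow _ (hrR.trans_le hR.r_le)
    simpa [FormalMultilinearSeries.ofScalars_norm, taylorCoeff, abs_div] using this
  · have hmem : y ∈ Metric.eball (0 : ℝ) R := by
      rw [Metric.mem_eball, edist_zero_right, ← ofReal_norm]
      refine lt_of_le_of_lt ?_ hrR
      rw [ENNReal.ofReal_le_iff_le_toReal ENNReal.coe_ne_top]
      simpa using hy
    have := hR.hasSum hmem
    simpa [FormalMultilinearSeries.ofScalars_apply_eq, taylorCoeff, mul_comm] using this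

lemma taylorCoeff_zero (g : ℝ → ℝ) (c₀ : ℝ) : taylorCoeff g c₀ 0 = g c₀ := by simp [taylorCoeff]

lemma taylorCoeff_one (g : ℝ → ℝ) (c₀ : ℝ) : taylorCoeff g c₀ 1 = deriv g c₀ := by
  simp [taylorCoeff, iteratedDeriv_one]

/-- Evaluation on the strip is a continuous algebra homomorphism. -/
lemma eval_powerTail {ψ : Fin d → ℂ} (hψ : ψ ∈ strip d ρ) {c : ℕ → ℂ} {r : ℝ}
    (hc : Summable fun p => ‖c p‖ * r ^ p) (k : ℕ) {y : Wiener d ρ} (hy : ‖y‖ ≤ r) :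
    eval ψ (powerTail c k y) = powerTail c k (eval ψ y) := by
  have := (evalCLM hψ).map_tsum (summable_powerTail hc k hy)
  simp only [evalCLM_apply] at this
  rw [powerTail, this, powerTail]
  refine tsum_congr fun p => ?_
  rw [← evalCLM_apply hψ, map_smul, evalCLM_apply, eval_pow hψ]

lemma complexExtension_eq_powerTail (g : ℝ → ℝ) (c₀ : ℝ) (z : ℂ) :
    complexExtension g c₀ (c₀ + z) = powerTail (fun p => (taylorCoeff g c₀ p : ℂ)) 0 z := by
  simp [complexExtension, powerTail]

/-- A solution of the range equation gives a solution of the differential equation. -/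
lemma isSolution_eval {f : (Fin d → ℝ) → ℝ} {ω : Fin d → ℝ} {g : ℝ → ℝ} {c₀ r : ℝ} {ε : ℂ}
    (hρ : 0 < ρ) {F y : Wiener d ρ} (hc₀ : g c₀ = torusAverage f)
    (hF : ∀ ψ : Fin d → ℝ, eval (fun k => (ψ k : ℂ)) F = (f ψ : ℂ) - (torusAverage f : ℝ))
    (hc : Summable fun p => ‖(taylorCoeff g c₀ p : ℂ)‖ * r ^ p) (hy : ‖y‖ ≤ r)
    (heq : ∀ ν, divisor (deriv g c₀) ε (freqDot ω ν) * y.coeff ν =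
      ε * (F.coeff ν - (powerTail (fun p => (taylorCoeff g c₀ p : ℂ)) 2 y).coeff ν)) :
    IsSolution (complexExtension g c₀) f ω ε
      (fun t => (c₀ : ℂ) + eval (fun k => ((ω k * t : ℝ) : ℂ)) y) := by
  obtain ⟨v, w, hv, hw, hvw⟩ := exists_derivatives hρ ω y
  refine ⟨v, w, fun t => (hv t).const_add _, hw, fun t => ?_⟩
  have hψ : (fun k => ((ω k * t : ℝ) : ℂ)) ∈ strip d ρ := ofReal_mem_strip _
  set ψ : Fin d → ℂ := fun k => ((ω k * t : ℝ) : ℂ) with hψdef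
  have hz : ‖eval ψ y‖ ≤ r := (norm_eval_le hψ y).trans hy
  have h1 := hvw (deriv g c₀) ε t
  have h2 : ∑' ν, divisor (deriv g c₀) ε (freqDot ω ν) * y.coeff ν * character ψ ν =
      ε * (eval ψ F - powerTail (fun p => (taylorCoeff g c₀ p : ℂ)) 2 (eval ψ y)) := by
    rw [← eval_powerTail hψ hc 2 hy, eval, eval,
      ← (summable_eval hψ _).tsum_sub (summable_eval hψ _), ← tsum_mul_left]
    refine tsum_congr fun ν => ?_
    rw [heq]
    ring
  rw [h2, hF (fun k => ω k * t)] at h1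
  -- The Taylor term of order zero cancels the average of f, and the one of order one is the summand
  -- εa already contained in the divisor.
  rw [complexExtension_eq_powerTail, powerTail_succ hc 0 hz, powerTail_succ hc 1 hz,
    taylorCoeff_zero, taylorCoeff_one, hc₀]
  simp only [smul_eq_mul, pow_zero, mul_one, pow_one]
  change ε * w t + v t + _ = ε * ((f fun k => ω k * t : ℝ) : ℂ)
  linear_combination h1

/-- Real Fourier series give real solutions of the original equation. -/
lemma exists_real_solution {f : (Fin d → ℝ) → ℝ} {ω : Fin d → ℝ} {g : ℝ → ℝ} {c₀ r : ℝ} {ε : ℝ}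
    {y : Wiener d ρ} (hreal : y ∈ realSubring d ρ) (hy : ‖y‖ ≤ r)
    (hg : ∀ x : ℝ, |x| ≤ r → HasSum (fun p => taylorCoeff g c₀ p * x ^ p) (g (c₀ + x)))
    (hsol : IsSolution (complexExtension g c₀) f ω (ε : ℂ)
      (fun t => (c₀ : ℂ) + eval (fun k => ((ω k * t : ℝ) : ℂ)) y)) :
    ∃ x : ℝ → ℝ, (∀ t, (x t : ℂ) = (c₀ : ℂ) + eval (fun k => ((ω k * t : ℝ) : ℂ)) y) ∧
      IsSolution g f ω ε x := by
  obtain ⟨v, w, hv, hw, hvw⟩ := hsol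
  have hz : ∀ t : ℝ, (((eval (fun k => ((ω k * t : ℝ) : ℂ)) y).re : ℝ) : ℂ) =
      eval (fun k => ((ω k * t : ℝ) : ℂ)) y := fun t =>
    Complex.conj_eq_iff_re.mp (conj_eval hreal fun k => ω k * t)
  have hx : ∀ t : ℝ, ((c₀ + (eval (fun k => ((ω k * t : ℝ) : ℂ)) y).re : ℝ) : ℂ) =
      (c₀ : ℂ) + eval (fun k => ((ω k * t : ℝ) : ℂ)) y := fun t => by
    rw [Complex.ofReal_add, hz]
  refine ⟨fun t => c₀ + (eval (fun k => ((ω k * t : ℝ) : ℂ)) y).re, hx,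
    fun t => (v t).re, fun t => (w t).re, fun t => ?_, fun t => ?_, fun t => ?_⟩
  · have := Complex.reCLM.hasFDerivAt.comp_hasDerivAt t (hv t)
    simpa [Function.comp_def] using this
  · have := Complex.reCLM.hasFDerivAt.comp_hasDerivAt t (hw t)
    simpa [Function.comp_def] using this
  · have hzr : |(eval (fun k => ((ω k * t : ℝ) : ℂ)) y).re| ≤ r :=
      (Complex.abs_re_le_norm _).trans ((norm_eval_le (ofReal_mem_strip fun k => ω k * t) y).trans hy)
    have hext : complexExtension g c₀ ((c₀ : ℂ) + eval (fun k => ((ω k * t : ℝ) : ℂ)) y) =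
        (g (c₀ + (eval (fun k => ((ω k * t : ℝ) : ℂ)) y).re) : ℂ) := by
      rw [← (hg _ hzr).tsum_eq, complexExtension, Complex.ofReal_tsum]
      refine tsum_congr fun p => ?_
      rw [add_sub_cancel_left, Complex.ofReal_mul, Complex.ofReal_pow, hz]
    have h1 := hvw t
    dsimp only at h1
    rw [hext] at h1
    have h2 := congrArg Complex.re h1
    simpa using h2

/-- The parabolic domain lies inside the open domain of existence. -/
lemma parabolicDomain_subset {B τ : ℝ} (hB : 0 < B) (hτ : 0 < τ) :
    parabolicDomain (τ / 512 * min B 1 ^ 8) B ⊆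
      openParabolicDomain (min B 1 / 2) ((min B 1 / 2) ^ 7 * τ) := by
  intro ε hε
  obtain ⟨h1, h2, h3⟩ := hε
  have hm0 : 0 < min B 1 := lt_min hB one_pos
  have hm1 : min B 1 ≤ 1 := min_le_right _ _
  refine ⟨?_, h2, h3.trans_le ?_⟩
  -- Halving min(B, 1) makes the parabolic inequality strict off the real axis; on the axis it is
  -- strict because Re ε ≠ 0.
  · rcases eq_or_ne ε.im 0 with him | him
    · rw [him]
      have : ε.re ≠ 0 := fun hre => (norm_pos_iff.mp h2) (Complex.ext hre him)
      simpa using this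
    · refine lt_of_lt_of_le ?_ h1
      have : 0 < ε.im ^ 2 := by positivity
      have : min B 1 / 2 < B := by linarith [min_le_left B 1]
      gcongr
  -- The outer radius 2·τ/512 times min(B, 1)^8 is at most τ/2^7 times min(B, 1)^7.
  · have : min B 1 ^ 8 ≤ min B 1 ^ 7 := pow_le_pow_of_le_one hm0.le hm1 (by norm_num)
    rw [div_pow]
    have h7 : 0 < min B 1 ^ 7 := by positivity
    nlinarith

/-- The response solution of the strongly damped quasi-periodically forced equation. -/
theorem exists_isAnalyticResponse {d : ℕ} (ω : Fin d → ℝ)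
    (hω : RationallyIndependent ω)
    (g : ℝ → ℝ) (hg : AnalyticOnNhd ℝ g Set.univ)
    (f : (Fin d → ℝ) → ℝ) (hper : IsTorusPeriodic f)
    (ξ : ℝ) (hξ : 0 < ξ) (hf : IsAnalyticInStrip f ξ)
    (c₀ : ℝ) (hc₀ : g c₀ = torusAverage f) (ha : deriv g c₀ ≠ 0)
    (hlim : Tendsto (epsilonSeq f ω) atTop (𝓝 0)) :
    ∃ ε₁ : ℝ, 0 < ε₁ ∧ ∃ ξ' : ℝ, 0 < ξ' ∧ ξ' < ξ ∧
      ∀ B : ℝ, 0 < B → ∃ u : (Fin d → ℂ) → ℂ → ℂ,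
        IsAnalyticResponse g f ω c₀ ξ' (ε₁ * min B 1 ^ 8) B u := by
  obtain ⟨r, hr, hsum, htaylor⟩ := exists_hasSum_taylorCoeff (hg c₀ trivial)
  obtain ⟨ρ, hρdef⟩ : ∃ ρ : ℝ≥0, (ρ : ℝ) = ξ / 4 := ⟨_, Real.coe_toNNReal _ (by positivity)⟩
  have hρξ : 4 * (ρ : ℝ) = ξ := by rw [hρdef]; ring
  have hρ : 0 < ρ := by
    rw [← NNReal.coe_pos]
    linarith
  have hρ' : (0 : ℝ) < ρ := hρ
  obtain ⟨F, S, hF, hFreal, hFeval⟩ := exists_forcing (ρ := ρ) hω hper hf hlim hρ hρξ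
  have hc : Summable fun p => ‖(taylorCoeff g c₀ p : ℂ)‖ * r ^ p := by
    simpa only [Complex.norm_real, Real.norm_eq_abs] using hsum
  obtain ⟨K, hK, hfam⟩ := exists_analytic_family ha hF hFreal hr hc
  have hτ : 0 < 1 / (2000 * K ^ 12) := by positivity
  -- The width ρ/2 puts the closed strip inside the open strip of width ρ, where the evaluation is
  -- analytic. Neither constant involves B, since K does not.
  refine ⟨1 / (2000 * K ^ 12) / 512, by positivity, ρ / 2, by positivity, by linarith,
    fun B hB => ?_⟩
  have hm0 : 0 < min B 1 := lt_min hB one_pos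
  obtain ⟨y, hyd, hy⟩ := hfam (min B 1 / 2) (by positivity) (by linarith [min_le_right B 1])
  have hsub := parabolicDomain_subset hB hτ
  rw [mul_one_div] at hsub
  have hstrip : ∀ ψ ∈ strip d (ρ / 2 : ℝ), ψ ∈ strip d ρ := fun ψ hψ k =>
    (hψ k).trans (by linarith)
  have hsol : ∀ ε ∈ parabolicDomain (1 / (2000 * K ^ 12) / 512 * min B 1 ^ 8) B,
      IsSolution (complexExtension g c₀) f ω ε
        (fun t => (c₀ : ℂ) + eval (fun k => ((ω k * t : ℝ) : ℂ)) (y ε)) := fun ε hε =>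
    isSolution_eval hρ hc₀ hFeval hc (hy ε (hsub hε)).2.1 (hy ε (hsub hε)).2.2.1
  refine ⟨fun ψ ε => eval ψ (y ε), ?_, ?_, ?_, ?_, hsol, ?_⟩
  · rintro ⟨ψ, ε⟩ ⟨hψ, hε⟩
    exact analyticAt_eval (fun k => (hψ k).trans_lt (by linarith))
      (hyd.analyticAt ((isOpen_openParabolicDomain _ _).mem_nhds (hsub hε)))
  · exact fun ε _ ψ _ k => eval_add_single ψ k (y ε)
  · exact ⟨_, fun ε hε ψ hψ => (norm_eval_le (hstrip ψ hψ) _).trans (hy ε (hsub hε)).1⟩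
  · exact ⟨r, hr, hsum, fun ε hε ψ hψ =>
      (norm_eval_le (hstrip ψ hψ) _).trans (hy ε (hsub hε)).2.1⟩
  · intro ε hε
    exact exists_real_solution ((hy ε (hsub hε)).2.2.2 (Complex.ofReal_im ε))
      (hy ε (hsub hε)).2.1 htaylor (hsol ε hε)

end

end ResponseSolution

end

theorem theorem2 {d : ℕ} (hd : 1 ≤ d) (ω : Fin d → ℝ)
    (hω : ResponseSolution.RationallyIndependent ω)
    (g : ℝ → ℝ) (hg : AnalyticOnNhd ℝ g Set.univ)
    (f : (Fin d → ℝ) → ℝ) (hper : ResponseSolution.IsTorusPeriodic f)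
    (ξ : ℝ) (hξ : 0 < ξ) (hf : ResponseSolution.IsAnalyticInStrip f ξ)
    (c₀ : ℝ) (hc₀ : g c₀ = ResponseSolution.torusAverage f) (ha : deriv g c₀ ≠ 0)
    (hlim : Tendsto (ResponseSolution.epsilonSeq f ω) atTop (𝓝 0)) :
    ∃ ε₁ : ℝ, 0 < ε₁ ∧ ∃ ξ' : ℝ, 0 < ξ' ∧ ξ' < ξ ∧
      ∀ B : ℝ, 0 < B → ∃ u : (Fin d → ℂ) → ℂ → ℂ,
        ResponseSolution.IsAnalyticResponse g f ω c₀ ξ' (ε₁ * min B 1 ^ 8) B u := by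
  exact ResponseSolution.exists_isAnalyticResponse ω hω g hg f hper ξ hξ hf c₀ hc₀ ha hlim
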